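/- Let $B>0$, let $d=2$ or $d=3$, and let $\mathbf A(x,y)=\tfrac12(-y,x)$ if $d=2$ and $\mathbf A(x,y,t)=\tfrac12(-y,x,0)$ if $d=3$. Let $\Omega\subset\mathbb R^d$ be a domain (a non-empty connected open set) of finite Lebesgue measure. With $\mathbf D=-i\nabla$ let $$H^1_{B\mathbf A}(\Omega)=\{u\in L_2(\Omega)\cap H^1_{\rm loc}(\Omega):\ (\mathbf D-B\mathbf A)u\in L_2(\Omega)\},$$ with norm $(\|(\mathbf D-B\mathbf A)u\|^2+\|u\|^2)^{1/2}$ (complex-valued functions), and let $\mathring H^1_{B\mathbf A}(\Omega)$ be the closure of $C_0^\infty(\Omega)$ in $H^1_{B\mathbf A}(\Omega)$. Let $H^D_\Omega(B)$ and $H^N_\Omega(B)$ be the self-adjoint operators in $L_2(\Omega)$ corresponding to the quadratic form $\|(\mathbf D-B\mathbf A)u\|^2$ with form domains $\mathring H^1_{B\mathbf A}(\Omega)$ and $H^1_{B\mathbf A}(\Omega)$, respectively. Assume that the embedding $H^1_{B\mathbf A}(\Omega)\subset L_2(\Omega)$ is compact. Eigenvalues are counted with multiplicity, and $\lambda_1(H)\le\lambda_2(H)\le\dots$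 denote the eigenvalues of $H$ in increasing order. 1. Let $d=2$, let $k\ge 1$ and $j\ge 0$ be integers, and assume that $H^D_\Omega(B)$ has (at least) $j$ eigenvalues less than or equal to $B(2k-1)$. Then $H^N_\Omega(B)$ has at least $j+1$ eigenvalues less than $B(2k-1)$. 2. Let $d=3$. Then for every integer $j\ge 1$ the eigenvalues $\lambda_{j+1}(H^N_\Omega(B))$ and $\lambda_j(H^D_\Omega(B))$ exist and $\lambda_{j+1}(H^N_\Omega(B))<\lambda_j(H^D_\Omega(B))$. -/

import Mathlib

open MeasureTheory TopologicalSpace Set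
open scoped Distributions ENNReal ContDiff

noncomputable section

namespace Landau

/-- The complex Hilbert space `L₂(Ω)`, with respect to Lebesgue measure. -/
abbrev L2 {d : ℕ} (Ω : Opens (EuclideanSpace ℝ (Fin d))) : Type :=
  Lp ℂ 2 (volume.restrict (Ω : Set (EuclideanSpace ℝ (Fin d))))

/-- `g` is locally square integrable on `Ω`. -/
def MemL2loc {d : ℕ} (Ω : Opens (EuclideanSpace ℝ (Fin d)))
    (g : EuclideanSpace ℝ (Fin d) → ℂ) : Prop :=
  ∀ K : Set (EuclideanSpace ℝ (Fin d)), K ⊆ Ω → IsCompact K → MemLp g 2 (volume.restrict K)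

/-- `u` belongs to `H¹_loc(Ω)` and its distributional gradient on `Ω` is `(g 0, …, g (d-1))`. -/
structure HasWeakGradient {d : ℕ} (Ω : Opens (EuclideanSpace ℝ (Fin d)))
    (u : EuclideanSpace ℝ (Fin d) → ℂ) (g : Fin d → EuclideanSpace ℝ (Fin d) → ℂ) : Prop where
  memL2loc : MemL2loc Ω u
  grad_memL2loc : ∀ j, MemL2loc Ω (g j)
  integral_eq : ∀ (j : Fin d) (φ : 𝓓(Ω, ℂ)),
    ∫ z in (Ω : Set (EuclideanSpace ℝ (Fin d))),
        u z * fderiv ℝ φ z (EuclideanSpace.single j (1 : ℝ))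
      = - ∫ z in (Ω : Set (EuclideanSpace ℝ (Fin d))), g j z * φ z

/-! ### Integrability facts -/

theorem MemL2loc.integrable_mul {d : ℕ} {Ω : Opens (EuclideanSpace ℝ (Fin d))}
    {g : EuclideanSpace ℝ (Fin d) → ℂ} (hg : MemL2loc Ω g) {ψ : EuclideanSpace ℝ (Fin d) → ℂ}
    (hψ : Continuous ψ) (hc : HasCompactSupport ψ) (hs : tsupport ψ ⊆ Ω) :
    Integrable (fun z => g z * ψ z) (volume.restrict (Ω : Set (EuclideanSpace ℝ (Fin d)))) := by
  have h1 : IntegrableOn (fun z => g z * ψ z) (tsupport ψ) volume := by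
    have h2 : MemLp ψ 2 (volume.restrict (tsupport ψ)) :=
      (hψ.memLp_of_hasCompactSupport (μ := volume) hc).restrict _
    have h3 := (hg _ hs hc).integrable_mul h2
    exact h3
  have h4 : Integrable (fun z => g z * ψ z) volume := by
    rw [← integrableOn_iff_integrable_of_support_subset (s := tsupport ψ)]
    · exact h1
    · intro z hz
      apply subset_tsupport ψ
      intro h0
      exact hz (by simp [h0])
  exact h4.restrict

theorem MemL2loc.integrable_mul_test {d : ℕ} {Ω : Opens (EuclideanSpace ℝ (Fin d))}
    {g : EuclideanSpace ℝ (Fin d) → ℂ} (hg : MemL2loc Ω g) (φ : 𝓓(Ω, ℂ)) :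
    Integrable (fun z => g z * φ z) (volume.restrict (Ω : Set (EuclideanSpace ℝ (Fin d)))) :=
  hg.integrable_mul φ.continuous φ.hasCompactSupport φ.tsupport_subset

theorem MemL2loc.integrable_mul_fderiv {d : ℕ} {Ω : Opens (EuclideanSpace ℝ (Fin d))}
    {g : EuclideanSpace ℝ (Fin d) → ℂ} (hg : MemL2loc Ω g) (φ : 𝓓(Ω, ℂ))
    (v : EuclideanSpace ℝ (Fin d)) :
    Integrable (fun z => g z * fderiv ℝ φ z v)
      (volume.restrict (Ω : Set (EuclideanSpace ℝ (Fin d)))) := by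
  have hts : tsupport (fun z => fderiv ℝ φ z v) ⊆ tsupport φ := tsupport_fderiv_apply_subset ℝ v
  refine hg.integrable_mul ?_ (φ.hasCompactSupport.fderiv_apply ℝ v) (hts.trans φ.tsupport_subset)
  exact (φ.contDiff.continuous_fderiv (by simp)).clm_apply continuous_const

theorem MemL2loc.congr {d : ℕ} {Ω : Opens (EuclideanSpace ℝ (Fin d))}
    {u v : EuclideanSpace ℝ (Fin d) → ℂ} (hu : MemL2loc Ω u)
    (h : u =ᵐ[volume.restrict (Ω : Set (EuclideanSpace ℝ (Fin d)))] v) : MemL2loc Ω v :=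
  fun K hK hKc => (hu K hK hKc).ae_eq (ae_restrict_of_ae_restrict_of_subset hK h)

theorem HasWeakGradient.congr {d : ℕ} {Ω : Opens (EuclideanSpace ℝ (Fin d))}
    {u v : EuclideanSpace ℝ (Fin d) → ℂ} {g : Fin d → EuclideanSpace ℝ (Fin d) → ℂ}
    (hu : HasWeakGradient Ω u g)
    (h : u =ᵐ[volume.restrict (Ω : Set (EuclideanSpace ℝ (Fin d)))] v) :
    HasWeakGradient Ω v g where
  memL2loc := hu.memL2loc.congr h
  grad_memL2loc := hu.grad_memL2loc
  integral_eq j φ := by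
    rw [← hu.integral_eq j φ]
    refine integral_congr_ae ?_
    filter_upwards [h] with z hz
    rw [hz]

theorem HasWeakGradient.add {d : ℕ} {Ω : Opens (EuclideanSpace ℝ (Fin d))}
    {u v : EuclideanSpace ℝ (Fin d) → ℂ} {g h : Fin d → EuclideanSpace ℝ (Fin d) → ℂ}
    (hu : HasWeakGradient Ω u g) (hv : HasWeakGradient Ω v h) :
    HasWeakGradient Ω (u + v) (g + h) where
  memL2loc K hK hKc := (hu.memL2loc K hK hKc).add (hv.memL2loc K hK hKc)
  grad_memL2loc j K hK hKc := (hu.grad_memL2loc j K hK hKc).add (hv.grad_memL2loc j K hK hKc)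
  integral_eq j φ := by
    simp only [Pi.add_apply, add_mul]
    rw [integral_add (hu.memL2loc.integrable_mul_fderiv φ _)
      (hv.memL2loc.integrable_mul_fderiv φ _), hu.integral_eq, hv.integral_eq,
      integral_add ((hu.grad_memL2loc j).integrable_mul_test φ)
      ((hv.grad_memL2loc j).integrable_mul_test φ), neg_add]

theorem HasWeakGradient.const_smul {d : ℕ} {Ω : Opens (EuclideanSpace ℝ (Fin d))}
    {u : EuclideanSpace ℝ (Fin d) → ℂ} {g : Fin d → EuclideanSpace ℝ (Fin d) → ℂ}
    (hu : HasWeakGradient Ω u g) (c : ℂ) : HasWeakGradient Ω (c • u) (c • g) where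
  memL2loc K hK hKc := (hu.memL2loc K hK hKc).const_smul c
  grad_memL2loc j K hK hKc := (hu.grad_memL2loc j K hK hKc).const_smul c
  integral_eq j φ := by
    simp only [Pi.smul_apply, smul_eq_mul, mul_assoc]
    rw [integral_const_mul, integral_const_mul, hu.integral_eq, mul_neg]

theorem HasWeakGradient.zero {d : ℕ} {Ω : Opens (EuclideanSpace ℝ (Fin d))} :
    HasWeakGradient Ω (0 : EuclideanSpace ℝ (Fin d) → ℂ) 0 where
  memL2loc _ _ _ := MemLp.zero
  grad_memL2loc _ _ _ _ := MemLp.zero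
  integral_eq j φ := by simp

theorem MemL2loc.ae_eq_zero {d : ℕ} {Ω : Opens (EuclideanSpace ℝ (Fin d))}
    {f : EuclideanSpace ℝ (Fin d) → ℂ} (hf : MemL2loc Ω f)
    (h : ∀ g : EuclideanSpace ℝ (Fin d) → ℝ, ContDiff ℝ ∞ g → HasCompactSupport g →
      tsupport g ⊆ Ω → ∫ z in (Ω : Set (EuclideanSpace ℝ (Fin d))), f z * (g z : ℂ) = 0) :
    f =ᵐ[volume.restrict (Ω : Set (EuclideanSpace ℝ (Fin d)))] 0 := by
  have hloc : LocallyIntegrableOn f (Ω : Set (EuclideanSpace ℝ (Fin d))) volume := by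
    rw [locallyIntegrableOn_iff Ω.isOpen.isLocallyClosed]
    intro K hK hKc
    have : IsFiniteMeasure (volume.restrict K) := ⟨by simpa using hKc.measure_lt_top⟩
    exact (hf K hK hKc).integrable (by norm_num)
  have := Ω.isOpen.ae_eq_zero_of_integral_contDiff_smul_eq_zero (μ := volume) hloc ?_
  · exact (ae_restrict_iff' Ω.isOpen.measurableSet).2 this
  · intro g hg hgc hgs
    rw [← h g hg hgc hgs, setIntegral_eq_integral_of_forall_compl_eq_zero]
    · refine integral_congr_ae (Filter.Eventually.of_forall fun z => ?_)
      simp [mul_comm]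
    · intro z hz
      have : g z = 0 := by
        by_contra h0
        exact hz (hgs (subset_tsupport g h0))
      simp [this]

/-- A smooth compactly supported real function as a complex test function. -/
def realTest {d : ℕ} {Ω : Opens (EuclideanSpace ℝ (Fin d))} (g : EuclideanSpace ℝ (Fin d) → ℝ)
    (hg : ContDiff ℝ ∞ g) (hgc : HasCompactSupport g) (hgs : tsupport g ⊆ Ω) : 𝓓(Ω, ℂ) where
  toFun z := (g z : ℂ)
  contDiff' := Complex.ofRealCLM.contDiff.comp hg
  hasCompactSupport' := hgc.comp_left (g := fun x : ℝ => (x : ℂ)) (by simp)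
  tsupport_subset' := (tsupport_comp_subset (g := fun x : ℝ => (x : ℂ)) (by simp) g).trans hgs

theorem HasWeakGradient.unique {d : ℕ} {Ω : Opens (EuclideanSpace ℝ (Fin d))}
    {u : EuclideanSpace ℝ (Fin d) → ℂ} {g h : Fin d → EuclideanSpace ℝ (Fin d) → ℂ}
    (hg : HasWeakGradient Ω u g) (hh : HasWeakGradient Ω u h) (j : Fin d) :
    g j =ᵐ[volume.restrict (Ω : Set (EuclideanSpace ℝ (Fin d)))] h j := by
  have hd : MemL2loc Ω (g j - h j) := fun K hK hKc =>
    (hg.grad_memL2loc j K hK hKc).sub (hh.grad_memL2loc j K hK hKc)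
  have := hd.ae_eq_zero (fun ψ h1 h2 h3 => ?_)
  · filter_upwards [this] with z hz
    exact sub_eq_zero.1 hz
  · have e1 := hg.integral_eq j (realTest ψ h1 h2 h3)
    have e2 := hh.integral_eq j (realTest ψ h1 h2 h3)
    have i1 := (hg.grad_memL2loc j).integrable_mul_test (realTest ψ h1 h2 h3)
    have i2 := (hh.grad_memL2loc j).integrable_mul_test (realTest ψ h1 h2 h3)
    have e3 := integral_sub i1 i2
    rw [neg_eq_iff_eq_neg.1 (e1.symm.trans e2), neg_neg, sub_self] at e3
    rw [← e3]
    refine integral_congr_ae (Filter.Eventually.of_forall fun z => ?_)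
    exact sub_mul _ _ _

theorem memL2loc_of_Lp {d : ℕ} {Ω : Opens (EuclideanSpace ℝ (Fin d))} (f : L2 Ω) :
    MemL2loc Ω f :=
  fun _ hK _ => (Lp.memLp f).mono_measure (Measure.restrict_mono hK le_rfl)

/-! ### The magnetic Sobolev spaces -/

/-- The magnetic Sobolev space `H¹_a(Ω)` of all `u ∈ L₂(Ω) ∩ H¹_loc(Ω)` with
`(-i∇ - a)u ∈ L₂(Ω)`. An element is the pair of `u` and `(-i∇ - a)u`; the second entry is
determined by the first one (`magneticH1_ext` below), and the norm inherited from the ambient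
`ℓ²` product is `(‖u‖² + ‖(-i∇ - a)u‖²)^(1/2)`. -/
def magneticH1 {d : ℕ} (Ω : Opens (EuclideanSpace ℝ (Fin d)))
    (a : EuclideanSpace ℝ (Fin d) → EuclideanSpace ℝ (Fin d)) :
    Submodule ℂ (WithLp 2 (L2 Ω × PiLp 2 (fun _ : Fin d => L2 Ω))) where
  carrier := {p | ∃ g : Fin d → EuclideanSpace ℝ (Fin d) → ℂ, HasWeakGradient Ω p.fst g ∧
    ∀ j : Fin d, p.snd j =ᵐ[volume.restrict (Ω : Set (EuclideanSpace ℝ (Fin d)))]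
      fun z => -Complex.I * g j z - (a z j : ℂ) * p.fst z}
  add_mem' := by
    rintro p q ⟨g, hg, hpg⟩ ⟨h, hh, hqh⟩
    refine ⟨g + h, (hg.add hh).congr (Lp.coeFn_add p.fst q.fst).symm, fun j => ?_⟩
    filter_upwards [hpg j, hqh j, Lp.coeFn_add p.fst q.fst,
      Lp.coeFn_add (p.snd j) (q.snd j)] with z h1 h2 h3 h4
    rw [WithLp.add_snd, PiLp.add_apply, h4, WithLp.add_fst, h3]
    simp only [Pi.add_apply, h1, h2]
    ring
  zero_mem' := by
    refine ⟨0, HasWeakGradient.zero.congr (Lp.coeFn_zero ℂ 2 _).symm, fun j => ?_⟩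
    filter_upwards [AEEqFun.coeFn_zero (β := ℂ)
      (μ := volume.restrict (Ω : Set (EuclideanSpace ℝ (Fin d))))] with z h1
    simp [h1]
  smul_mem' := by
    rintro c p ⟨g, hg, hpg⟩
    refine ⟨c • g, (hg.const_smul c).congr (Lp.coeFn_smul c p.fst).symm, fun j => ?_⟩
    filter_upwards [hpg j, Lp.coeFn_smul c p.fst, Lp.coeFn_smul c (p.snd j)] with z h1 h3 h4
    rw [WithLp.smul_snd, PiLp.smul_apply, h4, WithLp.smul_fst, h3]
    simp only [Pi.smul_apply, smul_eq_mul, h1]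
    ring

/-- The embedding `H¹_a(Ω) ⊂ L₂(Ω)`. -/
def embedding {d : ℕ} (Ω : Opens (EuclideanSpace ℝ (Fin d)))
    (a : EuclideanSpace ℝ (Fin d) → EuclideanSpace ℝ (Fin d)) :
    magneticH1 Ω a →L[ℂ] L2 Ω :=
  (WithLp.fstL 2 ℂ (L2 Ω) (PiLp 2 (fun _ : Fin d => L2 Ω))).comp (magneticH1 Ω a).subtypeL

theorem magneticH1_ext {d : ℕ} {Ω : Opens (EuclideanSpace ℝ (Fin d))}
    {a : EuclideanSpace ℝ (Fin d) → EuclideanSpace ℝ (Fin d)} {p q : magneticH1 Ω a}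
    (h : embedding Ω a p = embedding Ω a q) : p = q := by
  obtain ⟨p, g, hg, hp⟩ := p
  obtain ⟨q, k, hk, hq⟩ := q
  have h' : p.fst = q.fst := h
  rw [← h'] at hk
  have h2 : p.snd = q.snd := by
    ext j : 1
    refine Lp.ext ?_
    filter_upwards [hp j, hq j, hg.unique hk j] with z h1 h2 h3
    rw [h1, h2, h3, h']
  exact Subtype.ext (WithLp.ofLp_injective 2 (Prod.ext h' h2))

/-- The covariant gradient `u ↦ (-i∇ - a)u` from `H¹_a(Ω)` to `L₂(Ω)ᵈ`. -/
def covariantGradient {d : ℕ} (Ω : Opens (EuclideanSpace ℝ (Fin d)))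
    (a : EuclideanSpace ℝ (Fin d) → EuclideanSpace ℝ (Fin d)) :
    magneticH1 Ω a →L[ℂ] PiLp 2 (fun _ : Fin d => L2 Ω) :=
  (WithLp.sndL 2 ℂ (L2 Ω) (PiLp 2 (fun _ : Fin d => L2 Ω))).comp (magneticH1 Ω a).subtypeL

/-- The elements of `H¹_a(Ω)` that belong to `C₀^∞(Ω)`. -/
def testSubspace {d : ℕ} (Ω : Opens (EuclideanSpace ℝ (Fin d)))
    (a : EuclideanSpace ℝ (Fin d) → EuclideanSpace ℝ (Fin d)) :
    Submodule ℂ (magneticH1 Ω a) where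
  carrier := {p | ∃ φ : 𝓓(Ω, ℂ),
    embedding Ω a p =ᵐ[volume.restrict (Ω : Set (EuclideanSpace ℝ (Fin d)))] φ}
  add_mem' := by
    rintro p q ⟨φ, hφ⟩ ⟨ψ, hψ⟩
    refine ⟨φ + ψ, ?_⟩
    rw [map_add]
    filter_upwards [hφ, hψ, Lp.coeFn_add (embedding Ω a p) (embedding Ω a q)] with z h1 h2 h3
    rw [h3]
    simp [h1, h2]
  zero_mem' := by
    refine ⟨0, ?_⟩
    rw [map_zero]
    filter_upwards [AEEqFun.coeFn_zero (β := ℂ)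
      (μ := volume.restrict (Ω : Set (EuclideanSpace ℝ (Fin d))))] with z h1
    simp [h1]
  smul_mem' := by
    rintro c p ⟨φ, hφ⟩
    refine ⟨c • φ, ?_⟩
    rw [map_smul]
    filter_upwards [hφ, Lp.coeFn_smul c (embedding Ω a p)] with z h1 h2
    rw [h2]
    simp [h1]

/-- The closure of `C₀^∞(Ω)` in `H¹_a(Ω)`. -/
def magneticH10 {d : ℕ} (Ω : Opens (EuclideanSpace ℝ (Fin d)))
    (a : EuclideanSpace ℝ (Fin d) → EuclideanSpace ℝ (Fin d)) :
    Submodule ℂ (magneticH1 Ω a) :=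
  (testSubspace Ω a).topologicalClosure

/-! ### The operators of the quadratic form -/

/-- The graph of the operator in `L₂(Ω)` that corresponds to the quadratic form
`‖(-i∇ - a)u‖²` with form domain `Q`: all pairs `(u, f)` with `u ∈ Q` and
`⟨(-i∇ - a)w, (-i∇ - a)u⟩ = ⟨w, f⟩` for all `w ∈ Q`. -/
def formGraph {d : ℕ} {Ω : Opens (EuclideanSpace ℝ (Fin d))}
    {a : EuclideanSpace ℝ (Fin d) → EuclideanSpace ℝ (Fin d)}
    (Q : Submodule ℂ (magneticH1 Ω a)) : Submodule ℂ (L2 Ω × L2 Ω) where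
  carrier := {q | ∃ p ∈ Q, embedding Ω a p = q.1 ∧ ∀ w ∈ Q,
    inner ℂ (covariantGradient Ω a w) (covariantGradient Ω a p) = inner ℂ (embedding Ω a w) q.2}
  add_mem' := by
    rintro q r ⟨p, hp, hp1, hp2⟩ ⟨s, hs, hs1, hs2⟩
    refine ⟨p + s, Q.add_mem hp hs, by simp [hp1, hs1], fun w hw => ?_⟩
    rw [map_add, inner_add_right, hp2 w hw, hs2 w hw, Prod.snd_add, inner_add_right]
  zero_mem' := ⟨0, Q.zero_mem, by simp, fun w _ => by simp⟩
  smul_mem' := by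
    rintro c q ⟨p, hp, hp1, hp2⟩
    refine ⟨c • p, Q.smul_mem c hp, by simp [hp1], fun w hw => ?_⟩
    rw [map_smul, inner_smul_right, hp2 w hw, Prod.smul_snd, inner_smul_right]

/-- For a continuous field `a`, every test function belongs to `H¹_a(Ω)`. -/
theorem exists_mem_testSubspace {d : ℕ} {Ω : Opens (EuclideanSpace ℝ (Fin d))}
    {a : EuclideanSpace ℝ (Fin d) → EuclideanSpace ℝ (Fin d)} (ha : Continuous a) (φ : 𝓓(Ω, ℂ)) :
    ∃ p ∈ testSubspace Ω a,
      embedding Ω a p =ᵐ[volume.restrict (Ω : Set (EuclideanSpace ℝ (Fin d)))] φ := by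
  set D : Fin d → EuclideanSpace ℝ (Fin d) → ℂ :=
    fun j z => fderiv ℝ φ z (EuclideanSpace.single j (1 : ℝ)) with hD
  have hDc : ∀ j, Continuous (D j) := fun j =>
    (φ.contDiff.continuous_fderiv (by simp)).clm_apply continuous_const
  have hDs : ∀ j, HasCompactSupport (D j) := fun j => φ.hasCompactSupport.fderiv_apply ℝ _
  have hφ : MemLp φ 2 volume := φ.continuous.memLp_of_hasCompactSupport φ.hasCompactSupport
  have hDm : ∀ j, MemLp (D j) 2 volume := fun j => (hDc j).memLp_of_hasCompactSupport (hDs j)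
  have hw : HasWeakGradient Ω φ D := by
    refine ⟨fun K _ _ => hφ.restrict K, fun j K _ _ => (hDm j).restrict K, fun j ψ => ?_⟩
    have hψd : Differentiable ℝ ψ := ψ.contDiff.differentiable (by simp)
    have hφd : Differentiable ℝ φ := φ.contDiff.differentiable (by simp)
    have hψc : Continuous (fun z => fderiv ℝ ψ z (EuclideanSpace.single j (1 : ℝ))) :=
      (ψ.contDiff.continuous_fderiv (by simp)).clm_apply continuous_const
    have hz : ∀ z, z ∉ (Ω : Set (EuclideanSpace ℝ (Fin d))) → φ z = 0 := fun z hz => by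
      by_contra h0
      exact hz (φ.tsupport_subset (subset_tsupport _ h0))
    have hz' : ∀ z, z ∉ (Ω : Set (EuclideanSpace ℝ (Fin d))) → ψ z = 0 := fun z hz => by
      by_contra h0
      exact hz (ψ.tsupport_subset (subset_tsupport _ h0))
    rw [setIntegral_eq_integral_of_forall_compl_eq_zero (fun z h => by simp [hz z h]),
      setIntegral_eq_integral_of_forall_compl_eq_zero (fun z h => by simp [hz' z h])]
    refine integral_mul_fderiv_eq_neg_fderiv_mul_of_integrable ?_ ?_ ?_
      (fun z _ => hφd z) (fun z _ => hψd z)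
    · exact ((hDc j).mul ψ.continuous).integrable_of_hasCompactSupport (hDs j).mul_right
    · exact (φ.continuous.mul hψc).integrable_of_hasCompactSupport φ.hasCompactSupport.mul_right
    · exact (φ.continuous.mul ψ.continuous).integrable_of_hasCompactSupport
        φ.hasCompactSupport.mul_right
  have hv : ∀ j : Fin d, MemLp (fun z => -Complex.I * D j z - (a z j : ℂ) * φ z) 2
      (volume.restrict (Ω : Set (EuclideanSpace ℝ (Fin d)))) := by
    intro j
    refine MemLp.restrict _ (((hDm j).const_mul _).sub ?_)
    refine Continuous.memLp_of_hasCompactSupport ?_ φ.hasCompactSupport.mul_left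
    have := φ.continuous
    fun_prop
  have hu := hφ.restrict (Ω : Set (EuclideanSpace ℝ (Fin d)))
  refine ⟨⟨WithLp.toLp 2 (hu.toLp, WithLp.toLp 2 fun j => (hv j).toLp), D,
    hw.congr hu.coeFn_toLp.symm, fun j => ?_⟩, ⟨φ, hu.coeFn_toLp⟩, hu.coeFn_toLp⟩
  filter_upwards [(hv j).coeFn_toLp, hu.coeFn_toLp] with z h1 h2
  change (hv j).toLp _ z = _ - _ * hu.toLp _ z
  rw [h1, h2]

/-- If `Q` contains the test functions, then the graph above is single-valued. -/
theorem formGraph_singleValued {d : ℕ} {Ω : Opens (EuclideanSpace ℝ (Fin d))}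
    {a : EuclideanSpace ℝ (Fin d) → EuclideanSpace ℝ (Fin d)} (ha : Continuous a)
    {Q : Submodule ℂ (magneticH1 Ω a)} (hQ : testSubspace Ω a ≤ Q)
    (q : L2 Ω × L2 Ω) (hq : q ∈ formGraph Q) (h0 : q.1 = 0) : q.2 = 0 := by
  obtain ⟨p, hp, hp1, hp2⟩ := hq
  have hp0 : p = 0 := magneticH1_ext (by rw [hp1, h0, map_zero])
  have := (memL2loc_of_Lp q.2).ae_eq_zero (fun g hg hgc hgs => ?_)
  · exact Lp.ext (this.trans (Lp.coeFn_zero ℂ 2 _).symm)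
  · obtain ⟨w, hw, hwφ⟩ := exists_mem_testSubspace ha (realTest g hg hgc hgs)
    have h1 := hp2 w (hQ hw)
    rw [hp0, map_zero, inner_zero_right, L2.inner_def] at h1
    rw [h1]
    refine integral_congr_ae ?_
    filter_upwards [hwφ] with z hz
    rw [hz]
    change _ = inner ℂ ((g z : ℂ)) _
    simp

/-- The operator in `L₂(Ω)` that corresponds to the quadratic form `‖(-i∇ - a)u‖²` with form
domain `Q`. -/
def formOperator {d : ℕ} {Ω : Opens (EuclideanSpace ℝ (Fin d))}
    {a : EuclideanSpace ℝ (Fin d) → EuclideanSpace ℝ (Fin d)}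
    (Q : Submodule ℂ (magneticH1 Ω a)) : L2 Ω →ₗ.[ℂ] L2 Ω :=
  (formGraph Q).toLinearPMap

theorem formOperator_graph {d : ℕ} {Ω : Opens (EuclideanSpace ℝ (Fin d))}
    {a : EuclideanSpace ℝ (Fin d) → EuclideanSpace ℝ (Fin d)} (ha : Continuous a)
    {Q : Submodule ℂ (magneticH1 Ω a)} (hQ : testSubspace Ω a ≤ Q) :
    (formOperator Q).graph = formGraph Q :=
  Submodule.toLinearPMap_graph_eq _ (formGraph_singleValued ha hQ)

/-- The Dirichlet realization of `(-i∇ - a)²` on `Ω`. -/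
def dirichletOperator {d : ℕ} (Ω : Opens (EuclideanSpace ℝ (Fin d)))
    (a : EuclideanSpace ℝ (Fin d) → EuclideanSpace ℝ (Fin d)) : L2 Ω →ₗ.[ℂ] L2 Ω :=
  formOperator (magneticH10 Ω a)

/-- The Neumann realization of `(-i∇ - a)²` on `Ω`. -/
def neumannOperator {d : ℕ} (Ω : Opens (EuclideanSpace ℝ (Fin d)))
    (a : EuclideanSpace ℝ (Fin d) → EuclideanSpace ℝ (Fin d)) : L2 Ω →ₗ.[ℂ] L2 Ω :=
  formOperator (⊤ : Submodule ℂ (magneticH1 Ω a))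

/-! ### Eigenvalues -/

/-- The space of all `u` in the domain of `T` with `T u = μ u`. -/
def eigenspace {H : Type*} [AddCommGroup H] [Module ℂ H] (T : H →ₗ.[ℂ] H) (μ : ℝ) :
    Submodule ℂ H :=
  T.graph.comap (LinearMap.prod LinearMap.id ((μ : ℂ) • LinearMap.id))

theorem mem_eigenspace {H : Type*} [AddCommGroup H] [Module ℂ H] (T : H →ₗ.[ℂ] H) (μ : ℝ)
    (u : H) : u ∈ eigenspace T μ ↔ ∃ h : u ∈ T.domain, T ⟨u, h⟩ = (μ : ℂ) • u := by
  rw [eigenspace, Submodule.mem_comap, LinearMap.prod_apply, LinearPMap.mem_graph_iff]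
  constructor
  · rintro ⟨y, hy1, hy2⟩
    have hy : (y : H) = u := hy1
    subst hy
    exact ⟨y.2, hy2⟩
  · rintro ⟨h, h2⟩
    exact ⟨⟨u, h⟩, rfl, h2⟩

/-- The number of eigenvalues of `T` in `S`, counting multiplicities: the dimension of the span
of all eigenvectors with eigenvalue in `S`. -/
def eigenvalueCount {H : Type*} [AddCommGroup H] [Module ℂ H] (T : H →ₗ.[ℂ] H) (S : Set ℝ) :
    ℕ∞ :=
  Cardinal.toENat (Module.rank ℂ (⨆ μ ∈ S, eigenspace T μ : Submodule ℂ H))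

/-- `μ` is the `j`-th eigenvalue of `T` (`j = 1, 2, …`), in increasing order and counting
multiplicities: fewer than `j` eigenvalues lie below `μ`, and at least `j` of them are at most
`μ`. -/
def IsNthEigenvalue {H : Type*} [AddCommGroup H] [Module ℂ H] (T : H →ₗ.[ℂ] H) (j : ℕ)
    (μ : ℝ) : Prop :=
  eigenvalueCount T (Iio μ) < j ∧ (j : ℕ∞) ≤ eigenvalueCount T (Iic μ)

/-! ### The vector potentials -/

/-- `A(x, y) = (-y, x) / 2`. -/
def potential2 (z : EuclideanSpace ℝ (Fin 2)) : EuclideanSpace ℝ (Fin 2) :=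
  !₂[-(z 1) / 2, z 0 / 2]

/-- `A(x, y, t) = (-y, x, 0) / 2`. -/
def potential3 (z : EuclideanSpace ℝ (Fin 3)) : EuclideanSpace ℝ (Fin 3) :=
  !₂[-(z 1) / 2, z 0 / 2, 0]

theorem continuous_potential2 : Continuous potential2 := by
  refine (PiLp.continuous_toLp 2 _).comp (continuous_pi fun j => ?_)
  fin_cases j <;> simp <;> fun_prop

theorem continuous_potential3 : Continuous potential3 := by
  refine (PiLp.continuous_toLp 2 _).comp (continuous_pi fun j => ?_)
  fin_cases j <;> simp <;> fun_prop

end Landau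

end

/-!
Write `P = -i∇ - BA` and fix `Λ`. Let `N_D` and `N_N` count the Dirichlet eigenvalues `≤ Λ` and the
Neumann eigenvalues `< Λ` of `P²` on `Ω`. The theorem follows from `N_D + 1 ≤ N_N`, for
`Λ = B(2k - 1)` in the plane and for every Dirichlet eigenvalue `Λ` in space
(`finrank_dirichlet_lt_finrank_neumann_of_landauState`).

The proof of `N_D + 1 ≤ N_N` is variational (`IsFormPair.finrank_lt_finrank_formSpan`). Let `V` be
spanned by the Dirichlet eigenfunctions with eigenvalue at most `Λ`, and let `U` be a smooth
solution of `P² U = Λ U` on the whole space with `‖PU‖² < Λ ‖U‖²` on `Ω`. Since `U` is orthogonal to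
the Dirichlet form domain with respect to `‖P·‖² - Λ ‖·‖²`, this form is nonpositive on `V + ℂU`. If
the Neumann eigenfunctions below `Λ` spanned at most `dim V` dimensions, then some nonzero element
of `V + ℂU` would be orthogonal to all of them and hence a null vector of the form. It would lie in
`V` and be a Dirichlet and a Neumann eigenfunction at the same time.

* No such function exists (`eq_zero_of_mem_magneticH10`): extended by zero, it would be a square
  integrable solution of `P² u = Λ u` on the whole space that vanishes off a set of finite measure.
  The argument of Amrein and Berthier excludes this (`landauSpaceOn_eq_bot`). The dimension of the
  space of solutions living on a set `S` is bounded in terms of the measure of `S`, because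
  averaging magnetic translations over a small ball is bounded below on solutions and becomes a
  Hilbert–Schmidt operator after restriction to `S`. Choose `S` with the largest possible dimension
  among the sets of measure less than `M`. Adding a slight translate of `S` does not increase the
  dimension, so the solutions living on `S` are invariant under magnetic translations. Such a
  solution lives on every translate of `S` and hence vanishes.

* The function `U` is a magnetic translate of `(x - iy)^m e^{-B(x² + y²)/4}` in the plane, with
  `m = k - 1`, and of `e^{-B(x² + y²)/4} e^{iκt}` in space, with `κ = √(Λ - B)`. For these functions
  `|PU|² - Λ |U|²` is half of the Laplacian of `|U|²`, as a function of `(x, y)`. The integral of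
  this Laplacian over `Ω` is a function of the translation vector `w`, and it takes negative values,
  since its integral against `1 + cos(ε w₀)` is negative for small `ε`
  (`exists_integral_halfLaplacian_neg`).

* In space `κ` is real, because Dirichlet eigenvalues are at least `B`: the commutator of `P₀` and
  `P₁` is `iB`, so `‖P₀φ‖² + ‖P₁φ‖² - B ‖φ‖² = ‖(P₀ + iP₁)φ‖²`
  (`mul_norm_sq_le_of_mem_magneticH10`).
-/

noncomputable section

namespace Landau

set_option maxSynthPendingDepth 3

/-! ### The spectrum of a compactly embedded quadratic form -/

section FormSpectrum

variable {V H G : Type*} [NormedAddCommGroup V] [InnerProductSpace ℂ V]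
  [NormedAddCommGroup H] [InnerProductSpace ℂ H] [NormedAddCommGroup G] [InnerProductSpace ℂ G]

/-- The weak eigenvectors, in the form domain `V`, of the quadratic form `‖D p‖²` relative to
`‖e p‖²`: all `p` with `⟨D w, D p⟩ = μ ⟨e w, e p⟩` for every `w`. -/
def formEigenspace (e : V →L[ℂ] H) (D : V →L[ℂ] G) (μ : ℝ) : Submodule ℂ V where
  carrier := {p | ∀ w, inner ℂ (D w) (D p) = (μ : ℂ) * inner ℂ (e w) (e p)}
  add_mem' := by
    intro p q hp hq w
    rw [map_add, map_add, inner_add_right, inner_add_right, hp w, hq w, mul_add]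
  zero_mem' := fun w => by simp
  smul_mem' := by
    intro c p hp w
    rw [map_smul, map_smul, inner_smul_right, inner_smul_right, hp w]
    ring

/-- The span of the weak eigenvectors whose eigenvalue lies in `S`. -/
def formSpan (e : V →L[ℂ] H) (D : V →L[ℂ] G) (S : Set ℝ) : Submodule ℂ V :=
  ⨆ μ ∈ S, formEigenspace e D μ

variable {e : V →L[ℂ] H} {D : V →L[ℂ] G}

theorem formSpan_mono {S T : Set ℝ} (h : S ⊆ T) : formSpan e D S ≤ formSpan e D T :=
  biSup_mono h

theorem formEigenspace_le_formSpan {S : Set ℝ} {μ : ℝ} (h : μ ∈ S) :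
    formEigenspace e D μ ≤ formSpan e D S :=
  le_biSup (formEigenspace e D) h

theorem inner_eq_zero_of_mem_formEigenspace {μ ν : ℝ} (hne : μ ≠ ν) {p q : V}
    (hp : p ∈ formEigenspace e D μ) (hq : q ∈ formEigenspace e D ν) :
    inner ℂ (e p) (e q) = 0 := by
  have h1 := hq p
  have h2 := hp q
  have h3 : inner ℂ (D p) (D q) = (μ : ℂ) * inner ℂ (e p) (e q) := by
    rw [← inner_conj_symm, h2, map_mul, inner_conj_symm, Complex.conj_ofReal]
  rw [h1] at h3
  have h4 : ((ν : ℂ) - μ) * inner ℂ (e p) (e q) = 0 := by rw [sub_mul, h3, sub_self]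
  rcases mul_eq_zero.1 h4 with h | h
  · exact absurd (by exact_mod_cast (sub_eq_zero.1 h).symm) hne
  · exact h

/-- A vector in the span of eigenvectors is a finite sum of eigenvectors with distinct
eigenvalues, which diagonalizes both quadratic forms. -/
theorem exists_sum_of_mem_formSpan {S : Set ℝ} {p : V} (hp : p ∈ formSpan e D S) :
    ∃ (s : Finset ℝ) (f : ℝ → V), (∀ μ ∈ s, μ ∈ S) ∧ (∀ μ ∈ s, f μ ∈ formEigenspace e D μ) ∧
      p = ∑ μ ∈ s, f μ ∧ ‖e p‖ ^ 2 = ∑ μ ∈ s, ‖e (f μ)‖ ^ 2 ∧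
      ‖D p‖ ^ 2 = ∑ μ ∈ s, μ * ‖e (f μ)‖ ^ 2 := by
  rw [formSpan, iSup_subtype', Submodule.mem_iSup_iff_exists_finsupp] at hp
  obtain ⟨g, hg, hgp⟩ := hp
  classical
  let f : ℝ → V := fun μ => if h : μ ∈ S then g ⟨μ, h⟩ else 0
  have hfv : ∀ i : S, f i = g i := fun i => by simp [f, i.2]
  have hfm : ∀ μ, μ ∈ S → f μ ∈ formEigenspace e D μ := fun μ h => by
    rw [show f μ = g ⟨μ, h⟩ from hfv ⟨μ, h⟩]
    exact hg ⟨μ, h⟩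
  set s : Finset ℝ := g.support.map (Function.Embedding.subtype _) with hs
  have hsS : ∀ μ ∈ s, μ ∈ S := by
    intro μ h
    obtain ⟨i, _, rfl⟩ := Finset.mem_map.1 h
    exact i.2
  have hpf : p = ∑ μ ∈ s, f μ := by
    rw [← hgp, hs, Finset.sum_map]
    exact Finset.sum_congr rfl fun i _ => (hfv i).symm
  have hoff : ∀ μ ∈ s, ∀ ν ∈ s, μ ≠ ν → inner ℂ (e (f μ)) (e (f ν)) = 0 := fun μ hμ ν hν hne =>
    inner_eq_zero_of_mem_formEigenspace hne (hfm μ (hsS μ hμ)) (hfm ν (hsS ν hν))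
  have key : ∀ c : ℝ → ℝ, ∑ μ ∈ s, ∑ ν ∈ s, (c ν : ℂ) * inner ℂ (e (f μ)) (e (f ν)) =
      ((∑ μ ∈ s, c μ * ‖e (f μ)‖ ^ 2 : ℝ) : ℂ) := by
    intro c
    push_cast
    refine Finset.sum_congr rfl fun μ hμ => ?_
    rw [Finset.sum_eq_single μ]
    · rw [inner_self_eq_norm_sq_to_K]
      rfl
    · intro ν hν hne
      rw [hoff μ hμ ν hν (Ne.symm hne), mul_zero]
    · exact fun h => absurd hμ h
  refine ⟨s, f, hsS, fun μ h => hfm μ (hsS μ h), hpf, ?_, ?_⟩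
  · have h1 : inner ℂ (e p) (e p) = ((∑ μ ∈ s, ‖e (f μ)‖ ^ 2 : ℝ) : ℂ) := by
      have := key (fun _ => 1)
      simp only [Complex.ofReal_one, one_mul] at this
      rw [← this, hpf, map_sum, sum_inner]
      exact Finset.sum_congr rfl fun μ _ => inner_sum _ _ _
    rw [inner_self_eq_norm_sq_to_K] at h1
    refine Complex.ofReal_injective ?_
    rw [← h1, Complex.ofReal_pow]
    rfl
  · have h1 : inner ℂ (D p) (D p) = ((∑ μ ∈ s, μ * ‖e (f μ)‖ ^ 2 : ℝ) : ℂ) := by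
      rw [← key (fun μ => μ), hpf, map_sum, sum_inner]
      refine Finset.sum_congr rfl fun μ _ => ?_
      rw [inner_sum]
      exact Finset.sum_congr rfl fun ν hν => hfm ν (hsS ν hν) _
    rw [inner_self_eq_norm_sq_to_K] at h1
    refine Complex.ofReal_injective ?_
    rw [← h1, Complex.ofReal_pow]
    rfl

theorem norm_sq_le_of_mem_formSpan_Iic {Λ : ℝ} {p : V} (hp : p ∈ formSpan e D (Iic Λ)) :
    ‖D p‖ ^ 2 ≤ Λ * ‖e p‖ ^ 2 := by
  obtain ⟨s, f, hs, -, -, h1, h2⟩ := exists_sum_of_mem_formSpan hp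
  rw [h1, h2, Finset.mul_sum]
  exact Finset.sum_le_sum fun μ hμ => mul_le_mul_of_nonneg_right (hs μ hμ) (sq_nonneg _)

theorem le_norm_sq_of_mem_formSpan_Ici {Λ : ℝ} {p : V} (hp : p ∈ formSpan e D (Ici Λ)) :
    Λ * ‖e p‖ ^ 2 ≤ ‖D p‖ ^ 2 := by
  obtain ⟨s, f, hs, -, -, h1, h2⟩ := exists_sum_of_mem_formSpan hp
  rw [h1, h2, Finset.mul_sum]
  exact Finset.sum_le_sum fun μ hμ => mul_le_mul_of_nonneg_right (hs μ hμ) (sq_nonneg _)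

theorem inner_D_eq_zero_of_mem_formSpan {S : Set ℝ} {p q : V} (hq : q ∈ formSpan e D S)
    (h : ∀ r ∈ formSpan e D S, inner ℂ (e p) (e r) = 0) : inner ℂ (D p) (D q) = 0 := by
  obtain ⟨s, f, hs, hf, rfl, -, -⟩ := exists_sum_of_mem_formSpan hq
  rw [map_sum, inner_sum]
  refine Finset.sum_eq_zero fun μ hμ => ?_
  rw [hf μ hμ p, h _ (formEigenspace_le_formSpan (hs μ hμ) (hf μ hμ)), mul_zero]

/-- The maps `e` and `D` present `V` as the form domain of the quadratic form `‖D p‖²` in `H`: the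
embedding `e` is injective and the norm of `V` is the form norm. -/
structure IsFormPair (e : V →L[ℂ] H) (D : V →L[ℂ] G) : Prop where
  inner_eq : ∀ p q, inner ℂ p q = inner ℂ (e p) (e q) + inner ℂ (D p) (D q)
  injective : Function.Injective e

theorem IsFormPair.norm_sq (h : IsFormPair e D) (p : V) : ‖p‖ ^ 2 = ‖e p‖ ^ 2 + ‖D p‖ ^ 2 := by
  have := h.inner_eq p p
  rw [inner_self_eq_norm_sq_to_K, inner_self_eq_norm_sq_to_K, inner_self_eq_norm_sq_to_K] at this
  exact_mod_cast this

/-- Completeness of the eigenvectors when the form domain is compactly embedded: they are the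
eigenvectors of the compact operator `e⋆e` of the form domain. -/
theorem IsFormPair.orthogonal_formSpan_univ [CompleteSpace V] [CompleteSpace H]
    (h : IsFormPair e D) (hc : IsCompactOperator e) : (formSpan e D univ)ᗮ = ⊥ := by
  set T : V →L[ℂ] V := (ContinuousLinearMap.adjoint e).comp e with hT
  have hTi : ∀ p q, inner ℂ p (T q) = inner ℂ (e p) (e q) := fun p q =>
    ContinuousLinearMap.adjoint_inner_right e p (e q)
  have hTs : T.IsSymmetric := fun p q => by
    change inner ℂ (T p) q = inner ℂ p (T q)
    rw [hTi, ← inner_conj_symm, hTi, inner_conj_symm]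
  have hTc : IsCompactOperator T := hc.clm_comp (ContinuousLinearMap.adjoint e)
  have h1 := ContinuousLinearMap.orthogonalComplement_iSup_eigenspaces_eq_bot hTc hTs
  rw [eq_bot_iff, ← h1]
  refine Submodule.orthogonal_le (iSup_le fun τ => ?_)
  intro p hp
  rw [Module.End.mem_eigenspace_iff] at hp
  by_cases hp0 : p = 0
  · rw [hp0]; exact Submodule.zero_mem _
  have hτ : ∀ w, inner ℂ (e w) (e p) = τ * inner ℂ w p := fun w => by
    rw [← hTi, ← inner_smul_right]
    exact congrArg _ hp
  have hep : e p ≠ 0 := fun h3 => hp0 (h.injective (by rw [h3, map_zero]))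
  have hτ0 : τ ≠ 0 := by
    rintro rfl
    have := hτ p
    rw [zero_mul, inner_self_eq_zero] at this
    exact hep this
  have hτr : ∃ r : ℝ, (r : ℂ) = τ := by
    refine ⟨‖e p‖ ^ 2 / ‖p‖ ^ 2, ?_⟩
    have := hτ p
    rw [inner_self_eq_norm_sq_to_K, inner_self_eq_norm_sq_to_K] at this
    have hp1 : (‖p‖ : ℂ) ≠ 0 := by simpa using hp0
    push_cast
    rw [div_eq_iff (pow_ne_zero 2 hp1)]
    exact this
  obtain ⟨r, rfl⟩ := hτr
  -- `p = r⁻¹ e⋆e p` in the form norm means that `p` is a weak eigenvector for `1 / r - 1`.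
  refine formEigenspace_le_formSpan (μ := r⁻¹ - 1) (mem_univ _) fun w => ?_
  have h2 := hτ w
  rw [h.inner_eq] at h2
  push_cast
  field_simp
  linear_combination -h2

/-- Vectors orthogonal to the eigenvectors with eigenvalue below `Λ` have energy at least `Λ`. -/
theorem IsFormPair.le_norm_sq_of_orthogonal [CompleteSpace V] [CompleteSpace H]
    (h : IsFormPair e D) (hc : IsCompactOperator e) {Λ : ℝ} {p : V}
    (hp : ∀ q ∈ formSpan e D (Iio Λ), inner ℂ (e p) (e q) = 0) :
    Λ * ‖e p‖ ^ 2 ≤ ‖D p‖ ^ 2 := by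
  set L := formSpan e D (Iio Λ) with hL
  set K := formSpan e D (Ici Λ) with hK
  have hmem : ∀ x, (∀ q ∈ L, inner ℂ (e x) (e q) = 0) → x ∈ Lᗮ := fun x hx => by
    rw [Submodule.mem_orthogonal']
    intro q hq
    rw [h.inner_eq, hx q hq, inner_D_eq_zero_of_mem_formSpan hq hx, add_zero]
  have hpL : p ∈ Lᗮ := hmem p hp
  have hKL : K ≤ Lᗮ := by
    refine iSup₂_le fun μ hμ x hx => hmem x fun q hq => ?_
    obtain ⟨s, f, hs, hf, rfl, -, -⟩ := exists_sum_of_mem_formSpan hq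
    rw [map_sum, inner_sum]
    refine Finset.sum_eq_zero fun ν hν => ?_
    have h1 : ν < Λ := hs ν hν
    have h2 : Λ ≤ μ := hμ
    exact inner_eq_zero_of_mem_formEigenspace (h1.trans_le h2).ne'
      hx (hf ν hν)
  have htop : Lᗮ ⊓ Kᗮ = ⊥ := by
    rw [Submodule.inf_orthogonal, eq_bot_iff, ← h.orthogonal_formSpan_univ hc]
    refine Submodule.orthogonal_le (iSup₂_le fun μ _ => ?_)
    rcases lt_or_ge μ Λ with h1 | h1
    · exact le_sup_of_le_left (formEigenspace_le_formSpan h1)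
    · exact le_sup_of_le_right (formEigenspace_le_formSpan h1)
  set Kc := K.topologicalClosure with hKc
  have hKcL : Kc ≤ Lᗮ :=
    Submodule.topologicalClosure_minimal _ hKL (Submodule.isClosed_orthogonal L)
  have : CompleteSpace Kc := K.isClosed_topologicalClosure.completeSpace_coe
  have hpK : p ∈ Kc := by
    obtain ⟨y, hy, z, hz, hyz⟩ := Submodule.exists_add_mem_mem_orthogonal (K := Kc) p
    have hz1 : z ∈ Lᗮ := by
      rw [show z = p - y by rw [hyz]; abel]
      exact Submodule.sub_mem _ hpL (hKcL hy)
    have hz2 : z ∈ Kᗮ := Submodule.orthogonal_le K.le_topologicalClosure hz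
    have : z ∈ Lᗮ ⊓ Kᗮ := ⟨hz1, hz2⟩
    rw [htop, Submodule.mem_bot] at this
    rw [hyz, this, add_zero]
    exact hy
  have hcl : IsClosed {x : V | Λ * ‖e x‖ ^ 2 ≤ ‖D x‖ ^ 2} :=
    isClosed_le (by fun_prop) (by fun_prop)
  exact hcl.closure_subset_iff.2 (fun x hx => le_norm_sq_of_mem_formSpan_Ici hx) hpK

/-- A compactly embedded form has finitely many eigenvalues below any bound. -/
theorem IsFormPair.finiteDimensional_formSpan [CompleteSpace V]
    (h : IsFormPair e D) (hc : IsCompactOperator e) (Λ : ℝ) :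
    FiniteDimensional ℂ (formSpan e D (Iic Λ)) := by
  set F := (formSpan e D (Iic Λ)).topologicalClosure with hF
  have hFc : CompleteSpace F :=
    (Submodule.isClosed_topologicalClosure _).completeSpace_coe
  have hle : ∀ x ∈ F, ‖D x‖ ^ 2 ≤ Λ * ‖e x‖ ^ 2 := by
    have hcl : IsClosed {x : V | ‖D x‖ ^ 2 ≤ Λ * ‖e x‖ ^ 2} :=
      isClosed_le (by fun_prop) (by fun_prop)
    exact fun x hx => hcl.closure_subset_iff.2 (fun x hx => norm_sq_le_of_mem_formSpan_Iic hx) hx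
  set f : F →L[ℂ] H := e.comp F.subtypeL with hf
  have hfc : IsCompactOperator f := hc.comp_clm _
  have hb : ∀ x : F, ‖x‖ ≤ Real.sqrt (1 + |Λ|) * ‖f x‖ := fun x => by
    have h1 := h.norm_sq (x : V)
    have h2 := hle x x.2
    have h3 : ‖(x : V)‖ ^ 2 ≤ (1 + |Λ|) * ‖f x‖ ^ 2 := by
      change _ ≤ _ * ‖e (x : V)‖ ^ 2
      nlinarith [le_abs_self Λ, sq_nonneg ‖e (x : V)‖]
    rw [← Real.sqrt_sq (norm_nonneg (f x)), ← Real.sqrt_mul (by positivity)]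
    exact Real.le_sqrt_of_sq_le h3
  have hanti : AntilipschitzWith (Real.toNNReal (Real.sqrt (1 + |Λ|))) f :=
    f.antilipschitz_of_bound fun x => by
      rw [Real.coe_toNNReal _ (Real.sqrt_nonneg _)]
      exact hb x
  have hemb := hanti.isClosedEmbedding f.uniformContinuous
  have : FiniteDimensional ℂ F := by
    refine FiniteDimensional.of_isCompactOperator_id (𝕜 := ℂ) ?_
    obtain ⟨K, hK, hK2⟩ := hfc
    refine ⟨f ⁻¹' K, hemb.isCompact_preimage hK, ?_⟩
    simpa using hK2
  exact Submodule.finiteDimensional_of_le (Submodule.le_topologicalClosure _)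

end FormSpectrum

/-! ### The comparison principle and counting of eigenvalues -/

section FormComparison

variable {V H G : Type*} [NormedAddCommGroup V] [InnerProductSpace ℂ V]
  [NormedAddCommGroup H] [InnerProductSpace ℂ H] [NormedAddCommGroup G] [InnerProductSpace ℂ G]
  {e : V →L[ℂ] H} {D : V →L[ℂ] G}

theorem norm_sq_add_smul {E : Type*} [NormedAddCommGroup E] [InnerProductSpace ℂ E] (x y : E)
    (t : ℂ) : ‖x + t • y‖ ^ 2 = ‖x‖ ^ 2 + 2 * (t * inner ℂ x y).re + ‖t‖ ^ 2 * ‖y‖ ^ 2 := by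
  rw [norm_add_sq (𝕜 := ℂ), inner_smul_right, norm_smul, mul_pow]
  rfl

/-- Cauchy–Schwarz for the form `‖D p‖² - Λ ‖e p‖²` where it is nonnegative: a null vector of the
form is orthogonal to everything with respect to it. -/
theorem inner_D_eq_of_null {Λ : ℝ} {v u : V} (hv : ‖D v‖ ^ 2 = Λ * ‖e v‖ ^ 2)
    (hpos : ∀ t : ℂ, Λ * ‖e (v + t • u)‖ ^ 2 ≤ ‖D (v + t • u)‖ ^ 2) :
    inner ℂ (D u) (D v) = (Λ : ℂ) * inner ℂ (e u) (e v) := by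
  set β : ℂ := inner ℂ (D v) (D u) - (Λ : ℂ) * inner ℂ (e v) (e u) with hβ
  set γ : ℝ := ‖D u‖ ^ 2 - Λ * ‖e u‖ ^ 2 with hγ
  have hexp : ∀ t : ℂ, 0 ≤ 2 * (t * β).re + ‖t‖ ^ 2 * γ := fun t => by
    have h1 := hpos t
    rw [map_add, map_add, map_smul, map_smul, norm_sq_add_smul, norm_sq_add_smul] at h1
    have h2 : (t * β).re = (t * inner ℂ (D v) (D u)).re - Λ * (t * inner ℂ (e v) (e u)).re := by
      rw [hβ, mul_sub, Complex.sub_re, mul_left_comm, Complex.re_ofReal_mul]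
    rw [h2, hγ]
    nlinarith [h1, hv]
  have hβ0 : β = 0 := by
    by_contra h0
    have hn : 0 < ‖β‖ ^ 2 := by positivity
    set s : ℝ := 1 / (1 + |γ|) with hs
    have hs0 : 0 < s := by positivity
    have h1 := hexp (-(s : ℂ) * (starRingEnd ℂ) β)
    have h2 : (-(s : ℂ) * (starRingEnd ℂ) β * β).re = -s * ‖β‖ ^ 2 := by
      rw [mul_assoc, ← Complex.normSq_eq_conj_mul_self, Complex.normSq_eq_norm_sq]
      norm_cast
    have h3 : ‖(-(s : ℂ) * (starRingEnd ℂ) β)‖ ^ 2 = s ^ 2 * ‖β‖ ^ 2 := by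
      rw [norm_mul, norm_neg, Complex.norm_real, RCLike.norm_conj, mul_pow, Real.norm_eq_abs,
        sq_abs]
    rw [h2, h3] at h1
    have h4 : s * γ ≤ 1 := by
      rw [hs, one_div, inv_mul_le_iff₀ (by positivity)]
      linarith [le_abs_self γ]
    have h5 : s * ‖β‖ ^ 2 * (s * γ - 2) < 0 := mul_neg_of_pos_of_neg (by positivity) (by linarith)
    nlinarith
  have h6 : inner ℂ (D v) (D u) = (Λ : ℂ) * inner ℂ (e v) (e u) := sub_eq_zero.1 hβ0
  rw [← inner_conj_symm, h6, map_mul, inner_conj_symm, Complex.conj_ofReal]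

/-- The comparison principle. If the form `‖D p‖² - Λ ‖e p‖²` is nonpositive on `W ≤ Q` and
negative on a vector `U` that is orthogonal to `Q` with respect to it, and if `Q` contains no
eigenvector for `Λ`, then the eigenvectors with eigenvalues below `Λ` span more than `dim W`
dimensions. -/
theorem IsFormPair.finrank_lt_finrank_formSpan [CompleteSpace V] [CompleteSpace H]
    (h : IsFormPair e D) (hc : IsCompactOperator e) {Λ : ℝ} {Q W : Submodule ℂ V} (hWQ : W ≤ Q)
    [FiniteDimensional ℂ W] (hW : ∀ v ∈ W, ‖D v‖ ^ 2 ≤ Λ * ‖e v‖ ^ 2) {U : V}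
    (hU : ‖D U‖ ^ 2 < Λ * ‖e U‖ ^ 2)
    (hUQ : ∀ v ∈ Q, inner ℂ (D v) (D U) = (Λ : ℂ) * inner ℂ (e v) (e U))
    (hQ : ∀ v ∈ Q, v ∈ formEigenspace e D Λ → v = 0) :
    Module.finrank ℂ W + 1 ≤ Module.finrank ℂ (formSpan e D (Iio Λ)) := by
  set L := formSpan e D (Iio Λ) with hL
  have : FiniteDimensional ℂ (formSpan e D (Iic Λ)) := h.finiteDimensional_formSpan hc Λ
  have hLf : FiniteDimensional ℂ L :=
    Submodule.finiteDimensional_of_le (formSpan_mono Iio_subset_Iic_self)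
  have hUW : U ∉ W := fun hUW => by
    have h1 := hUQ U (hWQ hUW)
    rw [inner_self_eq_norm_sq_to_K, inner_self_eq_norm_sq_to_K] at h1
    have h2 : ‖D U‖ ^ 2 = Λ * ‖e U‖ ^ 2 := Complex.ofReal_injective (by push_cast; exact h1)
    exact absurd hU (by rw [h2]; exact lt_irrefl _)
  by_contra hlt
  set W' := W ⊔ Submodule.span ℂ {U} with hW'
  have hfr : Module.finrank ℂ W' = Module.finrank ℂ W + 1 := by
    have h1 := Submodule.finrank_sup_add_finrank_inf_eq W (Submodule.span ℂ {U})
    have hU0 : U ≠ 0 := fun h0 => hUW (h0 ▸ W.zero_mem)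
    rwa [(Submodule.disjoint_span_singleton_of_notMem hUW).eq_bot, finrank_bot, add_zero,
      finrank_span_singleton hU0] at h1
  have hLe : Module.finrank ℂ (L.map (e : V →ₗ[ℂ] H)) ≤ Module.finrank ℂ L :=
    Submodule.finrank_map_le _ _
  set P : W' →ₗ[ℂ] L.map (e : V →ₗ[ℂ] H) :=
    ((L.map (e : V →ₗ[ℂ] H)).orthogonalProjectionOnto : H →ₗ[ℂ] L.map (e : V →ₗ[ℂ] H)) ∘ₗ
      (e : V →ₗ[ℂ] H) ∘ₗ W'.subtype with hP
  -- By dimension, some nonzero `w ∈ W + ℂU` is orthogonal to all eigenvectors below `Λ`.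
  have hker : LinearMap.ker P ≠ ⊥ := LinearMap.ker_ne_bot_of_finrank_lt (by omega)
  obtain ⟨⟨w, hw⟩, hwP, hw0⟩ := Submodule.exists_mem_ne_zero_of_ne_bot hker
  have hw0' : w ≠ 0 := fun h0 => hw0 (Subtype.ext h0)
  have hworth : ∀ q ∈ L, inner ℂ (e w) (e q) = 0 := by
    have h1 : (L.map (e : V →ₗ[ℂ] H)).orthogonalProjectionOnto (e w) = 0 := hwP
    rw [Submodule.orthogonalProjectionOnto_eq_zero_iff] at h1
    exact fun q hq => Submodule.inner_left_of_mem_orthogonal (Submodule.mem_map_of_mem hq) h1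
  have hge := h.le_norm_sq_of_orthogonal hc hworth
  obtain ⟨v, hv, x, hx, rfl⟩ := Submodule.mem_sup.1 hw
  obtain ⟨c, rfl⟩ := Submodule.mem_span_singleton.1 hx
  have hcross : (c * inner ℂ (D v) (D U)).re = Λ * (c * inner ℂ (e v) (e U)).re := by
    rw [hUQ v (hWQ hv), mul_left_comm, Complex.re_ofReal_mul]
  -- The form would be negative at `w = v + c U` if `c` were nonzero.
  have hc0 : c = 0 := by
    by_contra hc0
    rw [map_add, map_add, map_smul, map_smul, norm_sq_add_smul, norm_sq_add_smul, hcross] at hge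
    have h1 := hW v hv
    have h2 : 0 < ‖c‖ ^ 2 := by positivity
    nlinarith [mul_lt_mul_of_pos_left hU h2]
  subst hc0
  rw [zero_smul, add_zero] at hworth hge hw0'
  -- It remains to see that the null vector `v` is an eigenvector for `Λ`; the test vector `u` is
  -- split into a combination of eigenvectors below `Λ` and a vector orthogonal to them.
  refine hw0' (hQ v (hWQ hv) fun u => ?_)
  have hnull : ‖D v‖ ^ 2 = Λ * ‖e v‖ ^ 2 := le_antisymm (hW v hv) hge
  obtain ⟨u₁, hu₁, hu₁e⟩ := ((L.map (e : V →ₗ[ℂ] H)).orthogonalProjectionOnto (e u)).2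
  have hu₂ : ∀ q ∈ L, inner ℂ (e (u - u₁)) (e q) = 0 := fun q hq => by
    have h1 := Submodule.sub_starProjection_mem_orthogonal (K := L.map (e : V →ₗ[ℂ] H)) (e u)
    rw [map_sub, show e u₁ = _ from hu₁e]
    exact Submodule.inner_left_of_mem_orthogonal (Submodule.mem_map_of_mem hq) h1
  have h2 : inner ℂ (D (u - u₁)) (D v) = (Λ : ℂ) * inner ℂ (e (u - u₁)) (e v) := by
    refine inner_D_eq_of_null hnull fun t => h.le_norm_sq_of_orthogonal hc fun q hq => ?_
    rw [map_add, map_smul, inner_add_left, inner_smul_left, hworth q hq, hu₂ q hq, mul_zero,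
      add_zero]
  have h3 : inner ℂ (D u₁) (D v) = 0 := by
    rw [← inner_conj_symm, inner_D_eq_zero_of_mem_formSpan hu₁ hworth, map_zero]
  have h4 : inner ℂ (e u₁) (e v) = 0 := by
    rw [← inner_conj_symm, hworth u₁ hu₁, map_zero]
  rw [map_sub, map_sub, inner_sub_left, inner_sub_left, h3, h4, sub_zero, sub_zero] at h2
  exact h2

/-- Below any bound only finitely many `μ` are eigenvalues. -/
theorem IsFormPair.finite_eigenvalues [CompleteSpace V] (h : IsFormPair e D)
    (hc : IsCompactOperator e) (Λ : ℝ) : {μ | μ ≤ Λ ∧ formEigenspace e D μ ≠ ⊥}.Finite := by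
  have : FiniteDimensional ℂ (formSpan e D (Iic Λ)) := h.finiteDimensional_formSpan hc Λ
  set S := {μ | μ ≤ Λ ∧ formEigenspace e D μ ≠ ⊥}
  choose p hp hp0 using fun μ : S => Submodule.exists_mem_ne_zero_of_ne_bot μ.2.2
  let v : S → formSpan e D (Iic Λ) := fun μ =>
    ⟨p μ, formEigenspace_le_formSpan (mem_Iic.2 μ.2.1) (hp μ)⟩
  have hli : LinearIndependent ℂ fun μ : S => e (p μ) := by
    refine linearIndependent_of_ne_zero_of_inner_eq_zero (fun μ h0 => hp0 μ (h.injective ?_))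
      fun μ ν hne => inner_eq_zero_of_mem_formEigenspace (fun h => hne (Subtype.ext h))
        (hp μ) (hp ν)
    rw [h0, map_zero]
  have hli2 : LinearIndependent ℂ v :=
    LinearIndependent.of_comp ((e : V →ₗ[ℂ] H) ∘ₗ (formSpan e D (Iic Λ)).subtype) hli
  have := hli2.finite
  exact S.toFinite

/-- If eigenvalues in `S` span at least `j ≥ 1` dimensions, then so do the eigenvalues up to a
suitable element of `S`. -/
theorem IsFormPair.exists_mem_le_finrank [CompleteSpace V] (h : IsFormPair e D)
    (hc : IsCompactOperator e) {Λ : ℝ} {S : Set ℝ} (hS : S ⊆ Iic Λ) {j : ℕ} (hj : 1 ≤ j)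
    (hjS : j ≤ Module.finrank ℂ (formSpan e D S)) :
    ∃ μ ∈ S, formEigenspace e D μ ≠ ⊥ ∧ j ≤ Module.finrank ℂ (formSpan e D (Iic μ)) := by
  have hfin : {μ | μ ∈ S ∧ formEigenspace e D μ ≠ ⊥}.Finite :=
    (h.finite_eigenvalues hc Λ).subset fun μ hμ => ⟨hS hμ.1, hμ.2⟩
  have hne : {μ | μ ∈ S ∧ formEigenspace e D μ ≠ ⊥}.Nonempty := by
    by_contra hemp
    rw [Set.not_nonempty_iff_eq_empty] at hemp
    have : formSpan e D S = ⊥ := by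
      rw [eq_bot_iff]
      refine iSup₂_le fun μ hμ => ?_
      by_contra h1
      have : μ ∈ {μ | μ ∈ S ∧ formEigenspace e D μ ≠ ⊥} := ⟨hμ, fun h2 => h1 h2.le⟩
      rw [hemp] at this
      exact this
    rw [this, finrank_bot] at hjS
    omega
  obtain ⟨μ, hμ, hmax⟩ := hfin.exists_maximal hne
  refine ⟨μ, hμ.1, hμ.2, hjS.trans ?_⟩
  have := h.finiteDimensional_formSpan hc μ
  refine Submodule.finrank_mono (iSup₂_le fun ν hν => ?_)
  by_cases h0 : formEigenspace e D ν = ⊥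
  · rw [h0]; exact bot_le
  · refine formEigenspace_le_formSpan (mem_Iic.2 ?_)
    by_contra hlt
    exact hlt (hmax ⟨hν, h0⟩ (le_of_not_ge hlt))

/-- Existence of the `j`-th eigenvalue. -/
theorem IsFormPair.exists_nth [CompleteSpace V] (h : IsFormPair e D)
    (hc : IsCompactOperator e) {Λ : ℝ} {S : Set ℝ} (hS : S ⊆ Iic Λ) {j : ℕ} (hj : 1 ≤ j)
    (hjS : j ≤ Module.finrank ℂ (formSpan e D S)) :
    ∃ μ, (∃ ν ∈ S, μ ≤ ν) ∧ formEigenspace e D μ ≠ ⊥ ∧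
      Module.finrank ℂ (formSpan e D (Iio μ)) < j ∧
      j ≤ Module.finrank ℂ (formSpan e D (Iic μ)) := by
  obtain ⟨ν, hνS, hν0, hνj⟩ := h.exists_mem_le_finrank hc hS hj hjS
  set A := {μ | (μ ≤ ν ∧ formEigenspace e D μ ≠ ⊥) ∧ j ≤ Module.finrank ℂ (formSpan e D (Iic μ))}
    with hA
  have hfin : A.Finite := (h.finite_eigenvalues hc ν).subset fun μ hμ => hμ.1
  obtain ⟨μ, hμ, hmin⟩ := hfin.exists_minimal ⟨ν, ⟨le_rfl, hν0⟩, hνj⟩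
  refine ⟨μ, ⟨ν, hνS, hμ.1.1⟩, hμ.1.2, ?_, hμ.2⟩
  by_contra hlt
  obtain ⟨κ, hκ, hκ0, hκj⟩ :=
    h.exists_mem_le_finrank hc (Iio_subset_Iic_self (a := μ)) hj (not_lt.1 hlt)
  have hκ' : κ < μ := hκ
  exact absurd (hmin ⟨⟨hκ'.le.trans hμ.1.1, hκ0⟩, hκj⟩ hκ'.le) (not_le.2 hκ')

/-- A compactly embedded form on an infinite-dimensional space has arbitrarily many eigenvalues. -/
theorem IsFormPair.exists_le_finrank [CompleteSpace V] [CompleteSpace H] (h : IsFormPair e D)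
    (hc : IsCompactOperator e) (hinf : ¬ FiniteDimensional ℂ V) (j : ℕ) :
    ∃ Λ, j ≤ Module.finrank ℂ (formSpan e D (Iic Λ)) := by
  by_contra hcon
  push Not at hcon
  have hbdd : BddAbove (range fun Λ : ℝ => Module.finrank ℂ (formSpan e D (Iic Λ))) :=
    ⟨j, by rintro _ ⟨Λ, rfl⟩; exact (hcon Λ).le⟩
  obtain ⟨Λ, hΛ⟩ := Nat.sSup_mem (range_nonempty _) hbdd
  have hmax : ∀ M, Module.finrank ℂ (formSpan e D (Iic M)) ≤
      Module.finrank ℂ (formSpan e D (Iic Λ)) := fun M => by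
    change _ ≤ (fun Λ : ℝ => Module.finrank ℂ (formSpan e D (Iic Λ))) Λ
    rw [hΛ]
    exact le_csSup hbdd ⟨M, rfl⟩
  have hfd := h.finiteDimensional_formSpan hc Λ
  have hle : formSpan e D univ ≤ formSpan e D (Iic Λ) := by
    refine iSup₂_le fun μ _ => ?_
    have := h.finiteDimensional_formSpan hc (max μ Λ)
    have h1 : formSpan e D (Iic Λ) = formSpan e D (Iic (max μ Λ)) :=
      Submodule.eq_of_le_of_finrank_le (formSpan_mono (Iic_subset_Iic.2 (le_max_right _ _)))
        (hmax _)
    rw [h1]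
    exact formEigenspace_le_formSpan (mem_Iic.2 (le_max_left _ _))
  have hbot : (formSpan e D (Iic Λ))ᗮ = ⊥ := by
    rw [eq_bot_iff, ← h.orthogonal_formSpan_univ hc]
    exact Submodule.orthogonal_le hle
  rw [Submodule.orthogonal_eq_bot_iff] at hbot
  rw [hbot] at hfd
  exact hinf (Module.finite_def.2 ((Submodule.fg_iff_finiteDimensional _).2 hfd))

end FormComparison

/-! ### Operators and weak eigenvectors -/

section FormOperator

variable {d : ℕ} {Ω : Opens (EuclideanSpace ℝ (Fin d))}
  {a : EuclideanSpace ℝ (Fin d) → EuclideanSpace ℝ (Fin d)}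

/-- The embedding of the form domain `Q` into `L₂(Ω)`. -/
def formEmbedding (Q : Submodule ℂ (magneticH1 Ω a)) : Q →L[ℂ] L2 Ω :=
  (embedding Ω a).comp Q.subtypeL

/-- The covariant gradient on the form domain `Q`. -/
def formGradient (Q : Submodule ℂ (magneticH1 Ω a)) :
    Q →L[ℂ] PiLp 2 (fun _ : Fin d => L2 Ω) :=
  (covariantGradient Ω a).comp Q.subtypeL

/-- The weak eigenvectors in the form domain `Q`. -/
def weakEigenspace (Q : Submodule ℂ (magneticH1 Ω a)) (μ : ℝ) : Submodule ℂ Q :=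
  formEigenspace (V := Q) (H := L2 Ω) (G := PiLp 2 fun _ : Fin d => L2 Ω)
    (formEmbedding Q) (formGradient Q) μ

/-- The span of the weak eigenvectors in the form domain `Q` whose eigenvalue lies in `S`. -/
def weakSpan (Q : Submodule ℂ (magneticH1 Ω a)) (S : Set ℝ) : Submodule ℂ Q :=
  formSpan (V := Q) (H := L2 Ω) (G := PiLp 2 fun _ : Fin d => L2 Ω)
    (formEmbedding Q) (formGradient Q) S

theorem isFormPair (Q : Submodule ℂ (magneticH1 Ω a)) :
    IsFormPair (V := Q) (H := L2 Ω) (G := PiLp 2 fun _ : Fin d => L2 Ω)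
      (formEmbedding Q) (formGradient Q) where
  inner_eq _ _ := WithLp.prod_inner_apply _ _
  injective _ _ h := Subtype.ext (magneticH1_ext h)

theorem eigenspace_formOperator (ha : Continuous a) {Q : Submodule ℂ (magneticH1 Ω a)}
    (hQ : testSubspace Ω a ≤ Q) (μ : ℝ) :
    eigenspace (formOperator Q) μ =
      (weakEigenspace Q μ).map
        (formEmbedding Q : Q →ₗ[ℂ] L2 Ω) := by
  ext u
  rw [eigenspace, formOperator_graph ha hQ, Submodule.mem_map]
  constructor
  · rintro ⟨p, hp, hpu, hp2⟩
    refine ⟨⟨p, hp⟩, fun w => ?_, hpu⟩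
    have := hp2 w w.2
    rw [LinearMap.prod_apply] at this
    have h2 : embedding Ω a p = u := hpu
    simp only [Function.prod_apply, LinearMap.smul_apply, LinearMap.id_apply,
      inner_smul_right] at this
    rw [← h2] at this
    exact this
  · rintro ⟨p, hp, rfl⟩
    refine ⟨p, p.2, rfl, fun w hw => ?_⟩
    have := hp ⟨w, hw⟩
    rw [LinearMap.prod_apply]
    simp only [Function.prod_apply, LinearMap.smul_apply, LinearMap.id_apply,
      inner_smul_right]
    exact this

theorem eigenvalueCount_formOperator (ha : Continuous a) {Q : Submodule ℂ (magneticH1 Ω a)}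
    (hQ : testSubspace Ω a ≤ Q) (S : Set ℝ)
    [FiniteDimensional ℂ (weakSpan Q S)] :
    eigenvalueCount (formOperator Q) S =
      (Module.finrank ℂ (weakSpan Q S) : ℕ∞) := by
  have h1 : (⨆ μ ∈ S, eigenspace (formOperator Q) μ : Submodule ℂ (L2 Ω)) =
      (weakSpan Q S).map
        (formEmbedding Q : Q →ₗ[ℂ] L2 Ω) := by
    rw [weakSpan, formSpan, Submodule.map_iSup]
    refine iSup_congr fun μ => ?_
    rw [Submodule.map_iSup]
    exact iSup_congr fun _ => eigenspace_formOperator ha hQ μ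
  have hinj : Function.Injective (formEmbedding Q : Q →ₗ[ℂ] L2 Ω) := (isFormPair Q).injective
  rw [eigenvalueCount, h1, ← (Submodule.equivMapOfInjective _ hinj _).rank_eq,
    ← Module.finrank_eq_rank, Cardinal.toENat_nat]

theorem isCompactOperator_formEmbedding (hc : IsCompactOperator (embedding Ω a))
    (Q : Submodule ℂ (magneticH1 Ω a)) : IsCompactOperator (formEmbedding Q) :=
  hc.comp_clm Q.subtypeL

end FormOperator

/-! ### Covariant derivatives -/

section CovariantDerivative

variable {d : ℕ}

/-- The covariant derivative `(-i∂_j - a_j)φ`. -/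
def covDeriv (a : EuclideanSpace ℝ (Fin d) → EuclideanSpace ℝ (Fin d)) (j : Fin d)
    (φ : EuclideanSpace ℝ (Fin d) → ℂ) (z : EuclideanSpace ℝ (Fin d)) : ℂ :=
  -Complex.I * fderiv ℝ φ z (EuclideanSpace.single j (1 : ℝ)) - (a z j : ℂ) * φ z

variable {a : EuclideanSpace ℝ (Fin d) → EuclideanSpace ℝ (Fin d)}
  {φ ψ U : EuclideanSpace ℝ (Fin d) → ℂ}

theorem contDiff_covDeriv (ha : ContDiff ℝ ∞ a) (hφ : ContDiff ℝ ∞ φ) (j : Fin d) :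
    ContDiff ℝ ∞ (covDeriv a j φ) := by
  have h1 : ContDiff ℝ ∞ fun z => fderiv ℝ φ z (EuclideanSpace.single j (1 : ℝ)) :=
    (hφ.fderiv_right (by simp)).clm_apply contDiff_const
  have h2 : ContDiff ℝ ∞ fun z => ((a z j : ℝ) : ℂ) :=
    Complex.ofRealCLM.contDiff.comp ((contDiff_euclidean.1 ha) j)
  exact (contDiff_const.mul h1).sub (h2.mul hφ)

theorem hasCompactSupport_covDeriv (hφ : HasCompactSupport φ) (j : Fin d) :
    HasCompactSupport (covDeriv a j φ) :=
  ((hφ.fderiv_apply ℝ _).mul_left).sub hφ.mul_left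

theorem covDeriv_eq_zero {z : EuclideanSpace ℝ (Fin d)} (hz : z ∉ tsupport φ) (j : Fin d) :
    covDeriv a j φ z = 0 := by
  rw [covDeriv, fderiv_of_notMem_tsupport ℝ hz, image_eq_zero_of_notMem_tsupport hz]
  simp

theorem memLp_of_contDiff {n : WithTop ℕ∞} (hφ : ContDiff ℝ n φ) (hc : HasCompactSupport φ) :
    MemLp φ 2 (volume : Measure (EuclideanSpace ℝ (Fin d))) :=
  hφ.continuous.memLp_of_hasCompactSupport hc

theorem integral_fderiv_mul_eq_neg (hφ : ContDiff ℝ 1 φ) (hc : HasCompactSupport φ)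
    (hψ : ContDiff ℝ 1 ψ) (v : EuclideanSpace ℝ (Fin d)) :
    ∫ z, fderiv ℝ φ z v * ψ z = - ∫ z, φ z * fderiv ℝ ψ z v := by
  have c1 : Continuous fun z => fderiv ℝ φ z v :=
    (hφ.continuous_fderiv one_ne_zero).clm_apply continuous_const
  have c2 : Continuous fun z => fderiv ℝ ψ z v :=
    (hψ.continuous_fderiv one_ne_zero).clm_apply continuous_const
  have := integral_mul_fderiv_eq_neg_fderiv_mul_of_integrable (𝕜 := ℂ) (f := φ) (g := ψ) (v := v)
    (μ := volume)
    ((c1.mul hψ.continuous).integrable_of_hasCompactSupport (hc.fderiv_apply ℝ v).mul_right)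
    ((hφ.continuous.mul c2).integrable_of_hasCompactSupport hc.mul_right)
    ((hφ.continuous.mul hψ.continuous).integrable_of_hasCompactSupport hc.mul_right)
    (fun z _ => hφ.differentiable one_ne_zero z) (fun z _ => hψ.differentiable one_ne_zero z)
  rw [this, neg_neg]

theorem fderiv_conj (hφ : Differentiable ℝ φ) (z v : EuclideanSpace ℝ (Fin d)) :
    fderiv ℝ (fun z => starRingEnd ℂ (φ z)) z v = starRingEnd ℂ (fderiv ℝ φ z v) := by
  have h : HasFDerivAt (fun z => starRingEnd ℂ (φ z))
      ((Complex.conjCLE : ℂ →L[ℝ] ℂ).comp (fderiv ℝ φ z)) z :=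
    (Complex.conjCLE : ℂ →L[ℝ] ℂ).hasFDerivAt.comp z (hφ z).hasFDerivAt
  rw [h.fderiv]
  rfl

/-- The covariant derivatives are formally symmetric. -/
theorem integral_conj_covDeriv_mul (ha : Continuous a) (hφ : ContDiff ℝ 1 φ)
    (hc : HasCompactSupport φ) (hψ : ContDiff ℝ 1 ψ) (j : Fin d) :
    ∫ z, starRingEnd ℂ (covDeriv a j φ z) * ψ z =
      ∫ z, starRingEnd ℂ (φ z) * covDeriv a j ψ z := by
  set v : EuclideanSpace ℝ (Fin d) := EuclideanSpace.single j (1 : ℝ) with hv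
  have hφc : ContDiff ℝ 1 fun z => starRingEnd ℂ (φ z) :=
    (Complex.conjCLE : ℂ →L[ℝ] ℂ).contDiff.comp hφ
  have hcc : HasCompactSupport fun z => starRingEnd ℂ (φ z) :=
    hc.comp_left (g := starRingEnd ℂ) (map_zero _)
  have haj : Continuous fun z => ((a z j : ℝ) : ℂ) := by fun_prop
  have c1 : Continuous fun z => fderiv ℝ (fun z => starRingEnd ℂ (φ z)) z v :=
    (hφc.continuous_fderiv one_ne_zero).clm_apply continuous_const
  have c2 : Continuous fun z => fderiv ℝ ψ z v :=
    (hψ.continuous_fderiv one_ne_zero).clm_apply continuous_const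
  have i1 : Integrable fun z => Complex.I *
      (fderiv ℝ (fun z => starRingEnd ℂ (φ z)) z v * ψ z) :=
    ((c1.mul hψ.continuous).integrable_of_hasCompactSupport
      (hcc.fderiv_apply ℝ v).mul_right).const_mul _
  have i2 : Integrable fun z => (a z j : ℂ) * (starRingEnd ℂ (φ z) * ψ z) :=
    (haj.mul (hφc.continuous.mul hψ.continuous)).integrable_of_hasCompactSupport
      hcc.mul_right.mul_left
  have i3 : Integrable fun z => -Complex.I * (starRingEnd ℂ (φ z) * fderiv ℝ ψ z v) :=
    ((hφc.continuous.mul c2).integrable_of_hasCompactSupport hcc.mul_right).const_mul _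
  have e1 : ∀ z, starRingEnd ℂ (covDeriv a j φ z) * ψ z =
      Complex.I * (fderiv ℝ (fun z => starRingEnd ℂ (φ z)) z v * ψ z) -
        (a z j : ℂ) * (starRingEnd ℂ (φ z) * ψ z) := fun z => by
    rw [fderiv_conj (hφ.differentiable one_ne_zero), covDeriv]
    simp only [map_sub, map_mul, map_neg, Complex.conj_I, Complex.conj_ofReal]
    ring
  have e2 : ∀ z, starRingEnd ℂ (φ z) * covDeriv a j ψ z =
      -Complex.I * (starRingEnd ℂ (φ z) * fderiv ℝ ψ z v) -
        (a z j : ℂ) * (starRingEnd ℂ (φ z) * ψ z) := fun z => by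
    rw [covDeriv]
    ring
  simp only [e1, e2]
  rw [integral_sub i1 i2, integral_sub i3 i2, integral_const_mul, integral_const_mul,
    integral_fderiv_mul_eq_neg hφc hcc hψ]
  ring

/-- A smooth function whose covariant gradient is square integrable on `Ω` belongs to the magnetic
Sobolev space. -/
theorem exists_magneticH1_of_contDiff {Ω : Opens (EuclideanSpace ℝ (Fin d))}
    (hU : ContDiff ℝ ∞ U)
    (h0 : MemLp U 2 (volume.restrict (Ω : Set (EuclideanSpace ℝ (Fin d)))))
    (h1 : ∀ j, MemLp (covDeriv a j U) 2
      (volume.restrict (Ω : Set (EuclideanSpace ℝ (Fin d))))) :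
    ∃ p : magneticH1 Ω a,
      embedding Ω a p =ᵐ[volume.restrict (Ω : Set (EuclideanSpace ℝ (Fin d)))] U ∧
      ∀ j, covariantGradient Ω a p j
        =ᵐ[volume.restrict (Ω : Set (EuclideanSpace ℝ (Fin d)))] covDeriv a j U := by
  set D : Fin d → EuclideanSpace ℝ (Fin d) → ℂ :=
    fun j z => fderiv ℝ U z (EuclideanSpace.single j (1 : ℝ)) with hD
  have hDc : ∀ j, Continuous (D j) := fun j =>
    (hU.continuous_fderiv (by simp)).clm_apply continuous_const
  have hloc : ∀ f : EuclideanSpace ℝ (Fin d) → ℂ, Continuous f → MemL2loc Ω f :=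
    fun f hf K _ hKc => by
      have : IsFiniteMeasure (volume.restrict K) := ⟨by simpa using hKc.measure_lt_top⟩
      obtain ⟨C, hC⟩ := hKc.exists_bound_of_continuousOn hf.continuousOn
      refine MemLp.of_bound hf.aestronglyMeasurable C ?_
      exact (ae_restrict_iff' hKc.measurableSet).2 (Filter.Eventually.of_forall hC)
  have hw : HasWeakGradient Ω U D := by
    refine ⟨hloc _ hU.continuous, fun j => hloc _ (hDc j), fun j ψ => ?_⟩
    have hz' : ∀ z, z ∉ (Ω : Set (EuclideanSpace ℝ (Fin d))) → z ∉ tsupport ψ := fun z hz h0 =>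
      hz (ψ.tsupport_subset h0)
    rw [setIntegral_eq_integral_of_forall_compl_eq_zero
        (fun z h => by rw [fderiv_of_notMem_tsupport ℝ (hz' z h)]; simp),
      setIntegral_eq_integral_of_forall_compl_eq_zero
        (fun z h => by rw [image_eq_zero_of_notMem_tsupport (hz' z h), mul_zero])]
    have := integral_fderiv_mul_eq_neg (ψ.contDiff.of_le (by simp)) ψ.hasCompactSupport
      (hU.of_le (by simp)) (EuclideanSpace.single j (1 : ℝ))
    simp only [mul_comm (U _), mul_comm (D _ _)]
    exact this
  refine ⟨⟨WithLp.toLp 2 (h0.toLp, WithLp.toLp 2 fun j => (h1 j).toLp), D,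
    hw.congr h0.coeFn_toLp.symm, fun j => ?_⟩, h0.coeFn_toLp, fun j => (h1 j).coeFn_toLp⟩
  filter_upwards [(h1 j).coeFn_toLp, h0.coeFn_toLp] with z h1z h2z
  change (h1 j).toLp _ z = _ - _ * h0.toLp _ z
  rw [h1z, h2z]
  rfl

theorem covariantGradient_ae_eq {Ω : Opens (EuclideanSpace ℝ (Fin d))} (ha : ContDiff ℝ ∞ a)
    {p : magneticH1 Ω a} (hφ : ContDiff ℝ ∞ φ) (hc : HasCompactSupport φ)
    (hp : embedding Ω a p =ᵐ[volume.restrict (Ω : Set (EuclideanSpace ℝ (Fin d)))] φ) (j : Fin d) :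
    covariantGradient Ω a p j
      =ᵐ[volume.restrict (Ω : Set (EuclideanSpace ℝ (Fin d)))] covDeriv a j φ := by
  obtain ⟨q, hq0, hq1⟩ := exists_magneticH1_of_contDiff (Ω := Ω) (a := a) hφ
    ((memLp_of_contDiff hφ hc).restrict _) fun j => (memLp_of_contDiff
      (contDiff_covDeriv ha hφ j) (hasCompactSupport_covDeriv hc j)).restrict _
  have : p = q := magneticH1_ext (Lp.ext (hp.trans hq0.symm))
  rw [this]
  exact hq1 j

/-- A smooth solution of `(-i∇ - a)² U = Λ U` is a weak solution on `Ω`. -/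
theorem inner_covariantGradient_eq {Ω : Opens (EuclideanSpace ℝ (Fin d))} (ha : ContDiff ℝ ∞ a)
    (hU : ContDiff ℝ ∞ U) {Λ : ℝ}
    (heq : ∀ z, ∑ j, covDeriv a j (covDeriv a j U) z = Λ * U z) {u : magneticH1 Ω a}
    (hu0 : embedding Ω a u =ᵐ[volume.restrict (Ω : Set (EuclideanSpace ℝ (Fin d)))] U)
    (hu1 : ∀ j, covariantGradient Ω a u j
        =ᵐ[volume.restrict (Ω : Set (EuclideanSpace ℝ (Fin d)))] covDeriv a j U)
    {v : magneticH1 Ω a} (hv : v ∈ magneticH10 Ω a) :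
    inner ℂ (covariantGradient Ω a v) (covariantGradient Ω a u) =
      (Λ : ℂ) * inner ℂ (embedding Ω a v) (embedding Ω a u) := by
  have hcl : IsClosed {v : magneticH1 Ω a |
      inner ℂ (covariantGradient Ω a v) (covariantGradient Ω a u) =
        (Λ : ℂ) * inner ℂ (embedding Ω a v) (embedding Ω a u)} :=
    isClosed_eq (by fun_prop) (by fun_prop)
  refine hcl.closure_subset_iff.2 (fun w hw => ?_) hv
  obtain ⟨φ, hφ⟩ := hw
  have hz : ∀ z, z ∉ (Ω : Set (EuclideanSpace ℝ (Fin d))) → z ∉ tsupport φ := fun z hz h0 =>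
    hz (φ.tsupport_subset h0)
  have hφs := φ.contDiff
  have hUj := contDiff_covDeriv ha hU
  have e1 : inner ℂ (embedding Ω a w) (embedding Ω a u) = ∫ z, starRingEnd ℂ (φ z) * U z := by
    rw [L2.inner_def, ← setIntegral_eq_integral_of_forall_compl_eq_zero
      (s := (Ω : Set (EuclideanSpace ℝ (Fin d)))) (f := fun z => starRingEnd ℂ (φ z) * U z)
      (fun z h => by rw [image_eq_zero_of_notMem_tsupport (hz z h), map_zero, zero_mul])]
    refine integral_congr_ae ?_
    filter_upwards [hφ, hu0] with z h1 h2
    rw [h1, h2, RCLike.inner_apply, mul_comm]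
  have e2 : ∀ j, inner ℂ (covariantGradient Ω a w j) (covariantGradient Ω a u j) =
      ∫ z, starRingEnd ℂ (φ z) * covDeriv a j (covDeriv a j U) z := fun j => by
    rw [← integral_conj_covDeriv_mul ha.continuous (hφs.of_le (by simp)) φ.hasCompactSupport
      ((hUj j).of_le (by simp)), L2.inner_def, ← setIntegral_eq_integral_of_forall_compl_eq_zero
      (s := (Ω : Set (EuclideanSpace ℝ (Fin d))))
      (f := fun z => starRingEnd ℂ (covDeriv a j φ z) * covDeriv a j U z)
      (fun z h => by rw [covDeriv_eq_zero (hz z h), map_zero, zero_mul])]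
    refine integral_congr_ae ?_
    filter_upwards [covariantGradient_ae_eq ha hφs φ.hasCompactSupport hφ j, hu1 j] with z h1 h2
    rw [h1, h2, RCLike.inner_apply, mul_comm]
  change inner ℂ _ _ = _
  rw [PiLp.inner_apply, e1, Finset.sum_congr rfl fun j _ => e2 j, ← integral_finsetSum,
    ← integral_const_mul]
  · refine integral_congr_ae (Filter.Eventually.of_forall fun z => ?_)
    change ∑ j, _ = _
    rw [← Finset.mul_sum, heq]
    ring
  · intro j _
    refine Continuous.integrable_of_hasCompactSupport ?_ ?_
    · exact (Complex.continuous_conj.comp hφs.continuous).mul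
        (contDiff_covDeriv ha (hUj j) j).continuous
    · exact (φ.hasCompactSupport.comp_left (g := starRingEnd ℂ) (map_zero _)).mul_right

end CovariantDerivative

/-! ### Magnetic translations -/

section MagneticTranslation

variable {d : ℕ}

/-- The function `z ↦ e^{i⟨b, z⟩} φ(z - w)`. For `b = A w` this is a magnetic translation, which
commutes with the covariant derivatives. -/
def twist (w b : EuclideanSpace ℝ (Fin d)) (φ : EuclideanSpace ℝ (Fin d) → ℂ)
    (z : EuclideanSpace ℝ (Fin d)) : ℂ :=
  Complex.exp (Complex.I * (inner ℝ b z : ℝ)) * φ (z - w)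

variable {w b : EuclideanSpace ℝ (Fin d)} {φ : EuclideanSpace ℝ (Fin d) → ℂ}

theorem norm_twist (z : EuclideanSpace ℝ (Fin d)) : ‖twist w b φ z‖ = ‖φ (z - w)‖ := by
  rw [twist, norm_mul, mul_comm Complex.I, Complex.norm_exp_ofReal_mul_I, one_mul]

theorem contDiff_phase (b : EuclideanSpace ℝ (Fin d)) {n : WithTop ℕ∞} :
    ContDiff ℝ n fun z : EuclideanSpace ℝ (Fin d) =>
      Complex.exp (Complex.I * (inner ℝ b z : ℝ)) := by
  have h : ContDiff ℝ n fun z : EuclideanSpace ℝ (Fin d) => ((inner ℝ b z : ℝ) : ℂ) :=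
    Complex.ofRealCLM.contDiff.comp (innerSL ℝ b).contDiff
  exact (contDiff_const.mul h).cexp

theorem contDiff_twist {n : WithTop ℕ∞} (hφ : ContDiff ℝ n φ) : ContDiff ℝ n (twist w b φ) :=
  (contDiff_phase b).mul (hφ.comp (contDiff_id.sub contDiff_const))

theorem hasCompactSupport_twist (hc : HasCompactSupport φ) : HasCompactSupport (twist w b φ) :=
  (hc.comp_homeomorph (Homeomorph.subRight w)).mul_left

theorem fderiv_twist (hφ : Differentiable ℝ φ) (z v : EuclideanSpace ℝ (Fin d)) :
    fderiv ℝ (twist w b φ) z v = Complex.exp (Complex.I * (inner ℝ b z : ℝ)) *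
      (fderiv ℝ φ (z - w) v + Complex.I * (inner ℝ b v : ℝ) * φ (z - w)) := by
  have h1 : HasFDerivAt (fun z : EuclideanSpace ℝ (Fin d) => ((inner ℝ b z : ℝ) : ℂ))
      (Complex.ofRealCLM.comp (innerSL ℝ b)) z :=
    Complex.ofRealCLM.hasFDerivAt.comp z (innerSL ℝ b).hasFDerivAt
  have h2 := (h1.const_mul Complex.I).cexp
  have h3 : HasFDerivAt (fun z => φ (z - w)) (fderiv ℝ φ (z - w)) z := by
    exact (hφ (z - w)).hasFDerivAt.comp z ((hasFDerivAt_id z).sub_const w)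
  have h4 := h2.mul h3
  have h5 : twist w b φ = (fun z => Complex.exp (Complex.I * (inner ℝ b z : ℝ))) *
    fun z => φ (z - w) := rfl
  rw [h5, h4.fderiv]
  simp
  ring

/-- Magnetic translations commute with the covariant derivatives of a linear vector potential. -/
theorem covDeriv_twist (A : EuclideanSpace ℝ (Fin d) →L[ℝ] EuclideanSpace ℝ (Fin d))
    (hφ : Differentiable ℝ φ) (j : Fin d) :
    covDeriv A j (twist w (A w) φ) = twist w (A w) (covDeriv A j φ) := by
  ext z
  rw [covDeriv, fderiv_twist hφ, twist, twist, covDeriv]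
  have h1 : inner ℝ (A w) (EuclideanSpace.single j (1 : ℝ)) = A w j := by
    rw [EuclideanSpace.inner_single_right]
    simp
  rw [h1, map_sub, PiLp.sub_apply]
  push_cast
  linear_combination (-Complex.exp (Complex.I * (inner ℝ (A w) z : ℝ)) * (A w j : ℂ) * φ (z - w)) *
    Complex.I_mul_I

end MagneticTranslation

/-! ### Solutions of the eigenvalue equation on the whole space -/

section WholeSpace

variable {d : ℕ}

/-- The complex Hilbert space `L₂(ℝᵈ)`. -/
abbrev L2Space (d : ℕ) : Type := Lp ℂ 2 (volume : Measure (EuclideanSpace ℝ (Fin d)))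

theorem aestronglyMeasurable_twist (w b : EuclideanSpace ℝ (Fin d))
    {u : EuclideanSpace ℝ (Fin d) → ℂ} (hu : AEStronglyMeasurable u volume) :
    AEStronglyMeasurable (twist w b u) volume :=
  ((contDiff_phase b (n := 0)).continuous.aestronglyMeasurable).mul
    (hu.comp_measurePreserving (measurePreserving_sub_right volume w))

theorem eLpNorm_twist (w b : EuclideanSpace ℝ (Fin d))
    {u : EuclideanSpace ℝ (Fin d) → ℂ} (hu : AEStronglyMeasurable u volume) :
    eLpNorm (twist w b u) 2 volume = eLpNorm u 2 volume := by
  rw [← eLpNorm_comp_measurePreserving hu (measurePreserving_sub_right volume w)]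
  exact eLpNorm_congr_norm_ae (Filter.Eventually.of_forall fun z => norm_twist z)

theorem memLp_twist (w b : EuclideanSpace ℝ (Fin d))
    {u : EuclideanSpace ℝ (Fin d) → ℂ} (hu : MemLp u 2 volume) :
    MemLp (twist w b u) 2 volume :=
  ⟨aestronglyMeasurable_twist w b hu.1, by rw [eLpNorm_twist w b hu.1]; exact hu.2⟩

theorem twist_ae_congr (w b : EuclideanSpace ℝ (Fin d))
    {u v : EuclideanSpace ℝ (Fin d) → ℂ} (h : u =ᵐ[volume] v) :
    twist w b u =ᵐ[volume] twist w b v := by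
  have := (measurePreserving_sub_right (volume : Measure (EuclideanSpace ℝ (Fin d)))
    w).quasiMeasurePreserving.ae_eq_comp h
  filter_upwards [this] with z hz
  have hz' : u (z - w) = v (z - w) := hz
  rw [twist, twist, hz']

/-- The unitary operator `u ↦ e^{i⟨b, z⟩} u(z - w)` of `L₂(ℝᵈ)`. -/
def twistLp (w b : EuclideanSpace ℝ (Fin d)) : L2Space d →ₗᵢ[ℂ] L2Space d where
  toFun u := (memLp_twist w b (Lp.memLp u)).toLp
  map_add' u v := by
    refine Lp.ext ?_
    filter_upwards [(memLp_twist w b (Lp.memLp (u + v))).coeFn_toLp,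
      (memLp_twist w b (Lp.memLp u)).coeFn_toLp, (memLp_twist w b (Lp.memLp v)).coeFn_toLp,
      Lp.coeFn_add (memLp_twist w b (Lp.memLp u)).toLp (memLp_twist w b (Lp.memLp v)).toLp,
      twist_ae_congr w b (Lp.coeFn_add u v)] with z h1 h2 h3 h4 h5
    rw [h1, h4, Pi.add_apply, h2, h3, h5, twist, twist, twist, Pi.add_apply, mul_add]
  map_smul' c u := by
    refine Lp.ext ?_
    filter_upwards [(memLp_twist w b (Lp.memLp (c • u))).coeFn_toLp,
      (memLp_twist w b (Lp.memLp u)).coeFn_toLp,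
      Lp.coeFn_smul c (memLp_twist w b (Lp.memLp u)).toLp,
      twist_ae_congr w b (Lp.coeFn_smul c u)] with z h1 h2 h4 h5
    rw [h1, RingHom.id_apply, h4, Pi.smul_apply, h2, h5, twist, twist, Pi.smul_apply,
      smul_eq_mul, smul_eq_mul, mul_left_comm]
  norm_map' u := by
    change ‖(memLp_twist w b (Lp.memLp u)).toLp‖ = _
    rw [Lp.norm_toLp, eLpNorm_twist w b (Lp.aestronglyMeasurable u), Lp.norm_def]

theorem coeFn_twistLp (w b : EuclideanSpace ℝ (Fin d)) (u : L2Space d) :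
    twistLp w b u =ᵐ[volume] twist w b u :=
  (memLp_twist w b (Lp.memLp u)).coeFn_toLp

variable (A : EuclideanSpace ℝ (Fin d) →L[ℝ] EuclideanSpace ℝ (Fin d))

/-- The graph of the covariant gradient on `C₀^∞(ℝᵈ)`. Only its closure is used, so the norm on the
product does not matter. -/
def testGraph : Submodule ℂ (L2Space d × (Fin d → L2Space d)) where
  carrier := {p | ∃ φ : EuclideanSpace ℝ (Fin d) → ℂ, ContDiff ℝ ∞ φ ∧ HasCompactSupport φ ∧
    p.1 =ᵐ[volume] φ ∧ ∀ j, p.2 j =ᵐ[volume] covDeriv A j φ}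
  add_mem' := by
    rintro p q ⟨φ, hφ, hφc, hp0, hp1⟩ ⟨ψ, hψ, hψc, hq0, hq1⟩
    refine ⟨φ + ψ, hφ.add hψ, hφc.add hψc, ?_, fun j => ?_⟩
    · filter_upwards [hp0, hq0, Lp.coeFn_add p.1 q.1] with z h1 h2 h3
      rw [Prod.fst_add, h3, Pi.add_apply, Pi.add_apply, h1, h2]
    · filter_upwards [hp1 j, hq1 j, Lp.coeFn_add (p.2 j) (q.2 j)] with z h1 h2 h3
      rw [Prod.snd_add, Pi.add_apply, h3, Pi.add_apply, h1, h2, covDeriv, covDeriv, covDeriv,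
        fderiv_add (hφ.differentiable (by simp) z) (hψ.differentiable (by simp) z)]
      simp only [add_apply, Pi.add_apply]
      ring
  zero_mem' := by
    refine ⟨0, contDiff_const, HasCompactSupport.zero, Lp.coeFn_zero _ _ _, fun j => ?_⟩
    filter_upwards [Lp.coeFn_zero ℂ 2 (volume : Measure (EuclideanSpace ℝ (Fin d)))] with z h1
    rw [Prod.snd_zero, Pi.zero_apply, h1, covDeriv, fderiv_zero]
    simp
  smul_mem' := by
    rintro c p ⟨φ, hφ, hφc, hp0, hp1⟩
    refine ⟨c • φ, contDiff_const.smul hφ, hφc.smul_left (f := fun _ => c), ?_, fun j => ?_⟩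
    · filter_upwards [hp0, Lp.coeFn_smul c p.1] with z h1 h3
      rw [Prod.smul_fst, h3, Pi.smul_apply, Pi.smul_apply, h1]
    · filter_upwards [hp1 j, Lp.coeFn_smul c (p.2 j)] with z h1 h3
      rw [Prod.smul_snd, Pi.smul_apply, h3, Pi.smul_apply, h1, covDeriv, covDeriv,
        fderiv_const_smul (hφ.differentiable (by simp) z)]
      simp only [smul_apply, Pi.smul_apply, smul_eq_mul]
      ring

/-- The space of all `u ∈ L₂(ℝᵈ)` in the domain of the closed form `‖(-i∇ - A)u‖²` that solve
`(-i∇ - A)² u = Λ u` weakly. -/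
def landauSpace (Λ : ℝ) : Submodule ℂ (L2Space d) where
  carrier := {u | ∃ g : Fin d → L2Space d, (u, g) ∈ (testGraph A).topologicalClosure ∧
    ∀ q ∈ (testGraph A).topologicalClosure,
      ∑ j, inner ℂ (q.2 j) (g j) = (Λ : ℂ) * inner ℂ q.1 u}
  add_mem' := by
    rintro u v ⟨g, hg, hg'⟩ ⟨h, hh, hh'⟩
    refine ⟨g + h, Submodule.add_mem _ hg hh, fun q hq => ?_⟩
    simp only [Pi.add_apply, inner_add_right, Finset.sum_add_distrib, hg' q hq, hh' q hq, mul_add]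
  zero_mem' := ⟨0, Submodule.zero_mem _, fun q _ => by simp⟩
  smul_mem' := by
    rintro c u ⟨g, hg, hg'⟩
    refine ⟨c • g, Submodule.smul_mem _ c hg, fun q hq => ?_⟩
    simp only [Pi.smul_apply, inner_smul_right, ← Finset.mul_sum, hg' q hq]
    ring

/-- The elements of `landauSpace A Λ` that vanish almost everywhere outside `S`. -/
def landauSpaceOn (Λ : ℝ) (S : Set (EuclideanSpace ℝ (Fin d))) : Submodule ℂ (L2Space d) where
  carrier := {u | u ∈ landauSpace A Λ ∧ ∀ᵐ z, z ∉ S → u z = 0}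
  add_mem' := by
    rintro u v ⟨hu, hu'⟩ ⟨hv, hv'⟩
    refine ⟨Submodule.add_mem _ hu hv, ?_⟩
    filter_upwards [hu', hv', Lp.coeFn_add u v] with z h1 h2 h3 hz
    rw [h3, Pi.add_apply, h1 hz, h2 hz, add_zero]
  zero_mem' := by
    refine ⟨Submodule.zero_mem _, ?_⟩
    filter_upwards [Lp.coeFn_zero ℂ 2 (volume : Measure (EuclideanSpace ℝ (Fin d)))] with z h1 _
    rw [h1, Pi.zero_apply]
  smul_mem' := by
    rintro c u ⟨hu, hu'⟩
    refine ⟨Submodule.smul_mem _ c hu, ?_⟩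
    filter_upwards [hu', Lp.coeFn_smul c u] with z h1 h3 hz
    rw [h3, Pi.smul_apply, h1 hz, smul_zero]

variable {A} {Λ : ℝ}

theorem landauSpaceOn_mono {S T : Set (EuclideanSpace ℝ (Fin d))} (h : S ⊆ T) :
    landauSpaceOn A Λ S ≤ landauSpaceOn A Λ T := by
  rintro u ⟨hu, hu'⟩
  refine ⟨hu, ?_⟩
  filter_upwards [hu'] with z h1 hz
  exact h1 fun h2 => hz (h h2)

theorem twistLp_mem_testGraph {p : L2Space d × (Fin d → L2Space d)} (hp : p ∈ testGraph A)
    (w : EuclideanSpace ℝ (Fin d)) :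
    (twistLp w (A w) p.1, fun j => twistLp w (A w) (p.2 j)) ∈ testGraph A := by
  obtain ⟨φ, hφ, hφc, hp0, hp1⟩ := hp
  refine ⟨twist w (A w) φ, contDiff_twist hφ, hasCompactSupport_twist hφc,
    (coeFn_twistLp _ _ _).trans (twist_ae_congr _ _ hp0), fun j => ?_⟩
  rw [covDeriv_twist A (hφ.differentiable (by simp))]
  exact (coeFn_twistLp _ _ _).trans (twist_ae_congr _ _ (hp1 j))

theorem twistLp_mem_closure {p : L2Space d × (Fin d → L2Space d)}
    (hp : p ∈ (testGraph A).topologicalClosure) (w : EuclideanSpace ℝ (Fin d)) :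
    (twistLp w (A w) p.1, fun j => twistLp w (A w) (p.2 j)) ∈
      (testGraph A).topologicalClosure := by
  have hc : Continuous fun p : L2Space d × (Fin d → L2Space d) =>
      (twistLp w (A w) p.1, fun j => twistLp w (A w) (p.2 j)) :=
    ((twistLp w (A w)).continuous.comp continuous_fst).prodMk
      (continuous_pi fun j => (twistLp w (A w)).continuous.comp
        ((continuous_apply j).comp continuous_snd))
  exact hc.closure_preimage_subset _ (closure_mono (fun q hq => twistLp_mem_testGraph hq w) hp)

theorem twistLp_twistLp_neg (hA : ∀ z, inner ℝ (A z) z = (0 : ℝ))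
    (w : EuclideanSpace ℝ (Fin d)) (u : L2Space d) :
    twistLp w (A w) (twistLp (-w) (A (-w)) u) = u := by
  refine Lp.ext ((coeFn_twistLp _ _ _).trans
    ((twist_ae_congr _ _ (coeFn_twistLp _ _ _)).trans ?_))
  refine Filter.Eventually.of_forall fun z => ?_
  rw [twist, twist, ← mul_assoc, ← Complex.exp_add, map_neg, inner_neg_left, inner_sub_right, hA,
    sub_zero, sub_neg_eq_add, sub_add_cancel]
  push_cast
  rw [mul_neg, add_neg_cancel, Complex.exp_zero, one_mul]

theorem twistLp_mem_landauSpace (hA : ∀ z, inner ℝ (A z) z = (0 : ℝ)) {u : L2Space d}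
    (hu : u ∈ landauSpace A Λ) (w : EuclideanSpace ℝ (Fin d)) :
    twistLp w (A w) u ∈ landauSpace A Λ := by
  obtain ⟨g, hg, hg'⟩ := hu
  refine ⟨fun j => twistLp w (A w) (g j), twistLp_mem_closure hg w, fun q hq => ?_⟩
  have h1 : ∀ x y : L2Space d,
      inner ℂ x (twistLp w (A w) y) = inner ℂ (twistLp (-w) (A (-w)) x) y := fun x y => by
    conv_lhs => rw [← twistLp_twistLp_neg hA w x]
    exact (twistLp w (A w)).inner_map_map _ _
  simp only [h1]
  exact hg' _ (twistLp_mem_closure hq (-w))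

theorem twistLp_mem_landauSpaceOn (hA : ∀ z, inner ℝ (A z) z = (0 : ℝ)) {u : L2Space d}
    {S : Set (EuclideanSpace ℝ (Fin d))} (hu : u ∈ landauSpaceOn A Λ S)
    (w : EuclideanSpace ℝ (Fin d)) :
    twistLp w (A w) u ∈ landauSpaceOn A Λ ((fun z => z - w) ⁻¹' S) := by
  refine ⟨twistLp_mem_landauSpace hA hu.1 w, ?_⟩
  have h1 := (measurePreserving_sub_right (volume : Measure (EuclideanSpace ℝ (Fin d)))
    w).quasiMeasurePreserving.ae hu.2
  filter_upwards [coeFn_twistLp w (A w) u, h1] with z h2 h3 hz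
  rw [h2, twist, h3 hz, mul_zero]

theorem sq_lintegral_le {α : Type*} [MeasurableSpace α] (μ : Measure α) {f : α → ℝ≥0∞}
    (hf : AEMeasurable f μ) : (∫⁻ x, f x ∂μ) ^ 2 ≤ μ univ * ∫⁻ x, f x ^ 2 ∂μ := by
  have h := ENNReal.lintegral_mul_le_Lp_mul_Lq μ Real.HolderConjugate.two_two hf
    (aemeasurable_const (b := (1 : ℝ≥0∞)))
  simp only [Pi.mul_apply, mul_one, ENNReal.one_rpow, lintegral_one] at h
  calc (∫⁻ x, f x ∂μ) ^ 2
      ≤ ((∫⁻ x, f x ^ (2 : ℝ) ∂μ) ^ (1 / 2 : ℝ) * μ univ ^ (1 / 2 : ℝ)) ^ 2 := by gcongr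
    _ = μ univ * ∫⁻ x, f x ^ 2 ∂μ := by
      rw [mul_pow, ← ENNReal.rpow_natCast, ← ENNReal.rpow_natCast, ← ENNReal.rpow_mul,
        ← ENNReal.rpow_mul, mul_comm]
      norm_num

theorem lintegral_enorm_sq_Lp (u : L2Space d) : ∫⁻ z, ‖u z‖ₑ ^ 2 = ‖u‖ₑ ^ 2 := by
  rw [Lp.enorm_def, eLpNorm_eq_lintegral_rpow_enorm_toReal (by norm_num) (by norm_num),
    ← ENNReal.rpow_natCast, ← ENNReal.rpow_mul]
  norm_num

/-- Along the segment from `0` to `h` the magnetic translations have a derivative that involves the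
covariant derivatives only; this uses that `A` is skew. -/
theorem hasDerivAt_twist_segment (hA : ∀ z, inner ℝ (A z) z = (0 : ℝ))
    {φ : EuclideanSpace ℝ (Fin d) → ℂ} (hφ : Differentiable ℝ φ)
    (h z : EuclideanSpace ℝ (Fin d)) (s : ℝ) :
    HasDerivAt (fun s : ℝ => twist (-(s • h)) (s • A h) φ z)
      (Complex.I * ∑ j, (h j : ℂ) * twist (-(s • h)) (s • A h) (covDeriv A j φ) z) s := by
  have h1 : HasDerivAt (fun s : ℝ => φ (z - -(s • h))) (fderiv ℝ φ (z - -(s • h)) h) s := by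
    have h2 : HasDerivAt (fun s : ℝ => z - -(s • h)) h s := by
      simpa using (((hasDerivAt_id s).smul_const h).neg.const_sub z)
    exact (hφ _).hasFDerivAt.comp_hasDerivAt s h2
  have h3 : HasDerivAt (fun s : ℝ => Complex.I * ((inner ℝ (s • A h) z : ℝ) : ℂ))
      (Complex.I * ((inner ℝ (A h) z : ℝ) : ℂ)) s := by
    have h4 : HasDerivAt (fun s : ℝ => inner ℝ (s • A h) z) (inner ℝ (A h) z) s := by
      simp only [real_inner_smul_left]
      simpa using (hasDerivAt_id s).mul_const (inner ℝ (A h) z)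
    exact h4.ofReal_comp.const_mul _
  refine (h3.cexp.mul h1).congr_deriv ?_
  have h5 : ∀ L : EuclideanSpace ℝ (Fin d) →L[ℝ] ℂ,
      L h = ∑ j, (h j : ℂ) * L (EuclideanSpace.single j (1 : ℝ)) := fun L => by
    conv_lhs => rw [← (EuclideanSpace.basisFun (Fin d) ℝ).sum_repr h, map_sum]
    refine Finset.sum_congr rfl fun j _ => ?_
    rw [map_smul]
    simp
  have h6 : inner ℝ (A h) z = -∑ j, h j * A (z - -(s • h)) j := by
    have e1 : inner ℝ (A (z - -(s • h))) h = ∑ j, h j * A (z - -(s • h)) j := by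
      rw [PiLp.inner_apply]
      exact Finset.sum_congr rfl fun j _ => by simp
    have e2 := hA (z + h)
    rw [map_add, inner_add_left, inner_add_right, inner_add_right, hA, hA] at e2
    rw [← e1, sub_neg_eq_add, map_add, map_smul, inner_add_left, real_inner_smul_left, hA]
    linarith
  rw [h5, h6]
  simp only [twist, covDeriv]
  push_cast
  simp only [Finset.mul_sum, Finset.sum_mul, ← Finset.sum_add_distrib, mul_neg, neg_mul,
    ← Finset.sum_neg_distrib]
  refine Finset.sum_congr rfl fun j _ => ?_
  linear_combination (Complex.exp (Complex.I * (inner ℝ (s • A h) z : ℝ)) *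
    fderiv ℝ φ (z - -(s • h)) (EuclideanSpace.single j (1 : ℝ)) * (h j : ℂ)) * Complex.I_mul_I

end WholeSpace

/-! ### The dimension of the space of solutions on a set of finite measure -/

section DimensionBound

variable {d : ℕ} {A : EuclideanSpace ℝ (Fin d) →L[ℝ] EuclideanSpace ℝ (Fin d)} {Λ : ℝ}

theorem sq_sum_ennreal_le (f : Fin d → ℝ≥0∞) : (∑ j, f j) ^ 2 ≤ d * ∑ j, f j ^ 2 := by
  have h := sq_lintegral_le (Measure.count : Measure (Fin d)) (f := f)
    (measurable_of_finite f).aemeasurable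
  rw [lintegral_count, lintegral_count, tsum_fintype, tsum_fintype] at h
  simpa using h

theorem lintegral_enorm_twist_sub_le (hA : ∀ z, inner ℝ (A z) z = (0 : ℝ))
    {φ : EuclideanSpace ℝ (Fin d) → ℂ} (hφ : ContDiff ℝ ∞ φ) (h : EuclideanSpace ℝ (Fin d)) :
    ∫⁻ z, ‖twist (-h) (A h) φ z - φ z‖ₑ ^ 2 ≤
      ‖h‖ₑ ^ 2 * (d * ∑ j, ∫⁻ z, ‖covDeriv A j φ z‖ₑ ^ 2) := by
  have hP : ∀ j, Continuous (covDeriv A j φ) := fun j =>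
    (contDiff_covDeriv A.contDiff hφ j).continuous
  set G : EuclideanSpace ℝ (Fin d) → ℝ → ℝ≥0∞ := fun z s =>
    ‖h‖ₑ ^ 2 * (d * ∑ j, ‖covDeriv A j φ (z - -(s • h))‖ₑ ^ 2) with hG
  have hGm : Measurable (Function.uncurry G) := by
    refine Measurable.const_mul (Measurable.const_mul (Finset.measurable_sum _ fun j _ => ?_) _) _
    have : Continuous fun p : EuclideanSpace ℝ (Fin d) × ℝ =>
        covDeriv A j φ (p.1 - -(p.2 • h)) := (hP j).comp (by fun_prop)
    exact this.measurable.enorm.pow_const 2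
  have hpt : ∀ z, ‖twist (-h) (A h) φ z - φ z‖ₑ ^ 2 ≤ ∫⁻ s in Ioc (0 : ℝ) 1, G z s := fun z => by
    set F : ℝ → ℂ := fun s =>
      Complex.I * ∑ j, (h j : ℂ) * twist (-(s • h)) (s • A h) (covDeriv A j φ) z with hF
    have hFc : Continuous F := by
      refine continuous_const.mul (continuous_finsetSum _ fun j _ => continuous_const.mul ?_)
      refine Continuous.mul ?_ ((hP j).comp (by fun_prop))
      refine Complex.continuous_exp.comp (continuous_const.mul (Complex.continuous_ofReal.comp ?_))
      fun_prop
    have hftc : ∫ s in (0 : ℝ)..1, F s = twist (-h) (A h) φ z - φ z := by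
      rw [intervalIntegral.integral_eq_sub_of_hasDerivAt
        (fun s _ => hasDerivAt_twist_segment hA (hφ.differentiable (by simp)) h z s)
        (hFc.intervalIntegrable _ _)]
      simp [twist]
    have hFG : ∀ s, ‖F s‖ₑ ^ 2 ≤ G z s := fun s => by
      have h1 : ‖F s‖ₑ ≤ ‖h‖ₑ * ∑ j, ‖covDeriv A j φ (z - -(s • h))‖ₑ := by
        have hI : ‖Complex.I‖ₑ = 1 := by rw [← ofReal_norm]; simp
        rw [hF, enorm_mul, hI, one_mul, Finset.mul_sum]
        refine (enorm_sum_le _ _).trans (Finset.sum_le_sum fun j _ => ?_)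
        rw [enorm_mul]
        refine mul_le_mul' ?_ (le_of_eq ?_)
        · rw [← ofReal_norm, ← ofReal_norm, Complex.norm_real]
          exact ENNReal.ofReal_le_ofReal (PiLp.norm_apply_le h j)
        · rw [← ofReal_norm, ← ofReal_norm, norm_twist]
      calc ‖F s‖ₑ ^ 2 ≤ (‖h‖ₑ * ∑ j, ‖covDeriv A j φ (z - -(s • h))‖ₑ) ^ 2 := by gcongr
        _ ≤ G z s := by
          rw [mul_pow]
          exact mul_le_mul' le_rfl (sq_sum_ennreal_le _)
    have h2 := sq_lintegral_le (volume.restrict (Ioc (0 : ℝ) 1)) (f := fun s => ‖F s‖ₑ)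
      hFc.measurable.enorm.aemeasurable
    rw [← hftc, intervalIntegral.integral_of_le zero_le_one]
    calc ‖∫ s in Ioc (0 : ℝ) 1, F s‖ₑ ^ 2 ≤ (∫⁻ s in Ioc (0 : ℝ) 1, ‖F s‖ₑ) ^ 2 := by
          gcongr
          exact enorm_integral_le_lintegral_enorm _
      _ ≤ _ := h2
      _ ≤ ∫⁻ s in Ioc (0 : ℝ) 1, G z s := by
          rw [Measure.restrict_apply_univ, Real.volume_Ioc, sub_zero, ENNReal.ofReal_one, one_mul]
          exact lintegral_mono hFG
  calc ∫⁻ z, ‖twist (-h) (A h) φ z - φ z‖ₑ ^ 2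
      ≤ ∫⁻ z, ∫⁻ s in Ioc (0 : ℝ) 1, G z s := lintegral_mono hpt
    _ = ∫⁻ s in Ioc (0 : ℝ) 1, ∫⁻ z, G z s := lintegral_lintegral_swap hGm.aemeasurable
    _ = ∫⁻ s in Ioc (0 : ℝ) 1, ‖h‖ₑ ^ 2 * (d * ∑ j, ∫⁻ z, ‖covDeriv A j φ z‖ₑ ^ 2) := by
      refine lintegral_congr fun s => ?_
      have hm : ∀ j, Measurable fun z => ‖covDeriv A j φ (z - -(s • h))‖ₑ ^ 2 := fun j =>
        ((hP j).comp (continuous_id.sub continuous_const)).measurable.enorm.pow_const 2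
      rw [lintegral_const_mul _ (Measurable.const_mul (Finset.measurable_sum _ fun j _ => hm j) _),
        lintegral_const_mul _ (Finset.measurable_sum _ fun j _ => hm j),
        lintegral_finsetSum _ fun j _ => hm j]
      congr 3
      funext j
      exact lintegral_sub_right_eq_self (fun z => ‖covDeriv A j φ z‖ₑ ^ 2) _
    _ = _ := by simp

/-- Magnetic translation by `h` moves a function by at most a multiple of `|h|` times the
norm of its covariant gradient. -/
theorem norm_twistLp_sub_le (hA : ∀ z, inner ℝ (A z) z = (0 : ℝ))
    {p : L2Space d × (Fin d → L2Space d)} (hp : p ∈ (testGraph A).topologicalClosure)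
    (h : EuclideanSpace ℝ (Fin d)) :
    ‖twistLp (-h) (A h) p.1 - p.1‖ ^ 2 ≤ ‖h‖ ^ 2 * (d * ∑ j, ‖p.2 j‖ ^ 2) := by
  have hcl : IsClosed {p : L2Space d × (Fin d → L2Space d) |
      ‖twistLp (-h) (A h) p.1 - p.1‖ ^ 2 ≤ ‖h‖ ^ 2 * (d * ∑ j, ‖p.2 j‖ ^ 2)} := by
    refine isClosed_le ?_ (by fun_prop)
    exact ((((twistLp (-h) (A h)).continuous.comp continuous_fst).sub
      continuous_fst).norm).pow 2
  refine hcl.closure_subset_iff.2 (fun q hq => ?_) hp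
  obtain ⟨φ, hφ, hφc, hq0, hq1⟩ := hq
  have h1 := lintegral_enorm_twist_sub_le hA hφ h
  have e1 : ∫⁻ z, ‖twist (-h) (A h) φ z - φ z‖ₑ ^ 2 = ‖twistLp (-h) (A h) q.1 - q.1‖ₑ ^ 2 := by
    rw [← lintegral_enorm_sq_Lp]
    refine lintegral_congr_ae ?_
    filter_upwards [Lp.coeFn_sub (twistLp (-h) (A h) q.1) q.1, hq0,
      (coeFn_twistLp (-h) (A h) q.1).trans (twist_ae_congr _ _ hq0)] with z h2 h3 h4
    rw [h2, Pi.sub_apply, h3, h4]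
  have e2 : ∀ j, ∫⁻ z, ‖covDeriv A j φ z‖ₑ ^ 2 = ‖q.2 j‖ₑ ^ 2 := fun j => by
    rw [← lintegral_enorm_sq_Lp]
    refine lintegral_congr_ae ?_
    filter_upwards [hq1 j] with z h2
    rw [h2]
  simp only [e1, e2] at h1
  simp only [← ofReal_norm] at h1
  have h3 : ∀ x : ℝ, 0 ≤ x → ENNReal.ofReal x ^ 2 = ENNReal.ofReal (x ^ 2) := fun x hx =>
    (ENNReal.ofReal_pow hx 2).symm
  rw [h3 _ (norm_nonneg _), h3 _ (norm_nonneg _),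
    Finset.sum_congr rfl fun j _ => h3 _ (norm_nonneg (q.2 j)),
    ← ENNReal.ofReal_sum_of_nonneg fun j _ => sq_nonneg _, ← ENNReal.ofReal_natCast,
    ← ENNReal.ofReal_mul (by positivity), ← ENNReal.ofReal_mul (by positivity),
    ENNReal.ofReal_le_ofReal_iff (by positivity)] at h1
  exact h1

/-- Magnetic translation by a small vector moves a solution of the eigenvalue equation by at most
half of its norm. -/
theorem lintegral_twist_sub_le_of_mem (hA : ∀ z, inner ℝ (A z) z = (0 : ℝ)) {u : L2Space d}
    (hu : u ∈ landauSpace A Λ) {h : EuclideanSpace ℝ (Fin d)}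
    (hh : ‖h‖ ^ 2 * (d * Λ) ≤ 1 / 4) :
    ∫⁻ z, ‖u z - twist (-h) (A h) u z‖ₑ ^ 2 ≤ ENNReal.ofReal (1 / 4) * ‖u‖ₑ ^ 2 := by
  obtain ⟨g, hg, hg'⟩ := hu
  have h1 : ∑ j, ‖g j‖ ^ 2 = Λ * ‖u‖ ^ 2 := by
    have h2 := hg' _ hg
    simp only [inner_self_eq_norm_sq_to_K] at h2
    refine Complex.ofReal_injective ?_
    push_cast
    exact h2
  have h2 := norm_twistLp_sub_le hA hg h
  have h3 : ‖u - twistLp (-h) (A h) u‖ ^ 2 ≤ 1 / 4 * ‖u‖ ^ 2 := by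
    rw [norm_sub_rev]
    refine h2.trans ?_
    simp only [h1]
    nlinarith [mul_le_mul_of_nonneg_right hh (sq_nonneg ‖u‖)]
  have e1 : ∫⁻ z, ‖u z - twist (-h) (A h) u z‖ₑ ^ 2 = ‖u - twistLp (-h) (A h) u‖ₑ ^ 2 := by
    rw [← lintegral_enorm_sq_Lp]
    refine lintegral_congr_ae ?_
    filter_upwards [Lp.coeFn_sub u (twistLp (-h) (A h) u),
      coeFn_twistLp (-h) (A h) u] with z h2 h4
    rw [h2, Pi.sub_apply, h4]
  rw [e1, ← ofReal_norm, ← ofReal_norm, ← ENNReal.ofReal_pow (norm_nonneg _),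
    ← ENNReal.ofReal_pow (norm_nonneg _), ← ENNReal.ofReal_mul (by norm_num)]
  exact ENNReal.ofReal_le_ofReal h3

/-- The kernel, as a function of `y`, of the average of magnetic translations over a ball of
radius `r`, cut off to `S`. -/
def averageKernel (A : EuclideanSpace ℝ (Fin d) →L[ℝ] EuclideanSpace ℝ (Fin d))
    (S : Set (EuclideanSpace ℝ (Fin d))) (r : ℝ) (z : EuclideanSpace ℝ (Fin d)) :
    EuclideanSpace ℝ (Fin d) → ℂ :=
  (Metric.ball z r ∩ S).indicator fun y => Complex.exp (-Complex.I * (inner ℝ (A y) z : ℝ))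

theorem memLp_averageKernel {S : Set (EuclideanSpace ℝ (Fin d))} (hS : MeasurableSet S) (r : ℝ)
    (z : EuclideanSpace ℝ (Fin d)) : MemLp (averageKernel A S r z) 2 volume := by
  have hm : MeasurableSet (Metric.ball z r ∩ S) := measurableSet_ball.inter hS
  rw [averageKernel, memLp_indicator_iff_restrict hm]
  have : IsFiniteMeasure (volume.restrict (Metric.ball z r ∩ S)) :=
    ⟨by simpa using (measure_mono inter_subset_left).trans_lt (measure_ball_lt_top (x := z))⟩
  refine MemLp.of_bound (C := 1) ?_ (Filter.Eventually.of_forall fun y => ?_)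
  · exact Continuous.aestronglyMeasurable (by fun_prop)
  · have : -Complex.I * ((inner ℝ (A y) z : ℝ) : ℂ) = ((-inner ℝ (A y) z : ℝ) : ℂ) * Complex.I := by
      push_cast; ring
    rw [this, Complex.norm_exp_ofReal_mul_I]

theorem enorm_averageKernel_sq {S : Set (EuclideanSpace ℝ (Fin d))} (hS : MeasurableSet S) (r : ℝ)
    (z : EuclideanSpace ℝ (Fin d)) :
    ‖(memLp_averageKernel (A := A) hS r z).toLp‖ₑ ^ 2 = volume (Metric.ball z r ∩ S) := by
  have hm : MeasurableSet (Metric.ball z r ∩ S) := measurableSet_ball.inter hS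
  rw [← lintegral_enorm_sq_Lp, ← lintegral_indicator_one hm]
  refine lintegral_congr_ae ?_
  filter_upwards [(memLp_averageKernel (A := A) hS r z).coeFn_toLp] with y hy
  rw [hy, averageKernel]
  by_cases h : y ∈ Metric.ball z r ∩ S
  · rw [indicator_of_mem h, indicator_of_mem h]
    have : -Complex.I * ((inner ℝ (A y) z : ℝ) : ℂ) = ((-inner ℝ (A y) z : ℝ) : ℂ) * Complex.I := by
      push_cast; ring
    rw [← ofReal_norm, this, Complex.norm_exp_ofReal_mul_I]
    simp
  · rw [indicator_of_notMem h, indicator_of_notMem h]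
    simp

theorem lintegral_volume_ball_inter (S : Set (EuclideanSpace ℝ (Fin d))) (r : ℝ) :
    ∫⁻ z, volume (Metric.ball z r ∩ S) =
      volume (Metric.ball (0 : EuclideanSpace ℝ (Fin d)) r) * volume S := by
  have e1 : ∀ z : EuclideanSpace ℝ (Fin d), volume (Metric.ball z r ∩ S) =
      ∫⁻ y in S, (Metric.ball (0 : EuclideanSpace ℝ (Fin d)) r).indicator 1 (y - z) := fun z => by
    rw [← Measure.restrict_apply measurableSet_ball, ← lintegral_indicator_one measurableSet_ball]
    refine lintegral_congr fun y => ?_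
    simp only [indicator, Metric.mem_ball, dist_eq_norm, sub_zero]
    rfl
  simp only [e1]
  rw [lintegral_lintegral_swap]
  · have e2 : ∀ y : EuclideanSpace ℝ (Fin d),
        ∫⁻ z, (Metric.ball (0 : EuclideanSpace ℝ (Fin d)) r).indicator 1 (y - z) =
          volume (Metric.ball (0 : EuclideanSpace ℝ (Fin d)) r) := fun y => by
      rw [lintegral_sub_left_eq_self
        (fun z => (Metric.ball (0 : EuclideanSpace ℝ (Fin d)) r).indicator
          (1 : EuclideanSpace ℝ (Fin d) → ℝ≥0∞) z) y,
        lintegral_indicator_one measurableSet_ball]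
    simp only [e2]
    rw [lintegral_const, Measure.restrict_apply_univ]
  · refine Measurable.aemeasurable ?_
    exact (measurable_one.indicator measurableSet_ball).comp (measurable_snd.sub measurable_fst)

theorem ennreal_le_four_mul {x y : ℝ≥0∞} (hx : x ≠ ⊤)
    (h : x ≤ 2 * (ENNReal.ofReal (1 / 4) * x) + 2 * y) : x ≤ 4 * y := by
  by_cases hy : y = ⊤
  · rw [hy, ENNReal.mul_top (by norm_num)]
    exact le_top
  · have h2 := ENNReal.toReal_mono (by finiteness) h
    rw [ENNReal.toReal_add (by finiteness) (by finiteness), ENNReal.toReal_mul, ENNReal.toReal_mul,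
      ENNReal.toReal_mul, ENNReal.toReal_ofReal (by norm_num)] at h2
    rw [← ENNReal.toReal_le_toReal hx (by finiteness), ENNReal.toReal_mul]
    norm_num at h2 ⊢
    linarith

/-- The averaging operator is bounded below on the solutions that are supported in `S`, since
small translations hardly move them. -/
theorem le_lintegral_inner_averageKernel (hA : ∀ z, inner ℝ (A z) z = (0 : ℝ)) {u : L2Space d}
    {S : Set (EuclideanSpace ℝ (Fin d))} (hS : MeasurableSet S) (hu : u ∈ landauSpaceOn A Λ S)
    {r : ℝ} (hr : ∀ h ∈ Metric.ball (0 : EuclideanSpace ℝ (Fin d)) r,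
      ‖h‖ ^ 2 * (d * Λ) ≤ 1 / 4) :
    volume (Metric.ball (0 : EuclideanSpace ℝ (Fin d)) r) ^ 2 * ‖u‖ₑ ^ 2 ≤
      4 * ∫⁻ z, ‖inner ℂ (memLp_averageKernel (A := A) hS r z).toLp u‖ₑ ^ 2 := by
  set m := volume (Metric.ball (0 : EuclideanSpace ℝ (Fin d)) r) with hm
  have hmt : m ≠ ⊤ := measure_ball_lt_top.ne
  have hum : Measurable u := (Lp.stronglyMeasurable u).measurable
  set J : EuclideanSpace ℝ (Fin d) → EuclideanSpace ℝ (Fin d) → ℝ≥0∞ := fun z h =>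
    ‖u z - twist (-h) (A h) u z‖ₑ ^ 2 with hJ
  have hJm : Measurable (Function.uncurry J) := by
    refine Measurable.pow_const (Measurable.enorm ?_) 2
    refine (hum.comp measurable_fst).sub (Measurable.mul ?_ ?_)
    · exact Continuous.measurable (by fun_prop)
    · exact hum.comp (by fun_prop)
  set K : EuclideanSpace ℝ (Fin d) → ℝ≥0∞ := fun z =>
    m * ∫⁻ h in Metric.ball (0 : EuclideanSpace ℝ (Fin d)) r, J z h with hK
  have hJi : Measurable fun z => ∫⁻ h in Metric.ball (0 : EuclideanSpace ℝ (Fin d)) r, J z h :=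
    hJm.lintegral_prod_right'
  have hKm : Measurable K := hJi.const_mul _
  -- Compare `m u(z)` with the average of the translates of `u` at `z`.
  have hpt : ∀ z, m ^ 2 * ‖u z‖ₑ ^ 2 ≤
      2 * K z + 2 * ‖inner ℂ (memLp_averageKernel (A := A) hS r z).toLp u‖ₑ ^ 2 := fun z => by
    have hint : IntegrableOn (fun y => Complex.exp (Complex.I * (inner ℝ (A y) z : ℝ)) * u y)
        (Metric.ball z r) := by
      have hfin : IsFiniteMeasure (volume.restrict (Metric.ball z r)) :=
        ⟨by simpa using measure_ball_lt_top (x := z)⟩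
      have h1 : IntegrableOn u (Metric.ball z r) :=
        ((Lp.memLp u).restrict (Metric.ball z r)).integrable (by norm_num)
      refine Integrable.mono' h1.norm ?_ (Filter.Eventually.of_forall fun y => ?_)
      · exact (Continuous.aestronglyMeasurable (by fun_prop)).mul h1.aestronglyMeasurable
      · rw [norm_mul, mul_comm Complex.I, Complex.norm_exp_ofReal_mul_I, one_mul]
    have e1 : inner ℂ (memLp_averageKernel (A := A) hS r z).toLp u =
        ∫ y in Metric.ball z r, Complex.exp (Complex.I * (inner ℝ (A y) z : ℝ)) * u y := by
      rw [L2.inner_def, ← integral_indicator measurableSet_ball]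
      refine integral_congr_ae ?_
      filter_upwards [(memLp_averageKernel (A := A) hS r z).coeFn_toLp, hu.2] with y h1 h2
      rw [h1, averageKernel, RCLike.inner_apply]
      by_cases hyb : y ∈ Metric.ball z r
      · rw [indicator_of_mem hyb]
        by_cases hyS : y ∈ S
        · rw [indicator_of_mem (show y ∈ Metric.ball z r ∩ S from ⟨hyb, hyS⟩),
            ← Complex.exp_conj, mul_comm]
          simp
        · rw [h2 hyS, zero_mul, mul_zero]
      · rw [indicator_of_notMem hyb, indicator_of_notMem fun h => hyb h.1, map_zero, mul_zero]
    have hball : volume.real (Metric.ball z r) = m.toReal := by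
      rw [measureReal_def, hm, Measure.addHaar_ball_center]
    have hfin : IsFiniteMeasure (volume.restrict (Metric.ball z r)) :=
      ⟨by simpa using measure_ball_lt_top (x := z)⟩
    have e2 : (m.toReal : ℂ) * u z - inner ℂ (memLp_averageKernel (A := A) hS r z).toLp u =
        ∫ y in Metric.ball z r, (u z - Complex.exp (Complex.I * (inner ℝ (A y) z : ℝ)) * u y) := by
      rw [integral_sub (integrable_const _) hint, e1, setIntegral_const, hball,
        Complex.real_smul]
    have e3 : ∫⁻ y in Metric.ball z r,
        ‖u z - Complex.exp (Complex.I * (inner ℝ (A y) z : ℝ)) * u y‖ₑ ^ 2 =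
          ∫⁻ h in Metric.ball (0 : EuclideanSpace ℝ (Fin d)) r, J z h := by
      rw [← lintegral_indicator measurableSet_ball, ← lintegral_indicator measurableSet_ball,
        ← lintegral_add_left_eq_self _ z]
      refine lintegral_congr fun h => ?_
      have hb : z + h ∈ Metric.ball z r ↔ h ∈ Metric.ball (0 : EuclideanSpace ℝ (Fin d)) r := by
        simp
      by_cases hh : h ∈ Metric.ball (0 : EuclideanSpace ℝ (Fin d)) r
      · rw [indicator_of_mem hh, indicator_of_mem (hb.2 hh), hJ]
        simp only [twist, map_add, inner_add_left, hA, zero_add, sub_neg_eq_add]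
      · rw [indicator_of_notMem hh, indicator_of_notMem fun h' => hh (hb.1 h')]
    have h4 : ‖(m.toReal : ℂ) * u z -
        inner ℂ (memLp_averageKernel (A := A) hS r z).toLp u‖ₑ ^ 2 ≤ K z := by
      rw [e2]
      have hmeas : Measurable fun y =>
          ‖u z - Complex.exp (Complex.I * (inner ℝ (A y) z : ℝ)) * u y‖ₑ := by
        refine Measurable.enorm (measurable_const.sub (Measurable.mul ?_ hum))
        exact Continuous.measurable (by fun_prop)
      have h5 := sq_lintegral_le (volume.restrict (Metric.ball z r)) hmeas.aemeasurable
      rw [e3, Measure.restrict_apply_univ, Measure.addHaar_ball_center] at h5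
      refine le_trans ?_ h5
      gcongr
      exact enorm_integral_le_lintegral_enorm _
    set x : ℂ := inner ℂ (memLp_averageKernel (A := A) hS r z).toLp u with hx
    have h6 : m * ‖u z‖ₑ ≤ ‖(m.toReal : ℂ) * u z - x‖ₑ + ‖x‖ₑ := by
      have h7 : m * ‖u z‖ₑ = ‖(m.toReal : ℂ) * u z‖ₑ := by
        rw [enorm_mul, ← ofReal_norm (m.toReal : ℂ), Complex.norm_real,
          Real.norm_of_nonneg ENNReal.toReal_nonneg, ENNReal.ofReal_toReal hmt]
      rw [h7]
      calc ‖(m.toReal : ℂ) * u z‖ₑ = ‖((m.toReal : ℂ) * u z - x) + x‖ₑ := by rw [sub_add_cancel]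
        _ ≤ _ := enorm_add_le _ _
    calc m ^ 2 * ‖u z‖ₑ ^ 2 = (m * ‖u z‖ₑ) ^ 2 := by rw [mul_pow]
      _ ≤ (‖(m.toReal : ℂ) * u z - x‖ₑ + ‖x‖ₑ) ^ 2 := by gcongr
      _ ≤ 2 * (‖(m.toReal : ℂ) * u z - x‖ₑ ^ 2 + ‖x‖ₑ ^ 2) := by
        have := sq_sum_ennreal_le ![‖(m.toReal : ℂ) * u z - x‖ₑ, ‖x‖ₑ]
        simpa [Fin.sum_univ_two] using this
      _ ≤ 2 * K z + 2 * ‖x‖ₑ ^ 2 := by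
        rw [mul_add]
        gcongr
  have hKint : ∫⁻ z, K z ≤ m ^ 2 * (ENNReal.ofReal (1 / 4) * ‖u‖ₑ ^ 2) := by
    have h1 : ∫⁻ z, K z = m * ∫⁻ z, ∫⁻ h in Metric.ball (0 : EuclideanSpace ℝ (Fin d)) r, J z h :=
      lintegral_const_mul m hJi
    rw [h1, lintegral_lintegral_swap hJm.aemeasurable, sq, mul_assoc]
    refine mul_le_mul' le_rfl ?_
    calc ∫⁻ h in Metric.ball (0 : EuclideanSpace ℝ (Fin d)) r, ∫⁻ z, J z h
        ≤ ∫⁻ h in Metric.ball (0 : EuclideanSpace ℝ (Fin d)) r,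
            ENNReal.ofReal (1 / 4) * ‖u‖ₑ ^ 2 :=
          setLIntegral_mono' measurableSet_ball fun h hh =>
            lintegral_twist_sub_le_of_mem hA hu.1 (hr h hh)
      _ = m * (ENNReal.ofReal (1 / 4) * ‖u‖ₑ ^ 2) := by
          rw [lintegral_const, Measure.restrict_apply_univ, mul_comm]
  set I := ∫⁻ z, ‖inner ℂ (memLp_averageKernel (A := A) hS r z).toLp u‖ₑ ^ 2 with hI
  refine ennreal_le_four_mul (ENNReal.mul_ne_top (ENNReal.pow_ne_top hmt)
    (ENNReal.pow_ne_top enorm_ne_top)) ?_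
  calc m ^ 2 * ‖u‖ₑ ^ 2 = ∫⁻ z, m ^ 2 * ‖u z‖ₑ ^ 2 := by
        rw [lintegral_const_mul _ (hum.enorm.pow_const 2), lintegral_enorm_sq_Lp]
    _ ≤ ∫⁻ z, (2 * K z + 2 * ‖inner ℂ (memLp_averageKernel (A := A) hS r z).toLp u‖ₑ ^ 2) :=
        lintegral_mono hpt
    _ = 2 * (∫⁻ z, K z) + 2 * I :=
        (lintegral_add_left (hKm.const_mul 2) _).trans
          (congrArg₂ _ (lintegral_const_mul 2 hKm) (lintegral_const_mul' _ _ (by norm_num)))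
    _ ≤ _ := by
        refine add_le_add (mul_le_mul' le_rfl (hKint.trans (le_of_eq ?_))) le_rfl
        rw [mul_left_comm]

theorem sum_lintegral_le_lintegral_sum {α ι : Type*} [MeasurableSpace α] (μ : Measure α)
    (s : Finset ι) (f : ι → α → ℝ≥0∞) :
    ∑ i ∈ s, ∫⁻ x, f i x ∂μ ≤ ∫⁻ x, ∑ i ∈ s, f i x ∂μ := by
  classical
  induction s using Finset.induction_on with
  | empty => simp
  | insert i s hi ih =>
    simp only [Finset.sum_insert hi]
    exact (add_le_add le_rfl ih).trans (le_lintegral_add _ _)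

/-- By Bessel's inequality, the lower bound for the averaging operator limits the number of
orthonormal solutions by its Hilbert–Schmidt norm. -/
theorem card_mul_le_of_orthonormal (hA : ∀ z, inner ℝ (A z) z = (0 : ℝ))
    {S : Set (EuclideanSpace ℝ (Fin d))} (hS : MeasurableSet S) {n : ℕ} {v : Fin n → L2Space d}
    (hv : Orthonormal ℂ v) (hvS : ∀ i, v i ∈ landauSpaceOn A Λ S) {r : ℝ}
    (hr : ∀ h ∈ Metric.ball (0 : EuclideanSpace ℝ (Fin d)) r, ‖h‖ ^ 2 * (d * Λ) ≤ 1 / 4) :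
    n * volume (Metric.ball (0 : EuclideanSpace ℝ (Fin d)) r) ^ 2 ≤
      4 * (volume (Metric.ball (0 : EuclideanSpace ℝ (Fin d)) r) * volume S) := by
  set m := volume (Metric.ball (0 : EuclideanSpace ℝ (Fin d)) r) with hm
  calc n * m ^ 2 = ∑ i : Fin n, m ^ 2 * ‖v i‖ₑ ^ 2 := by
        have h1 : ∀ i, ‖v i‖ₑ = 1 := fun i => by rw [← ofReal_norm, hv.1 i, ENNReal.ofReal_one]
        simp [h1]
    _ ≤ ∑ i : Fin n, 4 * ∫⁻ z, ‖inner ℂ (memLp_averageKernel (A := A) hS r z).toLp (v i)‖ₑ ^ 2 :=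
        Finset.sum_le_sum fun i _ => le_lintegral_inner_averageKernel hA hS (hvS i) hr
    _ ≤ 4 * ∫⁻ z, ∑ i : Fin n,
          ‖inner ℂ (memLp_averageKernel (A := A) hS r z).toLp (v i)‖ₑ ^ 2 := by
        rw [← Finset.mul_sum]
        gcongr
        exact sum_lintegral_le_lintegral_sum _ _ _
    _ ≤ 4 * ∫⁻ z, volume (Metric.ball z r ∩ S) := by
        gcongr with z
        rw [← enorm_averageKernel_sq (A := A) hS r z]
        set k := (memLp_averageKernel (A := A) hS r z).toLp
        have h2 := hv.sum_inner_products_le (x := k) (s := Finset.univ)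
        have h3 : ∀ x : ℂ, ‖x‖ₑ ^ 2 = ENNReal.ofReal (‖x‖ ^ 2) := fun x => by
          rw [← ofReal_norm, ENNReal.ofReal_pow (norm_nonneg _)]
        rw [Finset.sum_congr rfl fun i _ => h3 _,
          ← ENNReal.ofReal_sum_of_nonneg fun i _ => sq_nonneg _, ← ofReal_norm k,
          ← ENNReal.ofReal_pow (norm_nonneg _)]
        refine ENNReal.ofReal_le_ofReal ?_
        simpa only [norm_inner_symm] using h2
    _ = 4 * (m * volume S) := by rw [lintegral_volume_ball_inter]

/-- Solutions of the eigenvalue equation supported in a set of measure at most `M` span a space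
whose dimension is bounded in terms of `M`. -/
theorem exists_finrank_landauSpaceOn_le (hA : ∀ z, inner ℝ (A z) z = (0 : ℝ)) (Λ : ℝ)
    {M : ℝ≥0∞} (hM : M ≠ ⊤) :
    ∃ N : ℕ, ∀ S : Set (EuclideanSpace ℝ (Fin d)), MeasurableSet S → volume S ≤ M →
      FiniteDimensional ℂ (landauSpaceOn A Λ S) ∧
        Module.finrank ℂ (landauSpaceOn A Λ S) ≤ N := by
  obtain ⟨r, hr0, hr⟩ : ∃ r : ℝ, 0 < r ∧ ∀ h ∈ Metric.ball (0 : EuclideanSpace ℝ (Fin d)) r,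
      ‖h‖ ^ 2 * (d * Λ) ≤ 1 / 4 := by
    have hc : ContinuousAt (fun h : EuclideanSpace ℝ (Fin d) => ‖h‖ ^ 2 * (d * Λ)) 0 := by fun_prop
    have h1 : ∀ᶠ h in nhds (0 : EuclideanSpace ℝ (Fin d)), ‖h‖ ^ 2 * (d * Λ) < 1 / 4 := by
      refine hc.eventually_lt continuousAt_const ?_
      norm_num
    obtain ⟨r, hr0, hr⟩ := Metric.eventually_nhds_iff_ball.1 h1
    exact ⟨r, hr0, fun h hh => (hr h hh).le⟩
  set m := volume (Metric.ball (0 : EuclideanSpace ℝ (Fin d)) r) with hm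
  have hm0 : m ≠ 0 := (Metric.measure_ball_pos volume _ hr0).ne'
  have hmt : m ≠ ⊤ := measure_ball_lt_top.ne
  obtain ⟨N, hN⟩ := ENNReal.exists_nat_gt (r := 4 * M / m)
    (ENNReal.div_ne_top (ENNReal.mul_ne_top (by norm_num) hM) hm0)
  refine ⟨N, fun S hS hSM => ?_⟩
  have hrank : Module.rank ℂ (landauSpaceOn A Λ S) ≤ N := by
    refine rank_le fun s hs => ?_
    set W := Submodule.span ℂ (range fun i : s => ((i : landauSpaceOn A Λ S) : L2Space d)) with hW
    have hli : LinearIndependent ℂ fun i : s => ((i : landauSpaceOn A Λ S) : L2Space d) :=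
      hs.map' (landauSpaceOn A Λ S).subtype (Submodule.ker_subtype _)
    have hWS : W ≤ landauSpaceOn A Λ S := by
      rw [hW, Submodule.span_le]
      rintro _ ⟨i, rfl⟩
      exact (i : landauSpaceOn A Λ S).2
    have hfr : Module.finrank ℂ W = s.card := by
      rw [hW, finrank_span_eq_card hli, Fintype.card_coe]
    have : FiniteDimensional ℂ W := FiniteDimensional.span_of_finite ℂ (finite_range _)
    have hon : Orthonormal ℂ fun i => ((stdOrthonormalBasis ℂ W i : W) : L2Space d) :=
      (stdOrthonormalBasis ℂ W).orthonormal.comp_linearIsometry W.subtypeₗᵢ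
    have h1 := card_mul_le_of_orthonormal hA hS hon
      (fun i => hWS (stdOrthonormalBasis ℂ W i).2) hr
    rw [hfr, ← hm] at h1
    have h2 : (s.card : ℝ≥0∞) ≤ 4 * M / m := by
      rw [ENNReal.le_div_iff_mul_le (Or.inl hm0) (Or.inl hmt)]
      refine (ENNReal.mul_le_mul_iff_left hm0 hmt).1 ?_
      calc (s.card : ℝ≥0∞) * m * m = s.card * m ^ 2 := by ring
        _ ≤ 4 * (m * volume S) := h1
        _ ≤ 4 * (m * M) := by gcongr
        _ = 4 * M * m := by ring
    exact_mod_cast (h2.trans_lt hN).le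
  have hfin : FiniteDimensional ℂ (landauSpaceOn A Λ S) :=
    Module.rank_lt_aleph0_iff.1 (hrank.trans_lt (Cardinal.natCast_lt_aleph0))
  exact ⟨hfin, Module.finrank_le_of_rank_le hrank⟩

end DimensionBound

/-! ### Unique continuation -/

section UniqueContinuation

variable {d : ℕ} {A : EuclideanSpace ℝ (Fin d) →L[ℝ] EuclideanSpace ℝ (Fin d)} {Λ : ℝ}

/-- The measure of the union of a set and its translate is continuous at zero translation. -/
theorem exists_volume_union_translate_lt {S : Set (EuclideanSpace ℝ (Fin d))}
    (hS : MeasurableSet S) {M : ℝ≥0∞} (hSM : volume S < M) :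
    ∃ δ > 0, ∀ w : EuclideanSpace ℝ (Fin d), ‖w‖ < δ →
      volume (S ∪ (fun z => z - w) ⁻¹' S) < M := by
  have hSt : volume S ≠ ⊤ := (hSM.trans_le le_top).ne
  obtain ⟨ε, hε0, hε⟩ : ∃ ε : ℝ≥0∞, 0 < ε ∧ volume S + (ε + ε + ε) < M := by
    obtain ⟨η, hη0, hη⟩ := ENNReal.lt_iff_exists_add_pos_lt.1 hSM
    refine ⟨η / 3, ENNReal.div_pos (by simpa using hη0.ne') (by norm_num), ?_⟩
    rwa [ENNReal.add_thirds]
  obtain ⟨K, hKS, hK, hKε⟩ := hS.exists_isCompact_sdiff_lt hSt hε0.ne'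
  obtain ⟨U, hKU, hU, hUε⟩ := K.exists_isOpen_lt_of_lt (μ := volume) (volume K + ε)
    (ENNReal.lt_add_right hK.measure_lt_top.ne hε0.ne')
  obtain ⟨δ, hδ0, hδ⟩ := hK.exists_thickening_subset_open hU hKU
  refine ⟨δ, hδ0, fun w hw => ?_⟩
  have hsub : S ∪ (fun z => z - w) ⁻¹' S ⊆ U ∪ (S \ K ∪ (fun z => z - w) ⁻¹' (S \ K)) := by
    rintro z (hz | hz)
    · by_cases hzK : z ∈ K
      · exact Or.inl (hKU hzK)
      · exact Or.inr (Or.inl ⟨hz, hzK⟩)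
    · by_cases hzK : z - w ∈ K
      · refine Or.inl (hδ (Metric.mem_thickening_iff.2 ⟨z - w, hzK, ?_⟩))
        rwa [dist_eq_norm, sub_sub_cancel]
      · exact Or.inr (Or.inr ⟨hz, hzK⟩)
  have htr : volume ((fun z => z - w) ⁻¹' (S \ K)) = volume (S \ K) :=
    (measurePreserving_sub_right volume w).measure_preimage
      (hS.diff hK.measurableSet).nullMeasurableSet
  calc volume (S ∪ (fun z => z - w) ⁻¹' S)
      ≤ volume U + (volume (S \ K) + volume ((fun z => z - w) ⁻¹' (S \ K))) :=
        (measure_mono hsub).trans ((measure_union_le _ _).trans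
          (add_le_add le_rfl (measure_union_le _ _)))
    _ ≤ (volume S + ε) + (ε + ε) := by
        rw [htr]
        exact add_le_add (hUε.le.trans (add_le_add (measure_mono hKS) le_rfl))
          (add_le_add hKε.le hKε.le)
    _ = volume S + (ε + ε + ε) := by ring
    _ < M := hε

/-- No nonzero solution of the eigenvalue equation vanishes outside a set of finite measure. -/
theorem landauSpaceOn_eq_bot (hd : 0 < d) (hA : ∀ z, inner ℝ (A z) z = (0 : ℝ))
    {S : Set (EuclideanSpace ℝ (Fin d))} (hS : MeasurableSet S) (hSt : volume S < ⊤) :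
    landauSpaceOn A Λ S = ⊥ := by
  by_contra hne
  have hne' : Nonempty (Fin d) := ⟨⟨0, hd⟩⟩
  obtain ⟨M, hSM, hMt⟩ := exists_between hSt
  obtain ⟨N, hN⟩ := exists_finrank_landauSpaceOn_le hA Λ hMt.ne
  set T : Set ℕ := {n | ∃ S' : Set (EuclideanSpace ℝ (Fin d)), MeasurableSet S' ∧ volume S' < M ∧
    Module.finrank ℂ (landauSpaceOn A Λ S') = n} with hT
  have hTb : BddAbove T := ⟨N, by
    rintro n ⟨S', hS', hM', rfl⟩
    exact (hN S' hS' hM'.le).2⟩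
  obtain ⟨S₀, hS₀, hS₀M, hS₀n⟩ : sSup T ∈ T := Nat.sSup_mem ⟨_, S, hS, hSM, rfl⟩ hTb
  have hmax : ∀ S' : Set (EuclideanSpace ℝ (Fin d)), MeasurableSet S' → volume S' < M →
      Module.finrank ℂ (landauSpaceOn A Λ S') ≤ Module.finrank ℂ (landauSpaceOn A Λ S₀) :=
    fun S' hS' hM' => by
      rw [hS₀n]
      exact le_csSup hTb ⟨S', hS', hM', rfl⟩
  have hS₀ne : landauSpaceOn A Λ S₀ ≠ ⊥ := fun h0 => by
    have h1 := hmax S hS hSM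
    have := (hN S hS hSM.le).1
    rw [h0, finrank_bot, Nat.le_zero, Submodule.finrank_eq_zero] at h1
    exact hne h1
  obtain ⟨δ, hδ0, hδ⟩ := exists_volume_union_translate_lt hS₀ hS₀M
  -- Maximality of the dimension makes the solution space invariant under small translations.
  have hinv : ∀ w : EuclideanSpace ℝ (Fin d), ‖w‖ < δ → ∀ u ∈ landauSpaceOn A Λ S₀,
      twistLp w (A w) u ∈ landauSpaceOn A Λ S₀ := fun w hw u hu => by
    have hm : MeasurableSet (S₀ ∪ (fun z => z - w) ⁻¹' S₀) :=
      hS₀.union ((measurable_id.sub_const w) hS₀)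
    have := (hN _ hm (hδ w hw).le).1
    rw [Submodule.eq_of_le_of_finrank_le (landauSpaceOn_mono subset_union_left)
      (hmax _ hm (hδ w hw))]
    exact landauSpaceOn_mono subset_union_right (twistLp_mem_landauSpaceOn hA hu w)
  -- By iteration, every solution on `S₀` vanishes off each translate of `S₀`.
  have hiter : ∀ w : EuclideanSpace ℝ (Fin d), ‖w‖ < δ → ∀ n : ℕ, ∀ u ∈ landauSpaceOn A Λ S₀,
      ∀ᵐ z, z + n • w ∉ S₀ → u z = 0 := by
    intro w hw n
    induction n with
    | zero => intro u hu; simpa using hu.2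
    | succ n ih =>
      intro u hu
      have h1 := ih _ (hinv w hw u hu)
      have h2 : ∀ᵐ z, z + n • w ∉ S₀ → u (z - w) = 0 := by
        filter_upwards [h1, coeFn_twistLp w (A w) u] with z h3 h4 h5
        have h6 := h3 h5
        rw [h4, twist] at h6
        exact (mul_eq_zero.1 h6).resolve_left (Complex.exp_ne_zero _)
      have h3 := (measurePreserving_add_right
        (volume : Measure (EuclideanSpace ℝ (Fin d))) w).quasiMeasurePreserving.ae h2
      filter_upwards [h3] with z h4 h5
      rw [add_sub_cancel_right] at h4
      refine h4 ?_
      rwa [add_assoc, ← succ_nsmul']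
  obtain ⟨u, hu, hu0⟩ := Submodule.exists_mem_ne_zero_of_ne_bot hS₀ne
  have hall : ∀ w : EuclideanSpace ℝ (Fin d), ∀ᵐ z, z + w ∉ S₀ → u z = 0 := fun w => by
    obtain ⟨n, hn⟩ := exists_nat_gt (‖w‖ / δ)
    have hn0 : (0 : ℝ) < n := (div_nonneg (norm_nonneg _) hδ0.le).trans_lt hn
    have h1 : ‖(n : ℝ)⁻¹ • w‖ < δ := by
      rw [norm_smul, norm_inv, Real.norm_natCast, inv_mul_lt_iff₀ hn0]
      rwa [div_lt_iff₀ hδ0] at hn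
    have h2 := hiter _ h1 n u hu
    rwa [← Nat.cast_smul_eq_nsmul ℝ, smul_inv_smul₀ hn0.ne'] at h2
  have hum : Measurable u := (Lp.stronglyMeasurable u).measurable
  have hmeas : MeasurableSet {p : EuclideanSpace ℝ (Fin d) × EuclideanSpace ℝ (Fin d) |
      p.2 + p.1 ∉ S₀ → u p.2 = 0} := by
    have h1 : MeasurableSet {p : EuclideanSpace ℝ (Fin d) × EuclideanSpace ℝ (Fin d) |
      p.2 + p.1 ∈ S₀} := (measurable_snd.add measurable_fst) hS₀
    have h2 : MeasurableSet {p : EuclideanSpace ℝ (Fin d) × EuclideanSpace ℝ (Fin d) |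
      u p.2 = 0} := (hum.comp measurable_snd) (measurableSet_singleton 0)
    have : {p : EuclideanSpace ℝ (Fin d) × EuclideanSpace ℝ (Fin d) |
      p.2 + p.1 ∉ S₀ → u p.2 = 0} = {p | p.2 + p.1 ∈ S₀} ∪ {p | u p.2 = 0} := by
      ext p
      simp only [mem_ofPred_eq, mem_union]
      tauto
    rw [this]
    exact h1.union h2
  have hswap := (Measure.ae_ae_comm (μ := (volume : Measure (EuclideanSpace ℝ (Fin d))))
    (ν := (volume : Measure (EuclideanSpace ℝ (Fin d))))
    (p := fun w z => z + w ∉ S₀ → u z = 0) hmeas).1 (Filter.Eventually.of_forall hall)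
  refine hu0 (Lp.ext ?_)
  filter_upwards [hswap, Lp.coeFn_zero ℂ 2 (volume : Measure (EuclideanSpace ℝ (Fin d)))]
    with z hz h0
  rw [h0, Pi.zero_apply]
  by_contra hz0
  -- A point where `u` is nonzero would lie in almost every translate of `S₀`.
  have h1 : ∀ᵐ w, z + w ∈ S₀ := by
    filter_upwards [hz] with w hw
    by_contra h2
    exact hz0 (hw h2)
  have h2 : volume ((fun w => z + w) ⁻¹' S₀) = volume S₀ := measure_preimage_add volume z S₀
  have h3 : volume ((fun w => z + w) ⁻¹' S₀) = ⊤ := by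
    rw [← measure_univ_of_isAddLeftInvariant (volume : Measure (EuclideanSpace ℝ (Fin d)))]
    exact measure_congr (Filter.eventuallyEq_univ.2 h1)
  rw [← h2, h3] at hS₀M
  exact absurd hS₀M not_top_lt

/-! ### Extension by zero -/

variable {Ω : Opens (EuclideanSpace ℝ (Fin d))}

theorem memLp_extendZero (f : L2 Ω) :
    MemLp ((Ω : Set (EuclideanSpace ℝ (Fin d))).indicator f) 2 volume :=
  (memLp_indicator_iff_restrict Ω.isOpen.measurableSet).2 (Lp.memLp f)

/-- Extension by zero, as an isometry from `L₂(Ω)` to `L₂(ℝᵈ)`. -/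
def extendZero (Ω : Opens (EuclideanSpace ℝ (Fin d))) : L2 Ω →ₗᵢ[ℂ] L2Space d where
  toFun f := (memLp_extendZero f).toLp
  map_add' f g := by
    refine Lp.ext ?_
    have h := (ae_restrict_iff' Ω.isOpen.measurableSet).1 (Lp.coeFn_add f g)
    filter_upwards [(memLp_extendZero (f + g)).coeFn_toLp, (memLp_extendZero f).coeFn_toLp,
      (memLp_extendZero g).coeFn_toLp,
      Lp.coeFn_add (memLp_extendZero f).toLp (memLp_extendZero g).toLp, h] with z h1 h2 h3 h4 h5
    rw [h1, h4, Pi.add_apply, h2, h3]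
    by_cases hz : z ∈ (Ω : Set (EuclideanSpace ℝ (Fin d)))
    · simp only [indicator_of_mem hz, h5 hz, Pi.add_apply]
    · simp only [indicator_of_notMem hz, add_zero]
  map_smul' c f := by
    refine Lp.ext ?_
    have h := (ae_restrict_iff' Ω.isOpen.measurableSet).1 (Lp.coeFn_smul c f)
    filter_upwards [(memLp_extendZero (c • f)).coeFn_toLp, (memLp_extendZero f).coeFn_toLp,
      Lp.coeFn_smul c (memLp_extendZero f).toLp, h] with z h1 h2 h4 h5
    rw [h1, RingHom.id_apply, h4, Pi.smul_apply, h2]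
    by_cases hz : z ∈ (Ω : Set (EuclideanSpace ℝ (Fin d)))
    · simp only [indicator_of_mem hz, h5 hz, Pi.smul_apply]
    · simp only [indicator_of_notMem hz, smul_zero]
  norm_map' f := by
    change ‖(memLp_extendZero f).toLp‖ = _
    rw [Lp.norm_toLp, eLpNorm_indicator_eq_eLpNorm_restrict Ω.isOpen.measurableSet, Lp.norm_def]

theorem coeFn_extendZero (f : L2 Ω) :
    extendZero Ω f =ᵐ[volume] (Ω : Set (EuclideanSpace ℝ (Fin d))).indicator f :=
  (memLp_extendZero f).coeFn_toLp

theorem extendZero_ae_eq {f : L2 Ω} {φ : EuclideanSpace ℝ (Fin d) → ℂ}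
    (hf : f =ᵐ[volume.restrict (Ω : Set (EuclideanSpace ℝ (Fin d)))] φ)
    (hφ : ∀ z, z ∉ (Ω : Set (EuclideanSpace ℝ (Fin d))) → φ z = 0) :
    extendZero Ω f =ᵐ[volume] φ := by
  have h := (ae_restrict_iff' Ω.isOpen.measurableSet).1 hf
  filter_upwards [coeFn_extendZero f, h] with z h1 h2
  rw [h1]
  by_cases hz : z ∈ (Ω : Set (EuclideanSpace ℝ (Fin d)))
  · rw [indicator_of_mem hz, h2 hz]
  · rw [indicator_of_notMem hz, hφ z hz]

theorem extendZero_mem_closure {p : magneticH1 Ω A} (hp : p ∈ magneticH10 Ω A) :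
    (extendZero Ω (embedding Ω A p), fun j => extendZero Ω (covariantGradient Ω A p j)) ∈
      (testGraph A).topologicalClosure := by
  have hc : Continuous fun p : magneticH1 Ω A =>
      (extendZero Ω (embedding Ω A p), fun j => extendZero Ω (covariantGradient Ω A p j)) := by
    refine ((extendZero Ω).continuous.comp (embedding Ω A).continuous).prodMk
      (continuous_pi fun j => (extendZero Ω).continuous.comp ?_)
    exact (PiLp.continuous_apply 2 _ j).comp (covariantGradient Ω A).continuous
  refine hc.closure_preimage_subset _ (closure_mono (fun q hq => ?_) hp)
  obtain ⟨φ, hφ⟩ := hq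
  have hz : ∀ z, z ∉ (Ω : Set (EuclideanSpace ℝ (Fin d))) → z ∉ tsupport φ := fun z hz h0 =>
    hz (φ.tsupport_subset h0)
  exact ⟨φ, φ.contDiff, φ.hasCompactSupport,
    extendZero_ae_eq hφ fun z h => image_eq_zero_of_notMem_tsupport (hz z h),
    fun j => extendZero_ae_eq (covariantGradient_ae_eq A.contDiff φ.contDiff φ.hasCompactSupport
      hφ j) fun z h => covDeriv_eq_zero (hz z h) j⟩

theorem inner_extendZero (f : L2 Ω) {g : L2 Ω} {h : L2Space d} {φ : EuclideanSpace ℝ (Fin d) → ℂ}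
    (hg : g =ᵐ[volume.restrict (Ω : Set (EuclideanSpace ℝ (Fin d)))] φ) (hh : h =ᵐ[volume] φ) :
    inner ℂ h (extendZero Ω f) = inner ℂ g f := by
  rw [L2.inner_def, L2.inner_def, ← integral_indicator Ω.isOpen.measurableSet]
  refine integral_congr_ae ?_
  have h' := (ae_restrict_iff' Ω.isOpen.measurableSet).1 hg
  filter_upwards [coeFn_extendZero f, h', hh] with z h1 h2 h3
  rw [h1, h3]
  by_cases hz : z ∈ (Ω : Set (EuclideanSpace ℝ (Fin d)))
  · rw [indicator_of_mem hz, indicator_of_mem hz, h2 hz]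
  · rw [indicator_of_notMem hz, indicator_of_notMem hz, inner_zero_right]

/-- A Dirichlet eigenfunction that is also a Neumann eigenfunction vanishes: extended by zero it
solves the eigenvalue equation on the whole space. -/
theorem eq_zero_of_mem_magneticH10 (hd : 0 < d) (hA : ∀ z, inner ℝ (A z) z = (0 : ℝ))
    (hΩ : volume (Ω : Set (EuclideanSpace ℝ (Fin d))) < ⊤) {p : magneticH1 Ω A}
    (hp : p ∈ magneticH10 Ω A)
    (heq : ∀ w, inner ℂ (covariantGradient Ω A w) (covariantGradient Ω A p) =
      (Λ : ℂ) * inner ℂ (embedding Ω A w) (embedding Ω A p)) : p = 0 := by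
  have hmem : extendZero Ω (embedding Ω A p) ∈
      landauSpaceOn A Λ (Ω : Set (EuclideanSpace ℝ (Fin d))) := by
    refine ⟨⟨_, extendZero_mem_closure hp, fun q hq => ?_⟩, ?_⟩
    · have hcl : IsClosed {q : L2Space d × (Fin d → L2Space d) |
          ∑ j, inner ℂ (q.2 j) (extendZero Ω (covariantGradient Ω A p j)) =
            (Λ : ℂ) * inner ℂ q.1 (extendZero Ω (embedding Ω A p))} :=
        isClosed_eq (by fun_prop) (by fun_prop)
      refine hcl.closure_subset_iff.2 (fun q hq => ?_) hq
      obtain ⟨φ, hφ, hφc, hq0, hq1⟩ := hq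
      obtain ⟨w, hw0, hw1⟩ := exists_magneticH1_of_contDiff (Ω := Ω) (a := A) hφ
        ((memLp_of_contDiff hφ hφc).restrict _) fun j => (memLp_of_contDiff
          (contDiff_covDeriv A.contDiff hφ j) (hasCompactSupport_covDeriv hφc j)).restrict _
      have h1 := heq w
      rw [PiLp.inner_apply] at h1
      change ∑ j, _ = _
      rw [inner_extendZero _ hw0 hq0, ← h1]
      exact Finset.sum_congr rfl fun j _ => inner_extendZero _ (hw1 j) (hq1 j)
    · filter_upwards [coeFn_extendZero (embedding Ω A p)] with z h1 hz
      rw [h1, indicator_of_notMem hz]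
  rw [landauSpaceOn_eq_bot hd hA Ω.isOpen.measurableSet hΩ, Submodule.mem_bot] at hmem
  refine magneticH1_ext ?_
  rw [map_zero]
  exact (extendZero Ω).injective (by rw [hmem, map_zero])

end UniqueContinuation

/-! ### Completeness of the magnetic Sobolev space -/

section Completeness

variable {d : ℕ} {Ω : Opens (EuclideanSpace ℝ (Fin d))}
  {a : EuclideanSpace ℝ (Fin d) → EuclideanSpace ℝ (Fin d)}

/-- The complex conjugate of a test function. -/
def conjTest (φ : 𝓓(Ω, ℂ)) : 𝓓(Ω, ℂ) where
  toFun z := starRingEnd ℂ (φ z)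
  contDiff' := (Complex.conjCLE : ℂ →L[ℝ] ℂ).contDiff.comp φ.contDiff
  hasCompactSupport' := φ.hasCompactSupport.comp_left (g := starRingEnd ℂ) (map_zero _)
  tsupport_subset' :=
    (tsupport_comp_subset (g := starRingEnd ℂ) (map_zero _) φ).trans φ.tsupport_subset

theorem coe_conjTest (φ : 𝓓(Ω, ℂ)) : ⇑(conjTest φ) = fun z => starRingEnd ℂ (φ z) := rfl

theorem fderiv_conjTest (φ : 𝓓(Ω, ℂ)) (z v : EuclideanSpace ℝ (Fin d)) :
    fderiv ℝ (conjTest φ) z v = starRingEnd ℂ (fderiv ℝ φ z v) := by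
  rw [coe_conjTest]
  exact fderiv_conj (φ.contDiff.differentiable (by simp)) z v

/-- The potential is bounded on compact sets, so it preserves local square integrability. -/
theorem MemL2loc.potential_mul (ha : Continuous a) {f : EuclideanSpace ℝ (Fin d) → ℂ}
    (hf : MemL2loc Ω f) (j : Fin d) : MemL2loc Ω fun z => (a z j : ℂ) * f z := by
  intro K hK hKc
  have hc : Continuous fun z => ((a z j : ℝ) : ℂ) := by fun_prop
  obtain ⟨C, hC⟩ := hKc.exists_bound_of_continuousOn hc.continuousOn
  refine (hf K hK hKc).of_le_mul (c := C) (hc.aestronglyMeasurable.mul (hf K hK hKc).1) ?_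
  refine (ae_restrict_iff' hKc.measurableSet).2 (Filter.Eventually.of_forall fun z hz => ?_)
  rw [norm_mul]
  exact mul_le_mul_of_nonneg_right (hC z hz) (norm_nonneg _)

/-- The magnetic Sobolev space in terms of weak covariant derivatives. -/
theorem mem_magneticH1_iff (ha : Continuous a)
    (p : WithLp 2 (L2 Ω × PiLp 2 (fun _ : Fin d => L2 Ω))) :
    p ∈ magneticH1 Ω a ↔ ∀ (j : Fin d) (φ : 𝓓(Ω, ℂ)),
      ∫ z in (Ω : Set (EuclideanSpace ℝ (Fin d))), p.fst z * starRingEnd ℂ (covDeriv a j φ z) =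
        ∫ z in (Ω : Set (EuclideanSpace ℝ (Fin d))), p.snd j z * starRingEnd ℂ (φ z) := by
  have hu := memL2loc_of_Lp p.fst
  have hexp : ∀ (j : Fin d) (φ : 𝓓(Ω, ℂ)),
      ∫ z in (Ω : Set (EuclideanSpace ℝ (Fin d))), p.fst z * starRingEnd ℂ (covDeriv a j φ z) =
        Complex.I * (∫ z in (Ω : Set (EuclideanSpace ℝ (Fin d))),
          p.fst z * fderiv ℝ (conjTest φ) z (EuclideanSpace.single j (1 : ℝ))) -
        ∫ z in (Ω : Set (EuclideanSpace ℝ (Fin d))), ((a z j : ℂ) * p.fst z) * conjTest φ z := by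
    intro j φ
    rw [← integral_const_mul, ← integral_sub ((hu.integrable_mul_fderiv _ _).const_mul _)
      ((hu.potential_mul ha j).integrable_mul_test _)]
    refine integral_congr_ae (Filter.Eventually.of_forall fun z => ?_)
    change p.fst z * starRingEnd ℂ (covDeriv a j φ z) =
      Complex.I * (p.fst z * fderiv ℝ (conjTest φ) z (EuclideanSpace.single j (1 : ℝ))) -
      ((a z j : ℂ) * p.fst z) * conjTest φ z
    rw [fderiv_conjTest, coe_conjTest, covDeriv]
    simp only [map_sub, map_mul, map_neg, Complex.conj_I, Complex.conj_ofReal]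
    ring
  constructor
  · rintro ⟨g, hg, hpg⟩ j φ
    rw [hexp, hg.integral_eq]
    have h1 : ∫ z in (Ω : Set (EuclideanSpace ℝ (Fin d))), p.snd j z * starRingEnd ℂ (φ z) =
        ∫ z in (Ω : Set (EuclideanSpace ℝ (Fin d))),
          (-Complex.I * (g j z * conjTest φ z) - ((a z j : ℂ) * p.fst z) * conjTest φ z) := by
      refine integral_congr_ae ?_
      filter_upwards [hpg j] with z hz
      rw [hz, coe_conjTest]
      ring
    rw [h1, integral_sub (((hg.grad_memL2loc j).integrable_mul_test _).const_mul _)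
      ((hu.potential_mul ha j).integrable_mul_test _), integral_const_mul]
    ring
  · intro h
    have hg : ∀ j, MemL2loc Ω fun z => Complex.I * (p.snd j z + (a z j : ℂ) * p.fst z) :=
      fun j K hK hKc => ((memL2loc_of_Lp (p.snd j) K hK hKc).add
        (hu.potential_mul ha j K hK hKc)).const_mul _
    refine ⟨fun j z => Complex.I * (p.snd j z + (a z j : ℂ) * p.fst z), ⟨hu, hg, fun j φ => ?_⟩,
      fun j => Filter.Eventually.of_forall fun z => ?_⟩
    · have h1 := h j (conjTest φ)
      have h2 : conjTest (conjTest φ) = φ := by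
        ext z
        exact Complex.conj_conj _
      rw [hexp, h2] at h1
      have h3 : ∫ z in (Ω : Set (EuclideanSpace ℝ (Fin d))),
          Complex.I * (p.snd j z + (a z j : ℂ) * p.fst z) * φ z =
          Complex.I * ((∫ z in (Ω : Set (EuclideanSpace ℝ (Fin d))), p.snd j z * φ z) +
            ∫ z in (Ω : Set (EuclideanSpace ℝ (Fin d))), ((a z j : ℂ) * p.fst z) * φ z) := by
        rw [← integral_add ((memL2loc_of_Lp (p.snd j)).integrable_mul_test φ)
          ((hu.potential_mul ha j).integrable_mul_test φ), ← integral_const_mul]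
        refine integral_congr_ae (Filter.Eventually.of_forall fun z => ?_)
        change _ = Complex.I * (p.snd j z * φ z + ((a z j : ℂ) * p.fst z) * φ z)
        ring
      have h4 : ∀ z, starRingEnd ℂ (conjTest φ z) = φ z := fun z => Complex.conj_conj _
      simp only [h4] at h1
      rw [h3, ← h1]
      linear_combination (∫ z in (Ω : Set (EuclideanSpace ℝ (Fin d))),
          p.fst z * fderiv ℝ φ z (EuclideanSpace.single j (1 : ℝ))) * Complex.I_mul_I
    · change p.snd j z = -Complex.I * (Complex.I * (p.snd j z + (a z j : ℂ) * p.fst z)) -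
        (a z j : ℂ) * p.fst z
      linear_combination (p.snd j z + (a z j : ℂ) * p.fst z) * Complex.I_mul_I

theorem isClosed_magneticH1 (ha : ContDiff ℝ ∞ a) :
    IsClosed (magneticH1 Ω a : Set (WithLp 2 (L2 Ω × PiLp 2 (fun _ : Fin d => L2 Ω)))) := by
  have h1 : (magneticH1 Ω a : Set (WithLp 2 (L2 Ω × PiLp 2 (fun _ : Fin d => L2 Ω)))) =
      ⋂ (j : Fin d) (φ : 𝓓(Ω, ℂ)),
        {p | ∫ z in (Ω : Set (EuclideanSpace ℝ (Fin d))),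
            p.fst z * starRingEnd ℂ (covDeriv a j φ z) =
          ∫ z in (Ω : Set (EuclideanSpace ℝ (Fin d))), p.snd j z * starRingEnd ℂ (φ z)} := by
    ext p
    simp only [mem_iInter]
    exact mem_magneticH1_iff ha.continuous p
  rw [h1]
  refine isClosed_iInter fun j => isClosed_iInter fun φ => ?_
  have hφ := (memLp_of_contDiff φ.contDiff φ.hasCompactSupport).restrict
    (Ω : Set (EuclideanSpace ℝ (Fin d)))
  have hP := (memLp_of_contDiff (contDiff_covDeriv ha φ.contDiff j)
    (hasCompactSupport_covDeriv φ.hasCompactSupport j)).restrict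
      (Ω : Set (EuclideanSpace ℝ (Fin d)))
  have e1 : ∀ f : L2 Ω, ∫ z in (Ω : Set (EuclideanSpace ℝ (Fin d))),
      f z * starRingEnd ℂ (covDeriv a j φ z) = inner ℂ hP.toLp f := fun f => by
    rw [L2.inner_def]
    refine integral_congr_ae ?_
    filter_upwards [hP.coeFn_toLp] with z hz
    rw [hz, RCLike.inner_apply]
  have e2 : ∀ f : L2 Ω, ∫ z in (Ω : Set (EuclideanSpace ℝ (Fin d))),
      f z * starRingEnd ℂ (φ z) = inner ℂ hφ.toLp f := fun f => by
    rw [L2.inner_def]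
    refine integral_congr_ae ?_
    filter_upwards [hφ.coeFn_toLp] with z hz
    rw [hz, RCLike.inner_apply]
  simp only [e1, e2]
  have c1 : Continuous fun p : WithLp 2 (L2 Ω × PiLp 2 (fun _ : Fin d => L2 Ω)) => p.fst :=
    (WithLp.fstL 2 ℂ (L2 Ω) (PiLp 2 (fun _ : Fin d => L2 Ω))).continuous
  have c2 : Continuous fun p : WithLp 2 (L2 Ω × PiLp 2 (fun _ : Fin d => L2 Ω)) => p.snd j :=
    (PiLp.continuous_apply 2 _ j).comp
      (WithLp.sndL 2 ℂ (L2 Ω) (PiLp 2 (fun _ : Fin d => L2 Ω))).continuous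
  exact isClosed_eq (continuous_const.inner c1) (continuous_const.inner c2)

theorem completeSpace_of_isClosed (ha : ContDiff ℝ ∞ a) {Q : Submodule ℂ (magneticH1 Ω a)}
    (hQ : IsClosed (Q : Set (magneticH1 Ω a))) : CompleteSpace Q := by
  have : CompleteSpace (magneticH1 Ω a) := (isClosed_magneticH1 ha).completeSpace_coe
  exact hQ.completeSpace_coe

end Completeness

/-! ### Comparison of the Dirichlet and Neumann problems -/

section Comparison

variable {d : ℕ} {Ω : Opens (EuclideanSpace ℝ (Fin d))}
  {A : EuclideanSpace ℝ (Fin d) →L[ℝ] EuclideanSpace ℝ (Fin d)} {Λ : ℝ}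

theorem weakSpan_mono {a : EuclideanSpace ℝ (Fin d) → EuclideanSpace ℝ (Fin d)}
    {Q : Submodule ℂ (magneticH1 Ω a)} {S T : Set ℝ} (h : S ⊆ T) : weakSpan Q S ≤ weakSpan Q T :=
  formSpan_mono h

theorem norm_sq_le_of_mem_weakSpan {a : EuclideanSpace ℝ (Fin d) → EuclideanSpace ℝ (Fin d)}
    {Q : Submodule ℂ (magneticH1 Ω a)} {p : Q} (hp : p ∈ weakSpan Q (Iic Λ)) :
    ‖covariantGradient Ω a p‖ ^ 2 ≤ Λ * ‖embedding Ω a p‖ ^ 2 := by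
  have h1 := norm_sq_le_of_mem_formSpan_Iic (V := Q) (H := L2 Ω)
    (G := PiLp 2 fun _ : Fin d => L2 Ω) (e := formEmbedding Q) (D := formGradient Q) hp
  exact h1

theorem finiteDimensional_weakSpan {a : EuclideanSpace ℝ (Fin d) → EuclideanSpace ℝ (Fin d)}
    (ha : ContDiff ℝ ∞ a) (hc : IsCompactOperator (embedding Ω a))
    {Q : Submodule ℂ (magneticH1 Ω a)} (hQ : IsClosed (Q : Set (magneticH1 Ω a)))
    {S : Set ℝ} (hS : S ⊆ Iic Λ) : FiniteDimensional ℂ (weakSpan Q S) := by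
  have := completeSpace_of_isClosed ha hQ
  have h1 : FiniteDimensional ℂ (weakSpan Q (Iic Λ)) :=
    (isFormPair Q).finiteDimensional_formSpan (isCompactOperator_formEmbedding hc Q) Λ
  exact Submodule.finiteDimensional_of_le (weakSpan_mono hS)

/-- The comparison of Dirichlet and Neumann eigenvalues at `Λ`, given a smooth solution `U` of the
eigenvalue equation whose energy on `Ω` is less than `Λ ‖U‖²`. -/
theorem finrank_dirichlet_lt_finrank_neumann (hd : 0 < d)
    (hA : ∀ z, inner ℝ (A z) z = (0 : ℝ))
    (hΩ : volume (Ω : Set (EuclideanSpace ℝ (Fin d))) < ⊤)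
    (hc : IsCompactOperator (embedding Ω A)) {U : EuclideanSpace ℝ (Fin d) → ℂ}
    (hU : ContDiff ℝ ∞ U) (heq : ∀ z, ∑ j, covDeriv A j (covDeriv A j U) z = Λ * U z)
    (h0 : MemLp U 2 (volume.restrict (Ω : Set (EuclideanSpace ℝ (Fin d)))))
    (h1 : ∀ j, MemLp (covDeriv A j U) 2
      (volume.restrict (Ω : Set (EuclideanSpace ℝ (Fin d)))))
    (hneg : ∫ z in (Ω : Set (EuclideanSpace ℝ (Fin d))),
      ((∑ j, ‖covDeriv A j U z‖ ^ 2) - Λ * ‖U z‖ ^ 2) < 0) :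
    Module.finrank ℂ (weakSpan (magneticH10 Ω A) (Iic Λ)) + 1 ≤
      Module.finrank ℂ (weakSpan (⊤ : Submodule ℂ (magneticH1 Ω A)) (Iio Λ)) := by
  have hcl : IsClosed (magneticH10 Ω A : Set (magneticH1 Ω A)) :=
    Submodule.isClosed_topologicalClosure _
  have hclT : IsClosed ((⊤ : Submodule ℂ (magneticH1 Ω A)) : Set (magneticH1 Ω A)) := isClosed_univ
  have hcompl : CompleteSpace (⊤ : Submodule ℂ (magneticH1 Ω A)) :=
    completeSpace_of_isClosed A.contDiff hclT
  have hfin : FiniteDimensional ℂ (weakSpan (magneticH10 Ω A) (Iic Λ)) :=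
    finiteDimensional_weakSpan A.contDiff hc hcl Subset.rfl
  obtain ⟨u, hu0, hu1⟩ := exists_magneticH1_of_contDiff hU h0 h1
  set inc : magneticH10 Ω A →ₗ[ℂ] (⊤ : Submodule ℂ (magneticH1 Ω A)) :=
    Submodule.inclusion le_top with hinc
  have hinj : Function.Injective inc := Submodule.inclusion_injective _
  have hsq : ∀ (f : L2 Ω) (φ : EuclideanSpace ℝ (Fin d) → ℂ),
      f =ᵐ[volume.restrict (Ω : Set (EuclideanSpace ℝ (Fin d)))] φ →
      ‖f‖ ^ 2 = ∫ z in (Ω : Set (EuclideanSpace ℝ (Fin d))), ‖φ z‖ ^ 2 := fun f φ hf => by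
    have h2 := inner_self_eq_norm_sq_to_K (𝕜 := ℂ) f
    rw [L2.inner_def] at h2
    refine Complex.ofReal_injective ?_
    rw [← integral_complex_ofReal, Complex.ofReal_pow]
    refine h2.symm.trans (integral_congr_ae ?_)
    filter_upwards [hf] with z hz
    rw [hz, inner_self_eq_norm_sq_to_K]
    push_cast
    rfl
  have hUneg : ‖covariantGradient Ω A u‖ ^ 2 < Λ * ‖embedding Ω A u‖ ^ 2 := by
    rw [PiLp.norm_sq_eq_of_L2, hsq _ _ hu0, Finset.sum_congr rfl fun j _ => hsq _ _ (hu1 j)]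
    rw [integral_sub, integral_finsetSum, integral_const_mul] at hneg
    · linarith
    · exact fun j _ => (h1 j).integrable_norm_pow (by norm_num)
    · exact integrable_finsetSum _ fun j _ => (h1 j).integrable_norm_pow (by norm_num)
    · exact (h0.integrable_norm_pow (by norm_num)).const_mul _
  have := (isFormPair (⊤ : Submodule ℂ (magneticH1 Ω A))).finrank_lt_finrank_formSpan
    (isCompactOperator_formEmbedding hc _) (Λ := Λ)
    (Q := LinearMap.range inc) (W := (weakSpan (magneticH10 Ω A) (Iic Λ)).map inc)
    (LinearMap.map_le_range) ?_ (U := ⟨u, Submodule.mem_top⟩) hUneg ?_ ?_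
  · rw [← (Submodule.equivMapOfInjective inc hinj _).finrank_eq] at this
    exact this
  · rintro _ ⟨p, hp, rfl⟩
    exact (norm_sq_le_of_mem_weakSpan (Q := magneticH10 Ω A) (p := p) hp :)
  · rintro _ ⟨p, rfl⟩
    exact inner_covariantGradient_eq A.contDiff hU heq hu0 hu1 p.2
  · rintro _ ⟨p, rfl⟩ hp
    have h3 : (p : magneticH1 Ω A) = 0 := eq_zero_of_mem_magneticH10 hd hA hΩ p.2
      fun w => hp ⟨w, Submodule.mem_top⟩
    have h4 : p = 0 := Subtype.ext h3
    rw [h4, map_zero]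

end Comparison

/-! ### Averages of the Laplacian of a Gaussian-type function -/

section Gaussian

open Polynomial

/-- The radial function `p(s) e^{-cs}` of `s = ‖z‖²` on the plane. -/
def polyGauss (p : ℝ[X]) (c : ℝ) (z : EuclideanSpace ℝ (Fin 2)) : ℝ :=
  p.eval (‖z‖ ^ 2) * Real.exp (-c * ‖z‖ ^ 2)

theorem exists_polynomial_mul_exp_le (p : ℝ[X]) {c : ℝ} (hc : 0 < c) :
    ∃ C, ∀ s, 0 ≤ s → |p.eval s| * Real.exp (-c * s) ≤ C := by
  induction p using Polynomial.induction_on' with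
  | add p q hp hq =>
    obtain ⟨C, hC⟩ := hp
    obtain ⟨D, hD⟩ := hq
    refine ⟨C + D, fun s hs => ?_⟩
    rw [eval_add]
    calc |p.eval s + q.eval s| * Real.exp (-c * s)
        ≤ (|p.eval s| + |q.eval s|) * Real.exp (-c * s) := by
          gcongr
          exact abs_add_le _ _
      _ ≤ C + D := by rw [add_mul]; exact add_le_add (hC s hs) (hD s hs)
  | monomial n b =>
    refine ⟨|b| * (n.factorial / c ^ n), fun s hs => ?_⟩
    rw [eval_monomial, abs_mul, abs_of_nonneg (pow_nonneg hs n), mul_assoc]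
    refine mul_le_mul_of_nonneg_left ?_ (abs_nonneg b)
    have h := Real.pow_div_factorial_le_exp (c * s) (by positivity) n
    rw [div_le_iff₀ (by positivity), mul_pow] at h
    rw [neg_mul, Real.exp_neg, ← div_eq_mul_inv, div_le_div_iff₀ (Real.exp_pos _) (by positivity)]
    linarith

theorem continuous_polyGauss (p : ℝ[X]) (c : ℝ) : Continuous (polyGauss p c) := by
  unfold polyGauss
  exact (p.continuous.comp (by fun_prop)).mul (by fun_prop)

theorem integrable_polyGauss (p : ℝ[X]) {c : ℝ} (hc : 0 < c) : Integrable (polyGauss p c) := by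
  obtain ⟨C, hC⟩ := exists_polynomial_mul_exp_le p (half_pos hc)
  have h1 : Integrable fun z : EuclideanSpace ℝ (Fin 2) =>
      C * Real.exp (-(c / 2) * ‖z‖ ^ 2) := by
    have h2 := (GaussianFourier.integrable_cexp_neg_mul_sq_norm_add (V := EuclideanSpace ℝ (Fin 2))
      (b := ((c / 2 : ℝ) : ℂ)) (by simpa using hc) 0 0).norm
    refine (Integrable.const_mul ?_ C)
    refine h2.congr (Filter.Eventually.of_forall fun z => ?_)
    simp only [zero_mul, add_zero]
    rw [Complex.norm_exp]
    norm_cast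
  refine h1.mono' (continuous_polyGauss p c).aestronglyMeasurable
    (Filter.Eventually.of_forall fun z => ?_)
  have h3 := hC (‖z‖ ^ 2) (sq_nonneg _)
  rw [polyGauss, Real.norm_eq_abs, abs_mul, Real.abs_exp,
    show -c * ‖z‖ ^ 2 = -(c / 2) * ‖z‖ ^ 2 + -(c / 2) * ‖z‖ ^ 2 by ring, Real.exp_add, ← mul_assoc]
  exact mul_le_mul_of_nonneg_right h3 (Real.exp_pos _).le

theorem hasFDerivAt_polyGauss (p : ℝ[X]) (c : ℝ) (z : EuclideanSpace ℝ (Fin 2)) :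
    HasFDerivAt (polyGauss p c)
      ((2 * polyGauss (derivative p - C c * p) c z) • innerSL ℝ z) z := by
  have h1 : HasDerivAt (fun s : ℝ => p.eval s * Real.exp (-c * s))
      ((derivative p - C c * p).eval (‖z‖ ^ 2) * Real.exp (-c * ‖z‖ ^ 2)) (‖z‖ ^ 2) := by
    have h2 : HasDerivAt (fun s : ℝ => Real.exp (-c * s)) (Real.exp (-c * ‖z‖ ^ 2) * -c)
        (‖z‖ ^ 2) := by
      simpa using ((hasDerivAt_id (‖z‖ ^ 2)).const_mul (-c)).exp
    refine ((p.hasDerivAt _).mul h2).congr_deriv ?_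
    rw [eval_sub, eval_mul, eval_C]
    ring
  have h3 := h1.comp_hasFDerivAt z (hasStrictFDerivAt_norm_sq z).hasFDerivAt
  refine h3.congr_fderiv ?_
  rw [polyGauss]
  ext v
  simp
  ring

theorem hasFDerivAt_coord_mul_polyGauss (p : ℝ[X]) (c : ℝ) (j : Fin 2)
    (z : EuclideanSpace ℝ (Fin 2)) :
    HasFDerivAt (fun z : EuclideanSpace ℝ (Fin 2) => z j * polyGauss p c z)
      (z j • ((2 * polyGauss (derivative p - C c * p) c z) • innerSL ℝ z) +
        polyGauss p c z • EuclideanSpace.proj j) z :=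
  ((EuclideanSpace.proj j : EuclideanSpace ℝ (Fin 2) →L[ℝ] ℝ).hasFDerivAt).mul
    (hasFDerivAt_polyGauss p c z)

theorem coord_sq_le (j : Fin 2) (z : EuclideanSpace ℝ (Fin 2)) : z j ^ 2 ≤ ‖z‖ ^ 2 := by
  rw [← sq_abs (z j), ← Real.norm_eq_abs]
  exact pow_le_pow_left₀ (norm_nonneg _) (PiLp.norm_apply_le z j) 2

theorem integrable_coord_mul_polyGauss (p : ℝ[X]) {c : ℝ} (hc : 0 < c) (j : Fin 2) :
    Integrable fun z : EuclideanSpace ℝ (Fin 2) => z j * polyGauss p c z := by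
  refine ((integrable_polyGauss p hc).norm.add (integrable_polyGauss (X * p) hc).norm).mono'
    ((EuclideanSpace.proj j).continuous.mul (continuous_polyGauss p c)).aestronglyMeasurable
    (Filter.Eventually.of_forall fun z => ?_)
  have h1 := coord_sq_le j z
  have h2 : |z j| ≤ 1 + ‖z‖ ^ 2 := by
    nlinarith [sq_nonneg (|z j| - 1), sq_abs (z j), abs_nonneg (z j)]
  rw [norm_mul, Pi.add_apply, polyGauss, polyGauss, eval_mul, eval_X, norm_mul, norm_mul, norm_mul,
    Real.norm_of_nonneg (sq_nonneg ‖z‖), Real.norm_eq_abs (z j)]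
  nlinarith [mul_le_mul_of_nonneg_right h2
    (mul_nonneg (norm_nonneg (p.eval (‖z‖ ^ 2))) (norm_nonneg (Real.exp (-c * ‖z‖ ^ 2))))]

theorem integrable_coord_sq_mul_polyGauss (p : ℝ[X]) {c : ℝ} (hc : 0 < c) (j : Fin 2) :
    Integrable fun z : EuclideanSpace ℝ (Fin 2) => z j ^ 2 * polyGauss p c z := by
  refine (integrable_polyGauss (X * p) hc).norm.mono'
    (((EuclideanSpace.proj j).continuous.pow 2).mul
      (continuous_polyGauss p c)).aestronglyMeasurable
    (Filter.Eventually.of_forall fun z => ?_)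
  have h1 := coord_sq_le j z
  rw [norm_mul, polyGauss, polyGauss, eval_mul, eval_X, norm_mul, norm_mul, norm_mul,
    Real.norm_of_nonneg (sq_nonneg ‖z‖), Real.norm_of_nonneg (sq_nonneg (z j))]
  nlinarith [mul_le_mul_of_nonneg_right h1
    (mul_nonneg (norm_nonneg (p.eval (‖z‖ ^ 2))) (norm_nonneg (Real.exp (-c * ‖z‖ ^ 2))))]

/-- Integration by parts against a bounded function with bounded derivative. -/
theorem integral_fderiv_mul_of_bounded {f ψ : EuclideanSpace ℝ (Fin 2) → ℝ}
    {v : EuclideanSpace ℝ (Fin 2)} (hf : Differentiable ℝ f) (hψ : ContDiff ℝ 1 ψ)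
    (hfi : Integrable f) (hfi' : Integrable fun z => fderiv ℝ f z v) {K : ℝ}
    (hψK : ∀ z, ‖ψ z‖ ≤ K) (hψK' : ∀ z, ‖fderiv ℝ ψ z v‖ ≤ K) :
    ∫ z, fderiv ℝ f z v * ψ z = -∫ z, f z * fderiv ℝ ψ z v := by
  have hψc : Continuous fun z => fderiv ℝ ψ z v :=
    (hψ.continuous_fderiv one_ne_zero).clm_apply continuous_const
  rw [integral_mul_fderiv_eq_neg_fderiv_mul_of_integrable, neg_neg]
  · exact hfi'.mul_bdd (c := K) hψ.continuous.aestronglyMeasurable (Filter.Eventually.of_forall hψK)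
  · exact hfi.mul_bdd (c := K) hψc.aestronglyMeasurable (Filter.Eventually.of_forall hψK')
  · exact hfi.mul_bdd (c := K) hψ.continuous.aestronglyMeasurable (Filter.Eventually.of_forall hψK)
  · exact fun z _ => hf z
  · exact fun z _ => hψ.differentiable one_ne_zero z

/-- The polynomial `P` for which half of the Laplacian on the plane of `p(s) e^{-cs}`, where
`s = ‖z‖²`, equals `P(s) e^{-cs}`. -/
def halfLaplacian (p : ℝ[X]) (c : ℝ) : ℝ[X] :=
  let q := derivative p - C c * p
  2 * (q + X * (derivative q - C c * q))

/-- Half of a Laplacian against a plane wave with frequency `ε`, by two integrations by parts. -/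
theorem integral_halfLaplacian_mul_cos (p : ℝ[X]) {c : ℝ} (hc : 0 < c) (ε y : ℝ) :
    ∫ z, polyGauss (halfLaplacian p c) c z * Real.cos (ε * (y - z 0)) =
      -(ε ^ 2 / 2) * ∫ z, polyGauss p c z * Real.cos (ε * (y - z 0)) := by
  set q := derivative p - C c * p with hq
  set r := derivative q - C c * q with hr
  set e : Fin 2 → EuclideanSpace ℝ (Fin 2) := fun j => EuclideanSpace.single j (1 : ℝ) with he
  have hz : ∀ j (z : EuclideanSpace ℝ (Fin 2)), inner ℝ z (e j) = z j := fun j z => by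
    rw [he, EuclideanSpace.inner_single_right]
    simp
  have hL : ∀ z : EuclideanSpace ℝ (Fin 2),
      HasFDerivAt (fun z : EuclideanSpace ℝ (Fin 2) => ε * (y - z 0))
        (ε • -(EuclideanSpace.proj 0 : EuclideanSpace ℝ (Fin 2) →L[ℝ] ℝ)) z := fun z =>
    (((EuclideanSpace.proj 0 : EuclideanSpace ℝ (Fin 2) →L[ℝ] ℝ).hasFDerivAt).const_sub y).const_mul
      ε
  have hLs : ContDiff ℝ 1 fun z : EuclideanSpace ℝ (Fin 2) => ε * (y - z 0) :=
    contDiff_const.mul (contDiff_const.sub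
      (EuclideanSpace.proj 0 : EuclideanSpace ℝ (Fin 2) →L[ℝ] ℝ).contDiff)
  have hcosd : ∀ j z, fderiv ℝ (fun z : EuclideanSpace ℝ (Fin 2) => Real.cos (ε * (y - z 0))) z
      (e j) = ε * Real.sin (ε * (y - z 0)) * e j 0 := fun j z => by
    rw [(hL z).cos.fderiv]
    simp
    ring
  have hsind : ∀ j z, fderiv ℝ (fun z : EuclideanSpace ℝ (Fin 2) => Real.sin (ε * (y - z 0))) z
      (e j) = -ε * Real.cos (ε * (y - z 0)) * e j 0 := fun j z => by
    rw [(hL z).sin.fderiv]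
    simp
    ring
  have he0 : e 0 0 = 1 := by simp [he]
  have he1 : e 1 0 = 0 := by simp [he]
  have hpd : ∀ z, fderiv ℝ (polyGauss p c) z (e 0) = 2 * (z 0 * polyGauss q c z) := fun z => by
    rw [(hasFDerivAt_polyGauss p c z).fderiv]
    change (2 * polyGauss q c z) * inner ℝ z (e 0) = _
    rw [hz]
    ring
  have hqd : ∀ j z, fderiv ℝ (fun z : EuclideanSpace ℝ (Fin 2) => z j * polyGauss q c z) z (e j) =
      2 * (z j ^ 2 * polyGauss r c z) + polyGauss q c z := fun j z => by
    rw [(hasFDerivAt_coord_mul_polyGauss q c j z).fderiv]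
    change z j * ((2 * polyGauss r c z) * inner ℝ z (e j)) + polyGauss q c z * e j j = _
    rw [hz, show e j j = 1 by simp [he]]
    ring
  have hR : ∀ z, polyGauss (halfLaplacian p c) c z =
      fderiv ℝ (fun z : EuclideanSpace ℝ (Fin 2) => z 0 * polyGauss q c z) z (e 0) +
        fderiv ℝ (fun z : EuclideanSpace ℝ (Fin 2) => z 1 * polyGauss q c z) z (e 1) := fun z => by
    have h1 : ‖z‖ ^ 2 = z 0 ^ 2 + z 1 ^ 2 := by
      rw [EuclideanSpace.real_norm_sq_eq, Fin.sum_univ_two]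
    rw [hqd, hqd, polyGauss, halfLaplacian]
    simp only [eval_mul, eval_add, eval_X, ← hq, ← hr]
    rw [polyGauss, polyGauss, show eval (‖z‖ ^ 2) (2 : ℝ[X]) = 2 from eval_ofNat _ _]
    nth_rewrite 2 [h1]
    ring
  have hi : ∀ j, Integrable fun z : EuclideanSpace ℝ (Fin 2) => z j * polyGauss q c z :=
    integrable_coord_mul_polyGauss q hc
  have hi' : ∀ j, Integrable fun z => fderiv ℝ (fun z : EuclideanSpace ℝ (Fin 2) =>
      z j * polyGauss q c z) z (e j) := fun j => by
    simp only [hqd]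
    exact ((integrable_coord_sq_mul_polyGauss r hc j).const_mul 2).add (integrable_polyGauss q hc)
  have hcosb : ∀ z : EuclideanSpace ℝ (Fin 2), ‖Real.cos (ε * (y - z 0))‖ ≤ 1 + |ε| := fun z => by
    rw [Real.norm_eq_abs]
    linarith [Real.abs_cos_le_one (ε * (y - z 0)), abs_nonneg ε]
  have hsinb : ∀ z : EuclideanSpace ℝ (Fin 2), ‖Real.sin (ε * (y - z 0))‖ ≤ 1 + |ε| := fun z => by
    rw [Real.norm_eq_abs]
    linarith [Real.abs_sin_le_one (ε * (y - z 0)), abs_nonneg ε]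
  have heb : ∀ j, |e j 0| ≤ 1 := fun j => by fin_cases j <;> simp [he]
  have hcosb' : ∀ j z, ‖fderiv ℝ (fun z : EuclideanSpace ℝ (Fin 2) =>
      Real.cos (ε * (y - z 0))) z (e j)‖ ≤ 1 + |ε| := fun j z => by
    rw [hcosd, Real.norm_eq_abs, abs_mul, abs_mul]
    have h1 := mul_le_mul (mul_le_mul_of_nonneg_left (Real.abs_sin_le_one (ε * (y - z 0)))
      (abs_nonneg ε)) (heb j) (abs_nonneg _) (by positivity)
    linarith
  have hsinb' : ∀ j z, ‖fderiv ℝ (fun z : EuclideanSpace ℝ (Fin 2) =>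
      Real.sin (ε * (y - z 0))) z (e j)‖ ≤ 1 + |ε| := fun j z => by
    rw [hsind, Real.norm_eq_abs, abs_mul, abs_mul, abs_neg]
    have h1 := mul_le_mul (mul_le_mul_of_nonneg_left (Real.abs_cos_le_one (ε * (y - z 0)))
      (abs_nonneg ε)) (heb j) (abs_nonneg _) (by positivity)
    linarith
  have s1 : ∀ j, ∫ z, fderiv ℝ (fun z : EuclideanSpace ℝ (Fin 2) =>
      z j * polyGauss q c z) z (e j) * Real.cos (ε * (y - z 0)) =
      -∫ z, (z j * polyGauss q c z) * (ε * Real.sin (ε * (y - z 0)) * e j 0) := fun j => by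
    rw [integral_fderiv_mul_of_bounded
      (fun z => (hasFDerivAt_coord_mul_polyGauss q c j z).differentiableAt) hLs.cos (hi j) (hi' j)
      hcosb (hcosb' j)]
    simp only [hcosd]
  have s2 : ∫ z, 2 * (z 0 * polyGauss q c z) * Real.sin (ε * (y - z 0)) =
      -∫ z, polyGauss p c z * (-ε * Real.cos (ε * (y - z 0)) * e 0 0) := by
    have h1 := integral_fderiv_mul_of_bounded (v := e 0)
      (fun z => (hasFDerivAt_polyGauss p c z).differentiableAt) hLs.sin (integrable_polyGauss p hc)
      (by simp only [hpd]; exact (hi 0).const_mul 2) hsinb (hsinb' 0)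
    simp only [hpd, hsind] at h1
    exact h1
  have hib : ∀ j, Integrable fun z => fderiv ℝ (fun z : EuclideanSpace ℝ (Fin 2) =>
      z j * polyGauss q c z) z (e j) * Real.cos (ε * (y - z 0)) := fun j =>
    (hi' j).mul_bdd hLs.cos.continuous.aestronglyMeasurable
      (Filter.Eventually.of_forall hcosb)
  simp only [hR, add_mul]
  rw [integral_add (hib 0) (hib 1), s1, s1, he0, he1]
  simp only [mul_zero, integral_zero, neg_zero, add_zero, mul_one]
  rw [he0] at s2
  have e1 : ∀ z : EuclideanSpace ℝ (Fin 2), (z 0 * polyGauss q c z) * (ε * Real.sin (ε * (y - z 0)))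
      = (ε / 2) * (2 * (z 0 * polyGauss q c z) * Real.sin (ε * (y - z 0))) := fun z => by ring
  have e2 : ∀ z : EuclideanSpace ℝ (Fin 2), polyGauss p c z * (-ε * Real.cos (ε * (y - z 0)) * 1)
      = -ε * (polyGauss p c z * Real.cos (ε * (y - z 0))) := fun z => by ring
  simp only [e1, e2] at s2 ⊢
  rw [integral_const_mul, s2, integral_const_mul]
  ring

/-- For a finite nonzero measure `μ` and `F(z) = p(‖z‖²) e^{-c‖z‖²}` with positive integral, the
function `w ↦ ∫ ½ΔF(z - w) dμ(z)` is negative somewhere. -/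
theorem exists_integral_halfLaplacian_neg {p : ℝ[X]} {c : ℝ} (hc : 0 < c)
    (hp : 0 < ∫ z, polyGauss p c z) (μ : Measure (EuclideanSpace ℝ (Fin 2))) [IsFiniteMeasure μ]
    (hμ : μ ≠ 0) : ∃ w, ∫ z, polyGauss (halfLaplacian p c) c (z - w) ∂μ < 0 := by
  set g := polyGauss (halfLaplacian p c) c with hg
  have hgc : Continuous g := continuous_polyGauss _ _
  have hgi : Integrable g := integrable_polyGauss _ hc
  by_contra hcon
  push Not at hcon
  -- The integral of the function over `w` against the nonnegative weight `1 + cos(ε w₀)` is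
  -- `-½ε²` times `∫∫ F(u) cos(ε (z₀ - u₀)) du dμ(z)`, which is positive for small `ε`.
  have hlim : Filter.Tendsto (fun ε : ℝ => ∫ x, polyGauss p c x.2 * Real.cos (ε * (x.1 0 - x.2 0))
      ∂(μ.prod volume)) (nhds 0) (nhds (∫ x : EuclideanSpace ℝ (Fin 2) × EuclideanSpace ℝ (Fin 2),
        polyGauss p c x.2 ∂(μ.prod volume))) := by
    refine tendsto_integral_filter_of_dominated_convergence (fun x => ‖polyGauss p c x.2‖)
      ?_ ?_ ?_ ?_
    · refine Filter.Eventually.of_forall fun ε => Continuous.aestronglyMeasurable ?_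
      exact ((continuous_polyGauss p c).comp continuous_snd).mul (by fun_prop)
    · refine Filter.Eventually.of_forall fun ε => Filter.Eventually.of_forall fun x => ?_
      rw [norm_mul]
      exact mul_le_of_le_one_right (norm_nonneg _) (Real.abs_cos_le_one _)
    · exact ((integrable_polyGauss p hc).norm).comp_snd μ
    · refine Filter.Eventually.of_forall fun x => ?_
      have : Continuous fun ε : ℝ => polyGauss p c x.2 * Real.cos (ε * (x.1 0 - x.2 0)) := by
        fun_prop
      simpa using this.tendsto 0
  have hpos : 0 < ∫ x : EuclideanSpace ℝ (Fin 2) × EuclideanSpace ℝ (Fin 2),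
        polyGauss p c x.2 ∂(μ.prod volume) := by
    have h1 := integral_prod_mul (μ := μ) (ν := volume)
      (fun _ : EuclideanSpace ℝ (Fin 2) => (1 : ℝ)) (polyGauss p c)
    simp only [one_mul] at h1
    rw [h1]
    refine mul_pos ?_ hp
    have : NeZero μ := ⟨hμ⟩
    simp
  obtain ⟨ε, hε, hε0⟩ : ∃ ε : ℝ, 0 < (∫ x, polyGauss p c x.2 * Real.cos (ε * (x.1 0 - x.2 0))
      ∂(μ.prod volume)) ∧ 0 < ε := by
    have h1 := (hlim.eventually (lt_mem_nhds hpos)).filter_mono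
      (nhdsWithin_le_nhds (s := Ioi (0 : ℝ)))
    exact (h1.and self_mem_nhdsWithin).exists
  set ψ : EuclideanSpace ℝ (Fin 2) → ℝ := fun w => 1 + Real.cos (ε * w 0) with hψ
  have hψc : Continuous ψ := by fun_prop
  have hψ0 : ∀ w, 0 ≤ ψ w := fun w => by
    have := Real.neg_one_le_cos (ε * w 0)
    change 0 ≤ 1 + Real.cos (ε * w 0)
    linarith
  have hint : Integrable (fun x : EuclideanSpace ℝ (Fin 2) × EuclideanSpace ℝ (Fin 2) =>
      g (x.1 - x.2) * ψ x.2) (μ.prod volume) := by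
    have h1 : Integrable (fun x : EuclideanSpace ℝ (Fin 2) × EuclideanSpace ℝ (Fin 2) =>
        g (x.1 - x.2)) (μ.prod volume) := by
      have hm : AEStronglyMeasurable (fun x : EuclideanSpace ℝ (Fin 2) × EuclideanSpace ℝ (Fin 2) =>
          g (x.1 - x.2)) (μ.prod volume) :=
        (hgc.comp (continuous_fst.sub continuous_snd)).aestronglyMeasurable
      rw [integrable_prod_iff hm]
      refine ⟨Filter.Eventually.of_forall fun z => hgi.comp_sub_left z, ?_⟩
      have : ∀ z : EuclideanSpace ℝ (Fin 2), ∫ w, ‖g (z - w)‖ = ∫ w, ‖g w‖ := fun z =>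
        integral_sub_left_eq_self (fun w => ‖g w‖) volume z
      simp only [this]
      exact integrable_const _
    refine h1.mul_bdd (c := 2) (hψc.comp continuous_snd).aestronglyMeasurable
      (Filter.Eventually.of_forall fun x => ?_)
    rw [Real.norm_of_nonneg (hψ0 _)]
    have := Real.cos_le_one (ε * x.2 0)
    change 1 + Real.cos (ε * x.2 0) ≤ 2
    linarith
  have h1 : 0 ≤ ∫ x, g (x.1 - x.2) * ψ x.2 ∂(μ.prod volume) := by
    rw [integral_prod_symm _ hint]
    refine integral_nonneg fun w => ?_
    change 0 ≤ ∫ z, g (z - w) * ψ w ∂μ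
    rw [integral_mul_const]
    exact mul_nonneg (hcon w) (hψ0 w)
  have hinner : ∀ z : EuclideanSpace ℝ (Fin 2), ∫ w, g (z - w) * ψ w =
      -(ε ^ 2 / 2) * ∫ u, polyGauss p c u * Real.cos (ε * (z 0 - u 0)) := fun z => by
    have e1 : ∫ w, g (z - w) * ψ w = ∫ u, g u * (1 + Real.cos (ε * (z 0 - u 0))) := by
      rw [← integral_sub_left_eq_self (fun u => g u * (1 + Real.cos (ε * (z 0 - u 0)))) volume z]
      refine integral_congr_ae (Filter.Eventually.of_forall fun w => ?_)
      simp [hψ]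
    have e0 := integral_halfLaplacian_mul_cos p hc 0 0
    simp only [zero_mul, Real.cos_zero, mul_one] at e0
    rw [e1, ← integral_halfLaplacian_mul_cos p hc]
    simp only [mul_add, mul_one]
    rw [integral_add hgi, hg, e0]
    · simp
    · refine hgi.mul_bdd (c := 1) (Continuous.aestronglyMeasurable (by fun_prop))
        (Filter.Eventually.of_forall fun u => Real.abs_cos_le_one _)
  have h2 : ∫ x, g (x.1 - x.2) * ψ x.2 ∂(μ.prod volume) =
      -(ε ^ 2 / 2) * ∫ x, polyGauss p c x.2 * Real.cos (ε * (x.1 0 - x.2 0)) ∂(μ.prod volume) := by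
    rw [integral_prod _ hint, integral_prod]
    · simp only [hinner]
      rw [integral_const_mul]
    · refine (((integrable_polyGauss p hc)).comp_snd μ).mul_bdd (c := 1)
        (Continuous.aestronglyMeasurable (f := fun x : EuclideanSpace ℝ (Fin 2) ×
          EuclideanSpace ℝ (Fin 2) => Real.cos (ε * (x.1 0 - x.2 0))) (by fun_prop))
        (Filter.Eventually.of_forall fun u => Real.abs_cos_le_one _)
  rw [h2] at h1
  have : 0 < ε ^ 2 := by positivity
  nlinarith

theorem integral_polyGauss_pow_pos (m : ℕ) {c : ℝ} (hc : 0 < c) :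
    0 < ∫ z, polyGauss (X ^ m) c z := by
  have hnn : ∀ z, 0 ≤ polyGauss (X ^ m) c z := fun z => by
    rw [polyGauss, eval_pow, eval_X]
    positivity
  have hcont := continuous_polyGauss (X ^ m) c
  rw [integral_pos_iff_support_of_nonneg hnn (integrable_polyGauss _ hc)]
  refine hcont.isOpen_support.measure_pos volume ⟨EuclideanSpace.single 0 1, ?_⟩
  rw [Function.mem_support, polyGauss]
  simp

theorem eval_halfLaplacian_pow (m : ℕ) (c s : ℝ) :
    (halfLaplacian (X ^ m) c).eval s =
      2 * m ^ 2 * s ^ (m - 1) + 2 * c ^ 2 * s ^ (m + 1) - 2 * c * (2 * m + 1) * s ^ m := by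
  rcases m with _ | _ | n
  · simp [halfLaplacian]
    ring
  · simp [halfLaplacian]
    ring
  · simp [halfLaplacian]
    ring

end Gaussian

/-! ### Landau states -/

section Trial

variable {n : ℕ}

/-- The projection onto the plane of the first two coordinates. -/
def planeProj : EuclideanSpace ℝ (Fin (n + 2)) →L[ℝ] EuclideanSpace ℝ (Fin 2) :=
  (EuclideanSpace.proj 0).smulRight (EuclideanSpace.single 0 1) +
    (EuclideanSpace.proj 1).smulRight (EuclideanSpace.single 1 1)

/-- The vector potential `(B / 2) (-z₁, z₀, 0, …, 0)` as a linear map. -/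
def linearPotential (B : ℝ) : EuclideanSpace ℝ (Fin (n + 2)) →L[ℝ] EuclideanSpace ℝ (Fin (n + 2)) :=
  (B / 2) • ((EuclideanSpace.proj 0).smulRight (EuclideanSpace.single 1 1) -
    (EuclideanSpace.proj 1).smulRight (EuclideanSpace.single 0 1))

/-- The complex coordinate `z₀ - i z₁` on the plane of the first two coordinates. -/
def planeCoord : EuclideanSpace ℝ (Fin (n + 2)) →L[ℝ] ℂ :=
  Complex.ofRealCLM ∘L EuclideanSpace.proj 0 -
    Complex.I • (Complex.ofRealCLM ∘L EuclideanSpace.proj 1)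

theorem planeCoord_apply (z : EuclideanSpace ℝ (Fin (n + 2))) :
    planeCoord z = z 0 - Complex.I * z 1 := rfl

theorem planeProj_apply_zero (z : EuclideanSpace ℝ (Fin (n + 2))) : planeProj z 0 = z 0 := by
  simp [planeProj]

theorem planeProj_apply_one (z : EuclideanSpace ℝ (Fin (n + 2))) : planeProj z 1 = z 1 := by
  simp [planeProj]

theorem norm_planeProj_sq (z : EuclideanSpace ℝ (Fin (n + 2))) :
    ‖planeProj z‖ ^ 2 = z 0 ^ 2 + z 1 ^ 2 := by
  rw [EuclideanSpace.real_norm_sq_eq, Fin.sum_univ_two, planeProj_apply_zero, planeProj_apply_one]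

theorem norm_planeCoord_sq (z : EuclideanSpace ℝ (Fin (n + 2))) :
    ‖planeCoord z‖ ^ 2 = ‖planeProj z‖ ^ 2 := by
  rw [norm_planeProj_sq, planeCoord_apply, ← Complex.normSq_eq_norm_sq, Complex.normSq_apply]
  simp
  ring

theorem exists_planeProj_eq (w : EuclideanSpace ℝ (Fin 2)) :
    ∃ z : EuclideanSpace ℝ (Fin (n + 2)), planeProj z = w := by
  refine ⟨EuclideanSpace.single 0 (w 0) + EuclideanSpace.single 1 (w 1), ?_⟩
  ext j
  fin_cases j <;> simp [planeProj]

theorem linearPotential_apply_zero (B : ℝ) (z : EuclideanSpace ℝ (Fin (n + 2))) :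
    linearPotential B z 0 = -(B / 2 * z 1) := by
  simp [linearPotential]

theorem linearPotential_apply_one (B : ℝ) (z : EuclideanSpace ℝ (Fin (n + 2))) :
    linearPotential B z 1 = B / 2 * z 0 := by
  simp [linearPotential]

theorem linearPotential_apply_succ_succ (B : ℝ) (z : EuclideanSpace ℝ (Fin (n + 2))) (j : Fin n) :
    linearPotential B z j.succ.succ = 0 := by
  have h : j.succ.succ ≠ 1 := fun h => Fin.succ_ne_zero j (Fin.succ_injective _ h)
  simp [linearPotential, h]

theorem inner_linearPotential_self (B : ℝ) (z : EuclideanSpace ℝ (Fin (n + 2))) :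
    inner ℝ (linearPotential B z) z = 0 := by
  simp [linearPotential, inner_smul_left, inner_sub_left, EuclideanSpace.inner_single_left]
  right
  ring

theorem covDeriv_linear_comb {d : ℕ} {a : EuclideanSpace ℝ (Fin d) → EuclideanSpace ℝ (Fin d)}
    {f g : EuclideanSpace ℝ (Fin d) → ℂ} (hf : Differentiable ℝ f) (hg : Differentiable ℝ g)
    (α β : ℂ) (j : Fin d) :
    covDeriv a j (fun z => α * f z + β * g z) =
      fun z => α * covDeriv a j f z + β * covDeriv a j g z := by
  ext z
  have h := (((hf z).hasFDerivAt.const_mul α).add ((hg z).hasFDerivAt.const_mul β)).fderiv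
  simp only [covDeriv]
  erw [h]
  simp
  ring

/-- The state `ζ^m e^{-B|ζ|²/4} e^{i⟨b, z⟩}`, where `ζ = z₀ - i z₁`, in the `m`-th Landau level of
the plane of the first two coordinates. The momentum `b` is meant to be orthogonal to that plane. -/
def landauState (B : ℝ) (b : EuclideanSpace ℝ (Fin (n + 2))) (m : ℕ)
    (z : EuclideanSpace ℝ (Fin (n + 2))) : ℂ :=
  planeCoord z ^ m * Complex.exp (-(B / 4 : ℝ) * (planeCoord z * starRingEnd ℂ (planeCoord z)) +
    Complex.I * (inner ℝ b z : ℝ))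

theorem fderiv_landauState (B : ℝ) (b : EuclideanSpace ℝ (Fin (n + 2))) (m : ℕ)
    (z v : EuclideanSpace ℝ (Fin (n + 2))) : fderiv ℝ (landauState B b m) z v =
      m * planeCoord v * landauState B b (m - 1) z +
      (-(B / 4 : ℝ) * (planeCoord v * starRingEnd ℂ (planeCoord z) +
        planeCoord z * starRingEnd ℂ (planeCoord v)) + Complex.I * (inner ℝ b v : ℝ)) *
          landauState B b m z := by
  have h1 : HasFDerivAt (planeCoord (n := n)) planeCoord z := planeCoord.hasFDerivAt
  have h2 : HasFDerivAt (fun z : EuclideanSpace ℝ (Fin (n + 2)) => starRingEnd ℂ (planeCoord z))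
    ((Complex.conjCLE : ℂ →L[ℝ] ℂ) ∘L planeCoord) z :=
    ((Complex.conjCLE : ℂ →L[ℝ] ℂ) ∘L planeCoord).hasFDerivAt
  have h3 : HasFDerivAt (fun z : EuclideanSpace ℝ (Fin (n + 2)) => ((inner ℝ b z : ℝ) : ℂ))
    (Complex.ofRealCLM ∘L innerSL ℝ b) z := (Complex.ofRealCLM ∘L innerSL ℝ b).hasFDerivAt
  have h4 := (h1.pow m).mul (((h1.mul h2).const_mul (-(B / 4 : ℝ) : ℂ)).add
    (h3.const_mul Complex.I)).cexp
  have h5 := h4.fderiv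
  unfold landauState
  erw [h5]
  simp
  ring

theorem contDiff_landauState (B : ℝ) (b : EuclideanSpace ℝ (Fin (n + 2))) (m : ℕ) :
    ContDiff ℝ ∞ (landauState B b m) := by
  have h1 : ContDiff ℝ ∞ (planeCoord (n := n)) := planeCoord.contDiff
  have h2 : ContDiff ℝ ∞ (fun z : EuclideanSpace ℝ (Fin (n + 2)) =>
    starRingEnd ℂ (planeCoord z)) := ((Complex.conjCLE : ℂ →L[ℝ] ℂ) ∘L planeCoord).contDiff
  have h3 : ContDiff ℝ ∞ (fun z : EuclideanSpace ℝ (Fin (n + 2)) => ((inner ℝ b z : ℝ) : ℂ)) :=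
    (Complex.ofRealCLM ∘L innerSL ℝ b).contDiff
  exact (h1.pow m).mul ((contDiff_const.mul (h1.mul h2)).add (contDiff_const.mul h3)).cexp

theorem landauState_succ (B : ℝ) (b : EuclideanSpace ℝ (Fin (n + 2))) (m : ℕ)
    (z : EuclideanSpace ℝ (Fin (n + 2))) :
    landauState B b (m + 1) z = planeCoord z * landauState B b m z := by
  rw [landauState, landauState, pow_succ]
  ring

theorem covDeriv_zero_landauState (B : ℝ) {b : EuclideanSpace ℝ (Fin (n + 2))} (hb : b 0 = 0)
    (m : ℕ) : covDeriv (linearPotential B) 0 (landauState B b m) =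
      fun z => -Complex.I * m * landauState B b (m - 1) z +
        Complex.I * (B / 2) * landauState B b (m + 1) z := by
  ext z
  rw [covDeriv, fderiv_landauState, linearPotential_apply_zero, landauState_succ,
    EuclideanSpace.inner_single_right, hb]
  simp [planeCoord_apply]
  ring_nf
  simp
  ring

theorem covDeriv_one_landauState (B : ℝ) {b : EuclideanSpace ℝ (Fin (n + 2))} (hb : b 1 = 0)
    (m : ℕ) : covDeriv (linearPotential B) 1 (landauState B b m) =
      fun z => -m * landauState B b (m - 1) z + -(B / 2) * landauState B b (m + 1) z := by
  ext z
  rw [covDeriv, fderiv_landauState, linearPotential_apply_one, landauState_succ,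
    EuclideanSpace.inner_single_right, hb]
  simp [planeCoord_apply]
  ring_nf
  simp
  ring

theorem covDeriv_succ_succ_landauState (B : ℝ) (b : EuclideanSpace ℝ (Fin (n + 2)))
    (m : ℕ) (j : Fin n) : covDeriv (linearPotential B) j.succ.succ (landauState B b m) =
      fun z => b j.succ.succ * landauState B b m z := by
  ext z
  have h : j.succ.succ ≠ 1 := fun h => Fin.succ_ne_zero j (Fin.succ_injective _ h)
  rw [covDeriv, fderiv_landauState, linearPotential_apply_succ_succ,
    EuclideanSpace.inner_single_right]
  simp [planeCoord_apply, h]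
  ring_nf
  simp

/-- The Landau states are generalized eigenfunctions: the covariant derivatives in the plane act as
ladder operators. -/
theorem sum_covDeriv_covDeriv_landauState (B : ℝ) {b : EuclideanSpace ℝ (Fin (n + 2))}
    (hb0 : b 0 = 0) (hb1 : b 1 = 0) (m : ℕ) (z : EuclideanSpace ℝ (Fin (n + 2))) :
    ∑ j, covDeriv (linearPotential B) j (covDeriv (linearPotential B) j (landauState B b m)) z =
      ((B * (2 * m + 1) + ‖b‖ ^ 2 : ℝ) : ℂ) * landauState B b m z := by
  have hd : ∀ m, Differentiable ℝ (landauState B b m) := fun m =>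
    (contDiff_landauState B b m).differentiable (by simp)
  have hs : ∀ j : Fin n, covDeriv (linearPotential B) j.succ.succ
      (covDeriv (linearPotential B) j.succ.succ (landauState B b m)) z =
      ((b j.succ.succ ^ 2 : ℝ) : ℂ) * landauState B b m z := fun j => by
    have h := covDeriv_linear_comb (a := linearPotential B) (hd m) (hd m) (b j.succ.succ) 0
      j.succ.succ
    simp only [zero_mul, add_zero] at h
    rw [covDeriv_succ_succ_landauState, h, covDeriv_succ_succ_landauState]
    push_cast
    ring
  rw [Fin.sum_univ_succ, Fin.sum_univ_succ]
  simp only [hs]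
  rw [← Finset.sum_mul, covDeriv_zero_landauState B hb0, covDeriv_linear_comb (hd _) (hd _),
    covDeriv_zero_landauState B hb0, covDeriv_zero_landauState B hb0, Fin.succ_zero_eq_one,
    covDeriv_one_landauState B hb1, covDeriv_linear_comb (hd _) (hd _),
    covDeriv_one_landauState B hb1, covDeriv_one_landauState B hb1,
    EuclideanSpace.real_norm_sq_eq, Fin.sum_univ_succ, Fin.sum_univ_succ, Fin.succ_zero_eq_one,
    hb0, hb1]
  rcases m with _ | m
  · simp
    ring_nf
    simp
    ring
  · simp
    ring_nf
    simp
    ring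

theorem norm_landauState_sq (B : ℝ) (b : EuclideanSpace ℝ (Fin (n + 2))) (m : ℕ)
    (z : EuclideanSpace ℝ (Fin (n + 2))) :
    ‖landauState B b m z‖ ^ 2 = polyGauss (Polynomial.X ^ m) (B / 2) (planeProj z) := by
  rw [landauState, norm_mul, norm_pow, mul_pow, ← pow_mul, mul_comm m 2, pow_mul,
    norm_planeCoord_sq, polyGauss, Polynomial.eval_pow, Polynomial.eval_X, Complex.norm_exp,
    Complex.mul_conj, Complex.normSq_eq_norm_sq, norm_planeCoord_sq, ← Real.exp_nat_mul]
  congr 2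
  simp [-Complex.ofReal_pow]
  ring

/-- The energy density of a Landau state, minus the eigenvalue times its density, is half of the
planar Laplacian of the density. -/
theorem sum_norm_covDeriv_landauState_sq (B : ℝ) {b : EuclideanSpace ℝ (Fin (n + 2))}
    (hb0 : b 0 = 0) (hb1 : b 1 = 0) (m : ℕ) (z : EuclideanSpace ℝ (Fin (n + 2))) :
    (∑ j, ‖covDeriv (linearPotential B) j (landauState B b m) z‖ ^ 2) -
        (B * (2 * m + 1) + ‖b‖ ^ 2) * ‖landauState B b m z‖ ^ 2 =
      polyGauss (halfLaplacian (Polynomial.X ^ m) (B / 2)) (B / 2) (planeProj z) := by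
  have hs : ∀ j : Fin n, ‖covDeriv (linearPotential B) j.succ.succ (landauState B b m) z‖ ^ 2 =
      b j.succ.succ ^ 2 * ‖landauState B b m z‖ ^ 2 := fun j => by
    rw [covDeriv_succ_succ_landauState, norm_mul, mul_pow, Complex.norm_real, Real.norm_eq_abs,
      sq_abs]
  have e0 : covDeriv (linearPotential B) 0 (landauState B b m) z = Complex.I *
      ((B / 2) * landauState B b (m + 1) z - m * landauState B b (m - 1) z) := by
    rw [covDeriv_zero_landauState B hb0]
    ring
  have e1 : covDeriv (linearPotential B) 1 (landauState B b m) z = -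
      ((B / 2) * landauState B b (m + 1) z + m * landauState B b (m - 1) z) := by
    rw [covDeriv_one_landauState B hb1]
    ring
  have hp := parallelogram_law_with_norm ℝ ((B / 2) * landauState B b (m + 1) z)
    (m * landauState B b (m - 1) z)
  rw [norm_mul, norm_mul] at hp
  have hn : ‖((m : ℕ) : ℂ)‖ = m := by simp
  have hB2 : ‖(B / 2 : ℂ)‖ ^ 2 = (B / 2) ^ 2 := by
    rw [show (B / 2 : ℂ) = ((B / 2 : ℝ) : ℂ) by push_cast; rfl, Complex.norm_real,
      Real.norm_eq_abs, sq_abs]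
  rw [hn] at hp
  have hpp : ‖(B / 2) * landauState B b (m + 1) z + m * landauState B b (m - 1) z‖ ^ 2 +
      ‖(B / 2) * landauState B b (m + 1) z - m * landauState B b (m - 1) z‖ ^ 2 =
      2 * ((B / 2) ^ 2 * ‖landauState B b (m + 1) z‖ ^ 2 +
        m ^ 2 * ‖landauState B b (m - 1) z‖ ^ 2) := by
    rw [← hB2]
    linarith
  rw [Fin.sum_univ_succ, Fin.sum_univ_succ, Fin.succ_zero_eq_one, e0, e1]
  simp only [hs]
  rw [← Finset.sum_mul, norm_mul, Complex.norm_I, one_mul, norm_neg,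
    EuclideanSpace.real_norm_sq_eq, Fin.sum_univ_succ, Fin.sum_univ_succ, Fin.succ_zero_eq_one,
    hb0, hb1, polyGauss, eval_halfLaplacian_pow]
  have hl : ∀ k, ‖landauState B b k z‖ ^ 2 =
      (‖planeProj z‖ ^ 2) ^ k * Real.exp (-(B / 2) * ‖planeProj z‖ ^ 2) := fun k => by
    rw [norm_landauState_sq, polyGauss, Polynomial.eval_pow, Polynomial.eval_X]
  simp only [hl] at hpp ⊢
  linear_combination hpp

/-- Landau states are bounded. -/
theorem exists_norm_landauState_le {B : ℝ} (hB : 0 < B) (b : EuclideanSpace ℝ (Fin (n + 2)))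
    (m : ℕ) : ∃ C, ∀ z, ‖landauState B b m z‖ ≤ C := by
  obtain ⟨C, hC⟩ := exists_polynomial_mul_exp_le (Polynomial.X ^ m) (half_pos hB)
  refine ⟨C + 1, fun z => ?_⟩
  have h1 := hC _ (sq_nonneg ‖planeProj z‖)
  rw [Polynomial.eval_pow, Polynomial.eval_X, abs_of_nonneg (by positivity)] at h1
  have h2 := norm_landauState_sq B b m z
  rw [polyGauss, Polynomial.eval_pow, Polynomial.eval_X] at h2
  nlinarith [sq_nonneg (‖landauState B b m z‖ - 1), norm_nonneg (landauState B b m z)]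

theorem exists_norm_covDeriv_landauState_le {B : ℝ} (hB : 0 < B)
    {b : EuclideanSpace ℝ (Fin (n + 2))} (hb0 : b 0 = 0) (hb1 : b 1 = 0) (m : ℕ)
    (j : Fin (n + 2)) :
    ∃ C, ∀ z, ‖covDeriv (linearPotential B) j (landauState B b m) z‖ ≤ C := by
  obtain ⟨C, hC⟩ := exists_norm_landauState_le hB b m
  obtain ⟨C1, hC1⟩ := exists_norm_landauState_le hB b (m - 1)
  obtain ⟨C2, hC2⟩ := exists_norm_landauState_le hB b (m + 1)
  refine Fin.cases ?_ (fun j => Fin.cases ?_ (fun j => ?_) j) j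
  · refine ⟨‖-Complex.I * m‖ * C1 + ‖Complex.I * (B / 2)‖ * C2, fun z => ?_⟩
    rw [covDeriv_zero_landauState B hb0]
    refine (norm_add_le _ _).trans ?_
    rw [norm_mul _ (landauState B b (m - 1) z), norm_mul _ (landauState B b (m + 1) z)]
    gcongr
    exacts [hC1 z, hC2 z]
  · refine ⟨‖(-m : ℂ)‖ * C1 + ‖(-(B / 2) : ℂ)‖ * C2, fun z => ?_⟩
    rw [Fin.succ_zero_eq_one, covDeriv_one_landauState B hb1]
    refine (norm_add_le _ _).trans ?_
    rw [norm_mul _ (landauState B b (m - 1) z), norm_mul _ (landauState B b (m + 1) z)]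
    gcongr
    exacts [hC1 z, hC2 z]
  · refine ⟨‖(b j.succ.succ : ℂ)‖ * C, fun z => ?_⟩
    rw [covDeriv_succ_succ_landauState, norm_mul]
    gcongr
    exact hC z

theorem exists_setIntegral_halfLaplacian_planeProj_neg {c : ℝ} (hc : 0 < c)
    {Ω : Opens (EuclideanSpace ℝ (Fin (n + 2)))}
    (hne : (Ω : Set (EuclideanSpace ℝ (Fin (n + 2)))).Nonempty)
    (hΩ : volume (Ω : Set (EuclideanSpace ℝ (Fin (n + 2)))) < ⊤) (m : ℕ) :
    ∃ w, ∫ z in (Ω : Set (EuclideanSpace ℝ (Fin (n + 2)))),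
      polyGauss (halfLaplacian (Polynomial.X ^ m) c) c (planeProj (z - w)) < 0 := by
  have hfin : IsFiniteMeasure (volume.restrict (Ω : Set (EuclideanSpace ℝ (Fin (n + 2))))) :=
    ⟨by simpa using hΩ⟩
  have hp : AEMeasurable (planeProj (n := n))
      (volume.restrict (Ω : Set (EuclideanSpace ℝ (Fin (n + 2))))) :=
    planeProj.continuous.measurable.aemeasurable
  have hμ0 : (volume.restrict (Ω : Set (EuclideanSpace ℝ (Fin (n + 2))))).map planeProj ≠ 0 := by
    rw [Ne, Measure.map_eq_zero_iff hp, Measure.restrict_eq_zero]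
    exact (Ω.isOpen.measure_pos volume hne).ne'
  obtain ⟨w', hw'⟩ := exists_integral_halfLaplacian_neg hc (integral_polyGauss_pow_pos m hc) _ hμ0
  obtain ⟨w, rfl⟩ := exists_planeProj_eq (n := n) w'
  have hg : Continuous fun z => polyGauss (halfLaplacian (Polynomial.X ^ m) c) c
      (z - planeProj w) := (continuous_polyGauss _ _).comp (continuous_id.sub continuous_const)
  rw [integral_map hp hg.aestronglyMeasurable] at hw'
  refine ⟨w, ?_⟩
  simpa only [map_sub] using hw'

/-- The strict comparison of the counting functions at `Λ = B (2 m + 1) + κ²`, where `κ = |b|` is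
the momentum across the plane. -/
theorem finrank_dirichlet_lt_finrank_neumann_of_landauState {B : ℝ} (hB : 0 < B)
    {Ω : Opens (EuclideanSpace ℝ (Fin (n + 2)))}
    (hne : (Ω : Set (EuclideanSpace ℝ (Fin (n + 2)))).Nonempty)
    (hΩ : volume (Ω : Set (EuclideanSpace ℝ (Fin (n + 2)))) < ⊤)
    (hc : IsCompactOperator (embedding Ω (linearPotential B)))
    {b : EuclideanSpace ℝ (Fin (n + 2))} (hb0 : b 0 = 0) (hb1 : b 1 = 0) (m : ℕ) {Λ : ℝ}
    (hΛ : B * (2 * m + 1) + ‖b‖ ^ 2 = Λ) :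
    Module.finrank ℂ (weakSpan (magneticH10 Ω (linearPotential B)) (Iic Λ)) + 1 ≤
      Module.finrank ℂ (weakSpan (⊤ : Submodule ℂ (magneticH1 Ω (linearPotential B)))
        (Iio Λ)) := by
  subst hΛ
  have hfin : IsFiniteMeasure (volume.restrict (Ω : Set (EuclideanSpace ℝ (Fin (n + 2))))) :=
    ⟨by simpa using hΩ⟩
  have hd : ∀ m, Differentiable ℝ (landauState B b m) := fun m =>
    (contDiff_landauState B b m).differentiable (by simp)
  have hP : ∀ j, ContDiff ℝ ∞ (covDeriv (linearPotential B) j (landauState B b m)) := fun j =>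
    contDiff_covDeriv (linearPotential B).contDiff (contDiff_landauState B b m) j
  obtain ⟨w, hw⟩ := exists_setIntegral_halfLaplacian_planeProj_neg (half_pos hB) hne hΩ m
  have hcov : ∀ j, covDeriv (linearPotential B) j (twist w (linearPotential B w)
      (landauState B b m)) = twist w (linearPotential B w)
        (covDeriv (linearPotential B) j (landauState B b m)) := fun j =>
    covDeriv_twist _ (hd m) j
  refine finrank_dirichlet_lt_finrank_neumann (by omega) (inner_linearPotential_self B) hΩ hc
    (U := twist w (linearPotential B w) (landauState B b m))
    (contDiff_twist (contDiff_landauState B b m)) ?_ ?_ ?_ ?_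
  · intro z
    have h := sum_covDeriv_covDeriv_landauState B hb0 hb1 m (z - w)
    have : ∀ j, covDeriv (linearPotential B) j (covDeriv (linearPotential B) j
        (twist w (linearPotential B w) (landauState B b m))) z =
        Complex.exp (Complex.I * (inner ℝ (linearPotential B w) z : ℝ)) *
        covDeriv (linearPotential B) j (covDeriv (linearPotential B) j
          (landauState B b m)) (z - w) := fun j => by
      rw [hcov, covDeriv_twist _ ((hP j).differentiable (by simp)), twist]
    simp only [this]
    rw [← Finset.mul_sum, h, twist]
    ring
  · obtain ⟨C, hC⟩ := exists_norm_landauState_le hB b m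
    refine MemLp.of_bound
      (contDiff_twist (contDiff_landauState B b m)).continuous.aestronglyMeasurable C
      (Filter.Eventually.of_forall fun z => ?_)
    rw [norm_twist]
    exact hC _
  · intro j
    obtain ⟨C, hC⟩ := exists_norm_covDeriv_landauState_le hB hb0 hb1 m j
    rw [hcov]
    refine MemLp.of_bound (contDiff_twist (hP j)).continuous.aestronglyMeasurable C
      (Filter.Eventually.of_forall fun z => ?_)
    rw [norm_twist]
    exact hC _
  · refine lt_of_eq_of_lt (integral_congr_ae (Filter.Eventually.of_forall fun z => ?_)) hw
    simp only [hcov, norm_twist]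
    rw [sum_norm_covDeriv_landauState_sq B hb0 hb1]

end Trial

/-! ### The lower bound for the Dirichlet energy -/

section LowerBound

variable {n : ℕ}

theorem fderiv_fderiv_comm {E : Type*} [NormedAddCommGroup E] [NormedSpace ℝ E] {φ : E → ℂ}
    (hφ : ContDiff ℝ ∞ φ) (z v w : E) :
    fderiv ℝ (fun z => fderiv ℝ φ z v) z w = fderiv ℝ (fun z => fderiv ℝ φ z w) z v := by
  have hd : DifferentiableAt ℝ (fderiv ℝ φ) z :=
    ((hφ.fderiv_right (m := 1) (by norm_cast)).differentiable one_ne_zero) z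
  have h : ∀ v w, fderiv ℝ (fun z => fderiv ℝ φ z v) z w = fderiv ℝ (fderiv ℝ φ) z w v :=
    fun v w => by
      rw [fderiv_clm_apply hd (differentiableAt_const v)]
      simp
  rw [h, h]
  exact (hφ.contDiffAt.isSymmSndFDerivAt (by
    rw [minSmoothness_of_isRCLikeNormedField]
    exact WithTop.coe_le_coe.2 (le_top : (2 : ℕ∞) ≤ ⊤))) w v

/-- The commutator of the covariant derivatives in the plane of the magnetic field. -/
theorem covDeriv_commutator (B : ℝ) {φ : EuclideanSpace ℝ (Fin (n + 2)) → ℂ}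
    (hφ : ContDiff ℝ ∞ φ) (z : EuclideanSpace ℝ (Fin (n + 2))) :
    covDeriv (linearPotential B) 0 (covDeriv (linearPotential B) 1 φ) z -
      covDeriv (linearPotential B) 1 (covDeriv (linearPotential B) 0 φ) z =
        Complex.I * B * φ z := by
  have hφd : Differentiable ℝ φ := hφ.differentiable (by simp)
  have hd : ∀ v, Differentiable ℝ fun z => fderiv ℝ φ z v := fun v =>
    ((hφ.fderiv_right (m := 1) (by norm_cast)).clm_apply contDiff_const).differentiable one_ne_zero
  have hA : ∀ j z, HasFDerivAt (fun z : EuclideanSpace ℝ (Fin (n + 2)) =>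
      ((linearPotential B z j : ℝ) : ℂ)) (Complex.ofRealCLM ∘L EuclideanSpace.proj j ∘L
        linearPotential B) z := fun j z =>
    (Complex.ofRealCLM ∘L EuclideanSpace.proj j ∘L linearPotential B).hasFDerivAt
  have h : ∀ j v, fderiv ℝ (covDeriv (linearPotential B) j φ) z v =
      -Complex.I * fderiv ℝ (fun z => fderiv ℝ φ z (EuclideanSpace.single j (1 : ℝ))) z v -
        ((linearPotential B z j : ℝ) * fderiv ℝ φ z v + φ z * (linearPotential B v j : ℝ)) :=
    fun j v => by
      have h1 := (((hd (EuclideanSpace.single j (1 : ℝ))) z).hasFDerivAt.const_mul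
        (-Complex.I)).sub ((hA j z).mul (hφd z).hasFDerivAt)
      have h2 := h1.fderiv
      unfold covDeriv
      erw [h2]
      simp
  rw [covDeriv, h, covDeriv, covDeriv, h,
    fderiv_fderiv_comm hφ z _ (EuclideanSpace.single 0 (1 : ℝ)),
    covDeriv, linearPotential_apply_one, linearPotential_apply_one,
    linearPotential_apply_zero, linearPotential_apply_zero]
  simp
  ring

theorem inner_eq_integral {d : ℕ} {Ω : Opens (EuclideanSpace ℝ (Fin d))} {f g : L2 Ω}
    {φ ψ : EuclideanSpace ℝ (Fin d) → ℂ}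
    (hf : f =ᵐ[volume.restrict (Ω : Set (EuclideanSpace ℝ (Fin d)))] φ)
    (hg : g =ᵐ[volume.restrict (Ω : Set (EuclideanSpace ℝ (Fin d)))] ψ)
    (h0 : ∀ z, z ∉ Ω → φ z = 0) :
    inner ℂ f g = ∫ z, starRingEnd ℂ (φ z) * ψ z := by
  rw [L2.inner_def, ← setIntegral_eq_integral_of_forall_compl_eq_zero
    (f := fun z => starRingEnd ℂ (φ z) * ψ z) (s := Ω) (fun z hz => by rw [h0 z hz]; simp)]
  refine integral_congr_ae ?_
  filter_upwards [hf, hg] with z h1 h2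
  rw [h1, h2, RCLike.inner_apply, mul_comm]

/-- The magnetic field bounds the energy from below. -/
theorem mul_norm_sq_le_of_mem_magneticH10 (B : ℝ) {Ω : Opens (EuclideanSpace ℝ (Fin (n + 2)))}
    {p : magneticH1 Ω (linearPotential B)} (hp : p ∈ magneticH10 Ω (linearPotential B)) :
    B * ‖embedding Ω (linearPotential B) p‖ ^ 2 ≤
      ‖covariantGradient Ω (linearPotential B) p‖ ^ 2 := by
  have hcl : IsClosed {p : magneticH1 Ω (linearPotential B) |
      B * ‖embedding Ω (linearPotential B) p‖ ^ 2 ≤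
        ‖covariantGradient Ω (linearPotential B) p‖ ^ 2} :=
    isClosed_le (by fun_prop) (by fun_prop)
  refine closure_minimal (fun p hp => ?_) hcl hp
  obtain ⟨φ, hφ⟩ := hp
  rw [mem_ofPred_eq]
  have hA : ContDiff ℝ ∞ (linearPotential (n := n) B) := (linearPotential B).contDiff
  have hφs : ContDiff ℝ ∞ φ := φ.contDiff
  have hφc : HasCompactSupport φ := φ.hasCompactSupport
  have hG : ∀ j, covariantGradient Ω (linearPotential B) p j
      =ᵐ[volume.restrict (Ω : Set (EuclideanSpace ℝ (Fin (n + 2))))]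
        covDeriv (linearPotential B) j φ :=
    covariantGradient_ae_eq hA hφs hφc hφ
  have hz : ∀ z, z ∉ Ω → z ∉ tsupport φ := fun z hz h => hz (φ.tsupport_subset h)
  have hinner : ∀ i j, inner ℂ (covariantGradient Ω (linearPotential B) p i)
      (covariantGradient Ω (linearPotential B) p j) = ∫ z, starRingEnd ℂ (φ z) *
        covDeriv (linearPotential B) i (covDeriv (linearPotential B) j φ) z := fun i j => by
    rw [inner_eq_integral (hG i) (hG j) fun z h => covDeriv_eq_zero (hz z h) i]
    exact integral_conj_covDeriv_mul (linearPotential B).continuous (hφs.of_le (by simp)) hφc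
      ((contDiff_covDeriv hA hφs j).of_le (by simp)) i
  have hint : ∀ i j, Integrable fun z => starRingEnd ℂ (φ z) *
      covDeriv (linearPotential B) i (covDeriv (linearPotential B) j φ) z := fun i j =>
    ((Complex.continuous_conj.comp hφs.continuous).mul
      (contDiff_covDeriv hA (contDiff_covDeriv hA hφs j)
        i).continuous).integrable_of_hasCompactSupport
      (hφc.comp_left (g := starRingEnd ℂ) (map_zero _)).mul_right
  have hcomm : inner ℂ (covariantGradient Ω (linearPotential B) p 0)
      (covariantGradient Ω (linearPotential B) p 1) -
      inner ℂ (covariantGradient Ω (linearPotential B) p 1)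
      (covariantGradient Ω (linearPotential B) p 0) =
      Complex.I * B * (‖embedding Ω (linearPotential B) p‖ ^ 2 : ℝ) := by
    have h1 : ((‖embedding Ω (linearPotential B) p‖ ^ 2 : ℝ) : ℂ) =
        ∫ z, starRingEnd ℂ (φ z) * φ z := by
      rw [← inner_eq_integral hφ hφ fun z h => image_eq_zero_of_notMem_tsupport (hz z h),
        inner_self_eq_norm_sq_to_K]
      norm_cast
    rw [hinner, hinner, ← integral_sub (hint 0 1) (hint 1 0), h1, ← integral_const_mul]
    refine integral_congr_ae (Filter.Eventually.of_forall fun z => ?_)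
    have := covDeriv_commutator B hφs z
    simp only
    rw [← mul_sub, this]
    ring
  set G := covariantGradient Ω (linearPotential B) p with hGdef
  have h2 : ‖G 0‖ ^ 2 + ‖G 1‖ ^ 2 ≤ ‖G‖ ^ 2 := by
    rw [PiLp.norm_sq_eq_of_L2, Fin.sum_univ_succ, Fin.sum_univ_succ, Fin.succ_zero_eq_one,
      ← add_assoc]
    exact le_add_of_nonneg_right (Finset.sum_nonneg fun _ _ => sq_nonneg _)
  -- `‖(P₀ + i P₁)φ‖² = ‖P₀φ‖² + ‖P₁φ‖² - B ‖φ‖²`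
  have h3 := norm_add_sq (𝕜 := ℂ) (G 0) (Complex.I • G 1)
  rw [inner_smul_right, norm_smul, Complex.norm_I, one_mul] at h3
  have h4 : inner ℂ (G 1) (G 0) = starRingEnd ℂ (inner ℂ (G 0) (G 1)) :=
    (inner_conj_symm _ _).symm
  rw [h4, Complex.sub_conj] at hcomm
  have h5 := congrArg Complex.im hcomm
  simp [-Complex.ofReal_pow] at h5 h3
  nlinarith [sq_nonneg ‖G 0 + Complex.I • G 1‖]

end LowerBound

/-! ### Infinitely many Dirichlet eigenvalues -/

section InfiniteDimension

variable {d : ℕ}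

/-- Bump functions with disjoint supports span spaces of any finite dimension. -/
theorem not_finiteDimensional_testSubspace (hd : 0 < d) {Ω : Opens (EuclideanSpace ℝ (Fin d))}
    (hne : (Ω : Set (EuclideanSpace ℝ (Fin d))).Nonempty)
    {a : EuclideanSpace ℝ (Fin d) → EuclideanSpace ℝ (Fin d)} (ha : Continuous a) :
    ¬ FiniteDimensional ℂ (testSubspace Ω a) := by
  intro hfin
  have : NeZero d := ⟨hd.ne'⟩
  obtain ⟨x, hx⟩ := hne
  obtain ⟨s, hsΩ, hs⟩ := (infinite_of_mem_nhds x (Ω.isOpen.mem_nhds hx)).exists_subset_card_eq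
    (Module.finrank ℂ (testSubspace Ω a) + 1)
  obtain ⟨W, hW, hdisj⟩ := s.finite_toSet.t2_separation
  choose f hfs hfc hfd _ hf1 using fun y : s => exists_contDiff_tsupport_subset (n := ⊤)
    (((hW y).2.inter Ω.isOpen).mem_nhds ⟨(hW y).1, hsΩ y.2⟩)
  choose q hq hqf using fun y : s => exists_mem_testSubspace ha
    (realTest (f y) (hfd y) (hfc y) ((hfs y).trans inter_subset_right))
  have hli : LinearIndependent ℂ fun y : s => embedding Ω a (q y) := by
    refine linearIndependent_of_ne_zero_of_inner_eq_zero (fun y h0 => ?_) fun y y' hyy' => ?_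
    · have h1 : (fun z => (f y z : ℂ))
          =ᵐ[volume.restrict (Ω : Set (EuclideanSpace ℝ (Fin d)))] fun _ => 0 := by
        refine (hqf y).symm.trans ?_
        rw [h0]
        exact Lp.coeFn_zero ℂ 2 _
      have h2 := Measure.eqOn_open_of_ae_eq h1 Ω.isOpen
        (Complex.continuous_ofReal.comp (hfd y).continuous).continuousOn continuousOn_const
        (hsΩ y.2)
      simp [hf1] at h2
    · simp only [L2.inner_def]
      refine integral_eq_zero_of_ae ?_
      filter_upwards [hqf y, hqf y'] with z h1 h2
      rw [h1, h2]
      change inner ℂ (f y z : ℂ) (f y' z : ℂ) = 0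
      by_cases hz : z ∈ W y
      · have : f y' z = 0 := by
          by_contra h0
          exact (hdisj y.2 y'.2 fun h => hyy' (Subtype.ext h)).notMem_of_mem_left hz
            (hfs y' (subset_tsupport _ h0)).1
        simp [this]
      · have : f y z = 0 := by
          by_contra h0
          exact hz (hfs y (subset_tsupport _ h0)).1
        simp [this]
  have hli' : LinearIndependent ℂ fun y : s => (⟨q y, hq y⟩ : testSubspace Ω a) :=
    LinearIndependent.of_comp
      ((embedding Ω a).toLinearMap ∘ₗ (testSubspace Ω a).subtype) hli
  have := hli'.fintype_card_le_finrank
  simp [hs] at this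

end InfiniteDimension

/-! ### Eigenvalues of the Dirichlet and Neumann operators -/

section Operators

variable {d : ℕ} {Ω : Opens (EuclideanSpace ℝ (Fin d))}
  {a : EuclideanSpace ℝ (Fin d) → EuclideanSpace ℝ (Fin d)} {Λ : ℝ} {S : Set ℝ}

theorem testSubspace_le_magneticH10 : testSubspace Ω a ≤ magneticH10 Ω a :=
  Submodule.le_topologicalClosure _

theorem eigenvalueCount_dirichletOperator (ha : ContDiff ℝ ∞ a)
    (hc : IsCompactOperator (embedding Ω a)) (hS : S ⊆ Iic Λ) :
    eigenvalueCount (dirichletOperator Ω a) S =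
      (Module.finrank ℂ (weakSpan (magneticH10 Ω a) S) : ℕ∞) := by
  have := finiteDimensional_weakSpan (Q := magneticH10 Ω a) ha hc
    (Submodule.isClosed_topologicalClosure _) hS
  exact eigenvalueCount_formOperator ha.continuous testSubspace_le_magneticH10 S

theorem eigenvalueCount_neumannOperator (ha : ContDiff ℝ ∞ a)
    (hc : IsCompactOperator (embedding Ω a)) (hS : S ⊆ Iic Λ) :
    eigenvalueCount (neumannOperator Ω a) S =
      (Module.finrank ℂ (weakSpan (⊤ : Submodule ℂ (magneticH1 Ω a)) S) : ℕ∞) := by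
  have := finiteDimensional_weakSpan (Q := (⊤ : Submodule ℂ (magneticH1 Ω a))) ha hc
    isClosed_univ hS
  exact eigenvalueCount_formOperator ha.continuous le_top S

theorem exists_isNthEigenvalue_dirichletOperator (hd : 0 < d)
    (hne : (Ω : Set (EuclideanSpace ℝ (Fin d))).Nonempty) (ha : ContDiff ℝ ∞ a)
    (hc : IsCompactOperator (embedding Ω a)) {j : ℕ} (hj : 1 ≤ j) :
    ∃ μ, weakEigenspace (magneticH10 Ω a) μ ≠ ⊥ ∧
      IsNthEigenvalue (dirichletOperator Ω a) j μ := by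
  have hcl : IsClosed (magneticH10 Ω a : Set (magneticH1 Ω a)) :=
    Submodule.isClosed_topologicalClosure _
  have := completeSpace_of_isClosed ha hcl
  have hc' := isCompactOperator_formEmbedding hc (magneticH10 Ω a)
  have hinf : ¬ FiniteDimensional ℂ (magneticH10 Ω a) := fun _ =>
    not_finiteDimensional_testSubspace hd hne ha.continuous
      (Submodule.finiteDimensional_of_le testSubspace_le_magneticH10)
  obtain ⟨Λ, hΛ⟩ := (isFormPair (magneticH10 Ω a)).exists_le_finrank hc' hinf j
  obtain ⟨μ, -, h0, h1, h2⟩ := (isFormPair (magneticH10 Ω a)).exists_nth hc' Subset.rfl hj hΛ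
  refine ⟨μ, h0, ?_, ?_⟩
  · rw [eigenvalueCount_dirichletOperator ha hc Iio_subset_Iic_self]
    exact_mod_cast h1
  · rw [eigenvalueCount_dirichletOperator ha hc Subset.rfl]
    exact_mod_cast h2

theorem exists_isNthEigenvalue_neumannOperator_lt (ha : ContDiff ℝ ∞ a)
    (hc : IsCompactOperator (embedding Ω a)) {j : ℕ} (hj : 1 ≤ j)
    (h : j ≤ Module.finrank ℂ (weakSpan (⊤ : Submodule ℂ (magneticH1 Ω a)) (Iio Λ))) :
    ∃ μ < Λ, IsNthEigenvalue (neumannOperator Ω a) j μ := by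
  have hcl : IsClosed ((⊤ : Submodule ℂ (magneticH1 Ω a)) : Set (magneticH1 Ω a)) := isClosed_univ
  have := completeSpace_of_isClosed ha hcl
  obtain ⟨μ, ⟨ν, hν, hμν⟩, -, h1, h2⟩ := (isFormPair (⊤ : Submodule ℂ (magneticH1 Ω a))).exists_nth
    (isCompactOperator_formEmbedding hc ⊤) (Iio_subset_Iic_self (a := Λ)) hj h
  refine ⟨μ, hμν.trans_lt hν, ?_, ?_⟩
  · rw [eigenvalueCount_neumannOperator ha hc Iio_subset_Iic_self]
    exact_mod_cast h1
  · rw [eigenvalueCount_neumannOperator ha hc Subset.rfl]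
    exact_mod_cast h2

theorem le_of_weakEigenspace_magneticH10_ne_bot {n : ℕ} {B μ : ℝ}
    {Ω : Opens (EuclideanSpace ℝ (Fin (n + 2)))}
    (h : weakEigenspace (magneticH10 Ω (linearPotential B)) μ ≠ ⊥) : B ≤ μ := by
  obtain ⟨p, hp, hp0⟩ := Submodule.exists_mem_ne_zero_of_ne_bot h
  have h1 := mul_norm_sq_le_of_mem_magneticH10 B p.2
  have h2 : ‖covariantGradient Ω (linearPotential B) p‖ ^ 2 ≤
      μ * ‖embedding Ω (linearPotential B) p‖ ^ 2 :=
    norm_sq_le_of_mem_weakSpan (formEigenspace_le_formSpan (mem_Iic.2 le_rfl) hp)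
  have h3 : embedding Ω (linearPotential B) p ≠ 0 := fun h3 =>
    hp0 (Subtype.ext (magneticH1_ext (h3.trans (map_zero _).symm)))
  exact le_of_mul_le_mul_right (h1.trans h2) (by positivity)

theorem le_eigenvalueCount_neumannOperator_of_landauState {n : ℕ} {B : ℝ} (hB : 0 < B)
    {Ω : Opens (EuclideanSpace ℝ (Fin (n + 2)))}
    (hne : (Ω : Set (EuclideanSpace ℝ (Fin (n + 2)))).Nonempty)
    (hΩ : volume (Ω : Set (EuclideanSpace ℝ (Fin (n + 2)))) < ⊤)
    (hc : IsCompactOperator (embedding Ω (linearPotential B))) {m j : ℕ}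
    (hj : (j : ℕ∞) ≤ eigenvalueCount (dirichletOperator Ω (linearPotential B))
      (Iic (B * (2 * (m + 1 : ℕ) - 1)))) :
    ((j + 1 : ℕ) : ℕ∞) ≤ eigenvalueCount (neumannOperator Ω (linearPotential B))
      (Iio (B * (2 * (m + 1 : ℕ) - 1))) := by
  have h := finrank_dirichlet_lt_finrank_neumann_of_landauState hB hne hΩ hc (b := 0) rfl rfl m
    (Λ := B * (2 * (m + 1 : ℕ) - 1)) (by rw [norm_zero]; push_cast; ring)
  have h1 := hj.trans_eq
    (eigenvalueCount_dirichletOperator (linearPotential B).contDiff hc Subset.rfl)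
  exact (Nat.cast_le.2 ((Nat.add_le_add_right (Nat.cast_le.1 h1) 1).trans h)).trans_eq
    (eigenvalueCount_neumannOperator (linearPotential B).contDiff hc Iio_subset_Iic_self).symm

theorem exists_isNthEigenvalue_neumannOperator_lt_dirichletOperator {n : ℕ} {B : ℝ} (hB : 0 < B)
    {Ω : Opens (EuclideanSpace ℝ (Fin (n + 1 + 2)))}
    (hne : (Ω : Set (EuclideanSpace ℝ (Fin (n + 1 + 2)))).Nonempty)
    (hΩ : volume (Ω : Set (EuclideanSpace ℝ (Fin (n + 1 + 2)))) < ⊤)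
    (hc : IsCompactOperator (embedding Ω (linearPotential B))) {j : ℕ} (hj : 1 ≤ j) :
    ∃ lamN lamD : ℝ, IsNthEigenvalue (neumannOperator Ω (linearPotential B)) (j + 1) lamN ∧
      IsNthEigenvalue (dirichletOperator Ω (linearPotential B)) j lamD ∧ lamN < lamD := by
  have hA := (linearPotential (n := n + 1) B).contDiff (𝕜 := ℝ) (n := ∞)
  obtain ⟨lamD, h0, hD⟩ :=
    exists_isNthEigenvalue_dirichletOperator (Nat.succ_pos _) hne hA hc hj
  have hBD := le_of_weakEigenspace_magneticH10_ne_bot h0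
  -- The momentum along the field lifts the lowest Landau level to `lamD`.
  set b : EuclideanSpace ℝ (Fin (n + 1 + 2)) :=
    EuclideanSpace.single (Fin.succ (Fin.succ 0)) √(lamD - B) with hb
  have hb0 : b 0 = 0 := by
    rw [hb, PiLp.single_apply, if_neg (Fin.succ_ne_zero _).symm]
  have hb1 : b 1 = 0 := by
    rw [hb, PiLp.single_apply, if_neg fun h => Fin.succ_ne_zero _ (Fin.succ_injective _ h.symm)]
  have hlam : B * (2 * ((0 : ℕ) : ℝ) + 1) + ‖b‖ ^ 2 = lamD := by
    rw [hb, PiLp.norm_single, Real.norm_eq_abs, sq_abs, Real.sq_sqrt (sub_nonneg.2 hBD)]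
    push_cast
    ring
  have h := finrank_dirichlet_lt_finrank_neumann_of_landauState hB hne hΩ hc hb0 hb1 0 hlam
  have hj' := hD.2.trans_eq (eigenvalueCount_dirichletOperator hA hc Subset.rfl)
  obtain ⟨lamN, hlt, hN⟩ := exists_isNthEigenvalue_neumannOperator_lt hA hc
    (Nat.le_add_left 1 j) ((Nat.add_le_add_right (Nat.cast_le.1 hj') 1).trans h)
  exact ⟨lamN, lamD, hN, hD, hlt⟩

theorem smul_potential2 (B : ℝ) : B • potential2 = linearPotential (n := 0) B := by
  ext z j
  fin_cases j
  · change B * (-(z 1) / 2) = linearPotential B z 0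
    rw [linearPotential_apply_zero]
    ring
  · change B * (z 0 / 2) = linearPotential B z 1
    rw [linearPotential_apply_one]
    ring

theorem smul_potential3 (B : ℝ) : B • potential3 = linearPotential (n := 1) B := by
  ext z j
  fin_cases j
  · change B * (-(z 1) / 2) = linearPotential B z 0
    rw [linearPotential_apply_zero]
    ring
  · change B * (z 0 / 2) = linearPotential B z 1
    rw [linearPotential_apply_one]
    ring
  · change B * 0 = linearPotential B z (Fin.succ (Fin.succ 0))
    rw [linearPotential_apply_succ_succ, mul_zero]

end Operators

end Landau

end

theorem theorem3p1 (B : ℝ) (hB : 0 < B) :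
    (∀ Ω : TopologicalSpace.Opens (EuclideanSpace ℝ (Fin 2)),
      IsConnected (Ω : Set (EuclideanSpace ℝ (Fin 2))) →
      MeasureTheory.volume (Ω : Set (EuclideanSpace ℝ (Fin 2))) < ⊤ →
      IsCompactOperator (Landau.embedding Ω (B • Landau.potential2)) →
      ∀ k : ℕ, 1 ≤ k → ∀ j : ℕ,
        (j : ℕ∞) ≤ Landau.eigenvalueCount (Landau.dirichletOperator Ω (B • Landau.potential2))
          (Set.Iic (B * (2 * (k : ℝ) - 1))) →
        ((j + 1 : ℕ) : ℕ∞) ≤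
          Landau.eigenvalueCount (Landau.neumannOperator Ω (B • Landau.potential2))
            (Set.Iio (B * (2 * (k : ℝ) - 1)))) ∧
    (∀ Ω : TopologicalSpace.Opens (EuclideanSpace ℝ (Fin 3)),
      IsConnected (Ω : Set (EuclideanSpace ℝ (Fin 3))) →
      MeasureTheory.volume (Ω : Set (EuclideanSpace ℝ (Fin 3))) < ⊤ →
      IsCompactOperator (Landau.embedding Ω (B • Landau.potential3)) →
      ∀ j : ℕ, 1 ≤ j → ∃ lamN lamD : ℝ,
        Landau.IsNthEigenvalue (Landau.neumannOperator Ω (B • Landau.potential3)) (j + 1) lamN ∧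
        Landau.IsNthEigenvalue (Landau.dirichletOperator Ω (B • Landau.potential3)) j lamD ∧
        lamN < lamD) := by
  rw [Landau.smul_potential2, Landau.smul_potential3]
  refine ⟨fun Ω hΩc hΩ hc k hk j hj => ?_, fun Ω hΩc hΩ hc j hj => ?_⟩
  · obtain ⟨m, rfl⟩ := Nat.exists_eq_add_of_le' hk
    exact Landau.le_eigenvalueCount_neumannOperator_of_landauState (n := 0) hB hΩc.nonempty hΩ hc hj
  · exact Landau.exists_isNthEigenvalue_neumannOperator_lt_dirichletOperator (n := 0) hB
      hΩc.nonempty hΩ hc hj
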